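/- Let $N\ge 1$, and let $\theta$ be a positive real number or a formal variable; the coefficient field $K$ is any field containing $\mathbb C$ in which $\theta$ is, respectively, a positive real number or transcendental over $\mathbb C$ (e.g. $K=\mathbb C$, respectively $K=\mathbb C(\theta)$). On $K[x_1,\dots,x_N]$ let the symmetric group $S_N$ permute the variables, and put $$\mathcal D_i=\frac{\partial}{\partial x_i}+\theta\sum_{j\ne i}\frac{1-(i,j)}{x_i-x_j},\qquad \mathcal P_m=\sum_{i=1}^N (x_i\mathcal D_i)^m,\quad m\ge 1.$$ For an exponent vector $\gamma$ let $\gamma^+$ be its nonincreasing rearrangement. For a partition $\lambda=(\lambda_1\ge\dots\ge\lambda_N\ge0)$ let $V_\lambda$ be the span of the monomials $x^\gamma$ with $\gamma^+=\lambda$, and for a partition $\tau$ of $N$ let $V_{\lambda;\tau}$ be the isotypic component in $V_\lambda$ of the irreducible representation of $S_N$ labelled by $\tau$ (with $\tau=(N)$ the trivial representation). Say that a polynomial $F$ is an eigenfunction attached to $(\lambda,\tau)$ if it is an eigenvector of every $\mathcal P_m$, $m\ge1$, is homogeneous of degree $|\lambda|$, contains only monomials $x^\gamma$ with $\gamma^+\preceq\lambda$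 in the dominance order, and its part in $V_\lambda$ is nonzero and lies in $V_{\lambda;\tau}$. Let $0\le\eta\le N$, let $a>b\ge0$ be integers and let $\lambda=(a,\dots,a,b,\dots,b)$ with $N-\eta$ entries $a$ and $\eta$ entries $b$. Then: 1. For $0\le k\le\min(\eta,N-\eta)$ the component $V_{\lambda;(N-k,k)}$ is irreducible, isomorphic to the representation labelled by $(N-k,k)$ (that is, the multiplicity is one); $V_{\lambda;\tau}=0$ for every other partition $\tau$ of $N$; and $V_\lambda=\bigoplus_{k=0}^{\min(\eta,N-\eta)}V_{\lambda;(N-k,k)}$. 2. For $0\le k\le\min(\eta,N-\eta)$ every nonzero element of $V_{\lambda;(N-k,k)}$ is the part in $V_\lambda$ of some eigenfunction attached to $(\lambda,(N-k,k))$, and every eigenfunction $F$ attached to $(\lambda,(N-k,k))$ satisfies, for all $m\ge1$, $$\mathcal P_mF=\Bigl[(a+\theta\eta)^m(N-\eta)+b^m\eta-\theta\,\frac{(a+\theta\eta)^m-b^m}{a+\theta\eta-b}\,\bigl(\eta(N-\eta)-k(N-k+1)\bigr)\Bigr]F.$$ -/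

import Mathlib

open MvPolynomial

noncomputable section

namespace HP

/-- The nonincreasing rearrangement `γ⁺` of a tuple `γ` of exponents. -/
def sortDesc {N : ℕ} (γ : Fin N → ℕ) : Fin N → ℕ :=
  fun i => γ (Tuple.sort γ (Fin.rev i))

theorem sortDesc_comp_perm {N : ℕ} (γ : Fin N → ℕ) (σ : Equiv.Perm (Fin N)) :
    sortDesc (γ ∘ σ) = sortDesc γ := by
  funext i
  exact congrFun (Tuple.comp_perm_comp_sort_eq_comp_sort (f := γ) (σ := σ)) (Fin.rev i)

/-- The (reflexive) dominance order `μ ≼ ν` on nonincreasing tuples of length `N`. -/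
def DominanceLE {N : ℕ} (μ ν : Fin N → ℕ) : Prop :=
  ∑ i, μ i = ∑ i, ν i ∧
    ∀ k : ℕ, k ≤ N → ∑ i with i.val < k, μ i ≤ ∑ i with i.val < k, ν i

/-- The partition `(a, …, a, b, …, b)` with `N - η` entries `a` followed by `η` entries `b`. -/
def twoValued (N η a b : ℕ) : Fin N → ℕ :=
  fun i => if i.val < N - η then a else b

/-- The Young diagram with rows of lengths `p` and `q`, meant for `q ≤ p`
(`q` may be zero, and then there is no second row). -/
def twoRow (p q : ℕ) : YoungDiagram :=
  YoungDiagram.ofRowLens [p, min p q] (by simp [List.sortedGE_iff_pairwise])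

section Operators

variable {K : Type*} [Field K] {N : ℕ}

/-- The exchange of the variables `x i` and `x j`. -/
def swapVars (i j : Fin N) : MvPolynomial (Fin N) K →ₐ[K] MvPolynomial (Fin N) K :=
  rename (Equiv.swap i j)

theorem dvd_sub_swapVars (i j : Fin N) (f : MvPolynomial (Fin N) K) :
    (X i - X j) ∣ f - swapVars i j f := by
  induction f using MvPolynomial.induction_on with
  | C c => simp [swapVars]
  | add p q hp hq =>
    have h : p + q - swapVars i j (p + q)
        = (p - swapVars i j p) + (q - swapVars i j q) := by
      rw [map_add]; ring
    rw [h]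
    exact dvd_add hp hq
  | mul_X p n hp =>
    have h : p * X n - swapVars i j (p * X n)
        = (p - swapVars i j p) * X n + swapVars i j p * (X n - X (Equiv.swap i j n)) := by
      rw [map_mul]; simp only [swapVars, rename_X]; ring
    rw [h]
    refine dvd_add (Dvd.dvd.mul_right hp _) (Dvd.dvd.mul_left ?_ _)
    rcases eq_or_ne n i with rfl | hi
    · simp
    · rcases eq_or_ne n j with rfl | hj
      · rw [Equiv.swap_apply_right, ← neg_sub (X i), dvd_neg]
      · simp [Equiv.swap_apply_of_ne_of_ne hi hj]

theorem X_sub_X_ne_zero {i j : Fin N} (h : i ≠ j) :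
    (X i - X j : MvPolynomial (Fin N) K) ≠ 0 :=
  sub_ne_zero.mpr fun e => h (X_injective e)

/-- The operator `(1 - (i,j)) / (x i - x j)` for `i ≠ j`: the quotient is the polynomial `g` with
`f - (i,j) f = (x i - x j) g`. -/
def divDiff (i j : Fin N) (h : i ≠ j) :
    MvPolynomial (Fin N) K →ₗ[K] MvPolynomial (Fin N) K where
  toFun f := (dvd_sub_swapVars i j f).choose
  map_add' f g := by
    apply mul_left_cancel₀ (X_sub_X_ne_zero (K := K) h)
    rw [mul_add, ← (dvd_sub_swapVars i j (f + g)).choose_spec,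
      ← (dvd_sub_swapVars i j f).choose_spec, ← (dvd_sub_swapVars i j g).choose_spec, map_add]
    ring
  map_smul' c f := by
    apply mul_left_cancel₀ (X_sub_X_ne_zero (K := K) h)
    rw [RingHom.id_apply, mul_smul_comm, ← (dvd_sub_swapVars i j (c • f)).choose_spec,
      ← (dvd_sub_swapVars i j f).choose_spec, map_smul, smul_sub]

theorem X_sub_X_mul_divDiff (i j : Fin N) (h : i ≠ j) (f : MvPolynomial (Fin N) K) :
    (X i - X j) * divDiff i j h f = f - swapVars i j f :=
  (dvd_sub_swapVars i j f).choose_spec.symm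

/-- The Dunkl operator `D i = ∂/∂x i + θ ∑_{j ≠ i} (1 - (i,j)) / (x i - x j)`. -/
def dunkl (θ : K) (i : Fin N) : MvPolynomial (Fin N) K →ₗ[K] MvPolynomial (Fin N) K :=
  (pderiv i).toLinearMap + θ • ∑ j : {j : Fin N // i ≠ j}, divDiff i j.1 j.2

/-- The Heckman–Polychronakos operator `P m = ∑ i, (x i D i) ^ m`. -/
def heckmanPolychronakos (θ : K) (m : ℕ) : Module.End K (MvPolynomial (Fin N) K) :=
  ∑ i : Fin N, (LinearMap.mulLeft K (X i) ∘ₗ dunkl θ i : Module.End K (MvPolynomial (Fin N) K)) ^ m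

end Operators

section Representations

variable (K : Type*) [Field K] (N : ℕ)

/-- The action of the symmetric group on polynomials by permuting the variables,
`σ · x i = x (σ i)`. -/
def permRep : Representation K (Equiv.Perm (Fin N)) (MvPolynomial (Fin N) K) where
  toFun σ := (rename σ).toLinearMap
  map_one' := by
    apply LinearMap.ext
    intro f
    simp [Equiv.Perm.coe_one]
  map_mul' σ τ := by
    apply LinearMap.ext
    intro f
    simp [rename_rename, Function.comp_def]

variable {K N}

/-- The representation `V_λ` spanned by the monomials `x^γ` with `γ⁺ = lam`. -/
def monomialRep (lam : Fin N → ℕ) : Subrepresentation (permRep K N) where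
  toSubmodule := Submodule.span K
    {f | ∃ γ : Fin N →₀ ℕ, sortDesc γ = lam ∧ f = monomial γ 1}
  apply_mem_toSubmodule σ f hf := by
    induction hf using Submodule.span_induction with
    | mem x hx =>
      obtain ⟨γ, hγ, rfl⟩ := hx
      refine Submodule.subset_span ⟨γ.mapDomain σ, ?_, ?_⟩
      · rw [← hγ, ← sortDesc_comp_perm (γ.mapDomain σ) σ]
        congr 1
        funext i
        exact Finsupp.mapDomain_apply σ.injective γ i
      · simp [permRep, rename_monomial]
    | zero => simp
    | add x y _ _ hx hy => rw [map_add]; exact add_mem hx hy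
    | smul c x _ hx => rw [map_smul]; exact Submodule.smul_mem _ c hx

/-- The Specht polynomial of a bijective filling `t` of the cells of `τ`: the product of the
Vandermonde products of the columns. -/
def spechtPoly (τ : YoungDiagram) (t : {c // c ∈ τ.cells} ≃ Fin N) : MvPolynomial (Fin N) K :=
  ∏ p : {c // c ∈ τ.cells}, ∏ q : {c // c ∈ τ.cells} with
    p.1.2 = q.1.2 ∧ p.1.1 < q.1.1, (X (t p) - X (t q))

/-- The irreducible representation of the symmetric group labelled by a partition `τ` of `N`,
realized as the span of the Specht polynomials of shape `τ`. One row gives the trivial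
representation, one column the sign representation. -/
def specht (τ : YoungDiagram) : Subrepresentation (permRep K N) where
  toSubmodule := Submodule.span K (Set.range (spechtPoly (K := K) (N := N) τ))
  apply_mem_toSubmodule σ f hf := by
    induction hf using Submodule.span_induction with
    | mem x hx =>
      obtain ⟨t, rfl⟩ := hx
      refine Submodule.subset_span ⟨t.trans σ, ?_⟩
      simp [permRep, spechtPoly]
    | zero => simp
    | add x y _ _ hx hy => rw [map_add]; exact add_mem hx hy
    | smul c x _ hx => rw [map_smul]; exact Submodule.smul_mem _ c hx

/-- `V_{λ;τ}`: the `τ`-isotypic component of `V_λ`, the sum of all subrepresentations of `V_λ`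
isomorphic to the irreducible representation labelled by `τ`. -/
def isotypic (lam : Fin N → ℕ) (τ : YoungDiagram) : Subrepresentation (permRep K N) where
  toSubmodule := ⨆ U : {U : Subrepresentation (permRep K N) // U ≤ monomialRep lam ∧
    Nonempty (U.toRepresentation.Equiv (specht (K := K) (N := N) τ).toRepresentation)},
      U.1.toSubmodule
  apply_mem_toSubmodule σ f hf := by
    induction hf using Submodule.iSup_induction' with
    | mem U x hx => exact Submodule.mem_iSup_of_mem U (U.1.apply_mem_toSubmodule σ hx)
    | zero => simp
    | add x y _ _ hx hy => rw [map_add]; exact add_mem hx hy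

/-- The part of `F` spanned by the monomials in `V_λ`. -/
def leadingPart (lam : Fin N → ℕ) (F : MvPolynomial (Fin N) K) : MvPolynomial (Fin N) K :=
  ∑ γ ∈ F.support.filter (fun γ : Fin N →₀ ℕ => sortDesc γ = lam), monomial γ (F.coeff γ)

/-- `F` is one of the joint eigenfunctions of all `P m`, `m ≥ 1`, attached to `λ` and `τ`:
it is homogeneous of degree `|λ|`, all its monomials `x^γ` satisfy `γ⁺ ≼ λ`, and its part in `V_λ`
is nonzero and lies in `V_{λ;τ}`. -/
structure IsJointEigenfunction (θ : K) (lam : Fin N → ℕ) (τ : YoungDiagram)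
    (F : MvPolynomial (Fin N) K) : Prop where
  eigen : ∀ m : ℕ, 1 ≤ m → ∃ c : K, heckmanPolychronakos θ m F = c • F
  homogeneous : F.IsHomogeneous (∑ i, lam i)
  dominated : ∀ γ ∈ F.support, DominanceLE (sortDesc γ) lam
  leading_ne_zero : leadingPart lam F ≠ 0
  leading_mem : leadingPart lam F ∈ (isotypic lam τ).toSubmodule

end Representations

end HP

end

open HP

/-! The proof has three independent ingredients.

Representation theory. `V_λ` is the permutation module on the subsets `A` of size `N - η`, where `A`
marks the positions of the exponent `a`. A nonzero subrepresentation contains a nonzero vector fixed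
by the stabilizer of one subset `A₀`, and these fixed vectors form a space of dimension at most `min
η (N - η) + 1`, one dimension for each value of `|A \ A₀|`. So at most that many independent nonzero
subrepresentations fit (`iSup_eq_monomialRep`). Evaluating Specht polynomials of shape `(N - k, k)`
at indicator vectors (`slice`) produces exactly that many. They are independent because the sum of
all transpositions, `swapSum`, acts on them by distinct scalars (`IsHarmonic.swapSum_eq`). Hence
they exhaust `V_λ`, and since none can be shrunk they are irreducible. Other two-row shapes are
excluded by the scalar. Shapes with three rows are excluded because two exponent values leave no
room for antisymmetry in three variables.

Leading terms. Write `p_i = x_i D_i`. Modulo monomials strictly below `λ`, the operator `p_i`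
multiplies `x^A` by `a + θη` if `i ∈ A`. If `i ∉ A` it gives `b x^A` minus `θ` times a sum of
monomials on which `p_i` is the scalar `a + θη`. Powers of this triangular action produce the
divided difference of `t ↦ t^m` at `a + θη` and `b`. Summed over `i`, the leading part of `P_m` is
an affine function of `swapSum`, hence a scalar on each component (`heckmanPolychronakos_smodEq`).

Lifting. The sum of squares of the Cherednik operators, `calogero`, commutes with every `p_i` and is
triangular for dominance. Its diagonal entry, `energy`, takes at `λ` a value that it takes at no
strictly lower partition. So each `v` in `V_λ` has a correction by lower terms making it an
eigenvector of `calogero` (`exists_calogero_sub_eq`), and such an eigenvector is determined by its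
leading part (`eq_zero_of_calogero_eq`). As `P_m` commutes with `calogero` and is a scalar on the
leading part, it is the same scalar on the corrected polynomial. Conversely, the eigenvalue of any
eigenfunction can be read off from its leading part. -/

namespace HP

/-! ### Commutation relations of Dunkl and Polychronakos operators -/

section DunklRelations

variable {K : Type*} [Field K] {N : ℕ}

/-- `divDiff` extended by zero to the diagonal. -/
noncomputable def dividedDiff (i j : Fin N) : Module.End K (MvPolynomial (Fin N) K) :=
  if h : i ≠ j then divDiff i j h else 0

theorem dividedDiff_self (i : Fin N) : dividedDiff (K := K) i i = 0 := by simp [dividedDiff]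

theorem X_sub_X_mul_dividedDiff (i j : Fin N) (f : MvPolynomial (Fin N) K) :
    (X i - X j) * dividedDiff i j f = f - rename (Equiv.swap i j) f := by
  by_cases h : i = j
  · subst h; simp
  · rw [dividedDiff, dif_pos h, X_sub_X_mul_divDiff]; rfl

theorem eq_dividedDiff {i j : Fin N} (h : i ≠ j) {f g : MvPolynomial (Fin N) K}
    (hg : (X i - X j) * g = f - rename (Equiv.swap i j) f) : dividedDiff i j f = g :=
  mul_left_cancel₀ (X_sub_X_ne_zero h) ((X_sub_X_mul_dividedDiff i j f).trans hg.symm)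

theorem dunkl_apply (θ : K) (i : Fin N) (f : MvPolynomial (Fin N) K) :
    dunkl θ i f = pderiv i f + θ • ∑ j, dividedDiff i j f := by
  have h : ∑ j : {j : Fin N // i ≠ j}, divDiff (K := K) i j.1 j.2 = ∑ j, dividedDiff i j := by
    rw [← Finset.sum_subset (Finset.subset_univ (Finset.univ.filter fun j => i ≠ j)),
      Finset.sum_subtype _ (p := fun j => i ≠ j) (by simp)]
    · exact Finset.sum_congr rfl fun j _ => by rw [dividedDiff, dif_pos j.2]
    · intro j _ hj
      have : i = j := by simpa using hj
      rw [← this, dividedDiff_self]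
  rw [dunkl, h]
  simp [LinearMap.sum_apply]

theorem dividedDiff_X_mul_of_ne {i j l : Fin N} (hi : l ≠ i) (hj : l ≠ j)
    (f : MvPolynomial (Fin N) K) : dividedDiff i j (X l * f) = X l * dividedDiff i j f := by
  rcases eq_or_ne i j with rfl | h
  · simp [dividedDiff_self]
  · apply eq_dividedDiff h
    rw [map_mul, rename_X, Equiv.swap_apply_of_ne_of_ne hi hj, mul_left_comm,
      X_sub_X_mul_dividedDiff]
    ring

theorem dividedDiff_X_mul_right {i j : Fin N} (h : i ≠ j) (f : MvPolynomial (Fin N) K) :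
    dividedDiff i j (X j * f) = X j * dividedDiff i j f - rename (Equiv.swap i j) f := by
  apply eq_dividedDiff h
  rw [map_mul, rename_X, Equiv.swap_apply_right, mul_sub, mul_left_comm,
    X_sub_X_mul_dividedDiff]
  ring

theorem dividedDiff_X_mul_left {i j : Fin N} (h : i ≠ j) (f : MvPolynomial (Fin N) K) :
    dividedDiff i j (X i * f) = X i * dividedDiff i j f + rename (Equiv.swap i j) f := by
  apply eq_dividedDiff h
  rw [map_mul, rename_X, Equiv.swap_apply_left, mul_add, mul_left_comm,
    X_sub_X_mul_dividedDiff]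
  ring

theorem rename_rename_swap (σ : Equiv.Perm (Fin N)) (i j : Fin N) (f : MvPolynomial (Fin N) K) :
    rename σ (rename (Equiv.swap i j) f) = rename (Equiv.swap (σ i) (σ j)) (rename σ f) := by
  rw [rename_rename, rename_rename]
  congr 2
  funext x
  simp only [Function.comp_apply]
  exact (σ.injective.swap_apply i j x).symm

theorem rename_dividedDiff (σ : Equiv.Perm (Fin N)) (i j : Fin N) (f : MvPolynomial (Fin N) K) :
    rename σ (dividedDiff i j f) = dividedDiff (σ i) (σ j) (rename σ f) := by
  rcases eq_or_ne i j with rfl | h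
  · simp [dividedDiff_self]
  · symm
    apply eq_dividedDiff (σ.injective.ne h)
    rw [← rename_rename_swap, ← map_sub, ← X_sub_X_mul_dividedDiff, map_mul, map_sub, rename_X,
      rename_X]

theorem rename_pderiv (σ : Equiv.Perm (Fin N)) (i : Fin N) (f : MvPolynomial (Fin N) K) :
    rename σ (pderiv i f) = pderiv (σ i) (rename σ f) :=
  (pderiv_rename σ.injective i f).symm

theorem rename_dunkl (θ : K) (σ : Equiv.Perm (Fin N)) (i : Fin N) (f : MvPolynomial (Fin N) K) :
    rename σ (dunkl θ i f) = dunkl θ (σ i) (rename σ f) := by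
  rw [dunkl_apply, dunkl_apply, map_add, rename_pderiv, map_smul, map_sum,
    ← Equiv.sum_comp σ (fun j => dividedDiff (σ i) j (rename σ f))]
  simp only [rename_dividedDiff]

theorem dunkl_X_mul_of_ne (θ : K) {i l : Fin N} (h : i ≠ l) (f : MvPolynomial (Fin N) K) :
    dunkl θ i (X l * f) = X l * dunkl θ i f - θ • rename (Equiv.swap i l) f := by
  have h1 : ∀ j, dividedDiff i j (X l * f)
      = X l * dividedDiff i j f - if j = l then rename (Equiv.swap i l) f else 0 := by
    intro j
    by_cases hj : j = l
    · subst hj; simp [dividedDiff_X_mul_right h]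
    · simp [hj, dividedDiff_X_mul_of_ne (Ne.symm h) (Ne.symm hj)]
  simp only [dunkl_apply, h1, Derivation.leibniz, pderiv_X_of_ne (Ne.symm h), smul_eq_mul,
    Finset.sum_sub_distrib, Finset.sum_ite_eq', Finset.mem_univ, if_true, ← Finset.mul_sum,
    smul_sub, mul_add, mul_smul_comm]
  ring

theorem dunkl_X_mul_self (θ : K) (i : Fin N) (f : MvPolynomial (Fin N) K) :
    dunkl θ i (X i * f) = X i * dunkl θ i f + f
      + θ • ∑ j with i ≠ j, rename (Equiv.swap i j) f := by
  have h1 : ∀ j, dividedDiff i j (X i * f)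
      = X i * dividedDiff i j f + if i ≠ j then rename (Equiv.swap i j) f else 0 := by
    intro j
    by_cases hj : i = j
    · subst hj; simp [dividedDiff_self]
    · simp [hj, dividedDiff_X_mul_left hj]
  simp only [dunkl_apply, h1, Derivation.leibniz, pderiv_X_self, smul_eq_mul,
    Finset.sum_add_distrib, ← Finset.sum_filter, ← Finset.mul_sum,
    smul_add, mul_add, mul_smul_comm]
  ring

theorem dunkl_C (θ : K) (i : Fin N) (c : K) : dunkl θ i (C c) = 0 := by
  have : ∀ j, dividedDiff i j (C c : MvPolynomial (Fin N) K) = 0 := by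
    intro j
    rcases eq_or_ne i j with rfl | h
    · simp [dividedDiff_self]
    · apply eq_dividedDiff h; simp
  simp [dunkl_apply, this]

/-- The inductive step for commutativity: a variable is moved through both operators. The case `l =
i` is left out because it follows by exchanging `i` and `j`. -/
theorem dunkl_comm_aux (θ : K) {i j : Fin N} (h : i ≠ j) (f : MvPolynomial (Fin N) K) (l : Fin N)
    (hf : dunkl θ i (dunkl θ j f) = dunkl θ j (dunkl θ i f)) (hl : l ≠ i) :
    dunkl θ i (dunkl θ j (X l * f)) = dunkl θ j (dunkl θ i (X l * f)) := by
  by_cases hj : l = j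
  · subst hj
    rw [dunkl_X_mul_self, dunkl_X_mul_of_ne θ h, map_add, map_add, map_sub, dunkl_X_mul_of_ne θ h,
      dunkl_X_mul_self, map_smul, map_smul, map_sum, hf, rename_dunkl, Equiv.swap_apply_right]
    have h3 : ∀ m, i ≠ m → l ≠ m → dunkl θ i (rename (Equiv.swap l m) f)
        = rename (Equiv.swap l m) (dunkl θ i f) := by
      intro m hm _
      rw [rename_dunkl, Equiv.swap_apply_of_ne_of_ne h hm]
    have h4 : dunkl θ l (rename (Equiv.swap i l) f) = rename (Equiv.swap i l) (dunkl θ i f) := by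
      rw [rename_dunkl, Equiv.swap_apply_left]
    -- The summand `m = i` is isolated: on either side it cancels against the correction term that
    -- comes from moving `X l` past `D i`.
    have hmem : i ∈ Finset.univ.filter fun m => l ≠ m := by simp [h.symm]
    rw [← Finset.add_sum_erase _ _ hmem, ← Finset.add_sum_erase _ _ hmem,
      Finset.sum_congr rfl (fun m hm => h3 m (by simp at hm; tauto) (by simp at hm; tauto)), h4,
      Equiv.swap_comm l i]
    simp only [smul_add]
    ring
  · rw [dunkl_X_mul_of_ne θ (Ne.symm hj), dunkl_X_mul_of_ne θ (Ne.symm hl), map_sub, map_sub,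
      dunkl_X_mul_of_ne θ (Ne.symm hj), dunkl_X_mul_of_ne θ (Ne.symm hl), hf, map_smul, map_smul,
      rename_dunkl, rename_dunkl, Equiv.swap_apply_of_ne_of_ne h (Ne.symm hl),
      Equiv.swap_apply_of_ne_of_ne h.symm (Ne.symm hj)]
    ring

theorem dunkl_comm (θ : K) (i j : Fin N) (f : MvPolynomial (Fin N) K) :
    dunkl θ i (dunkl θ j f) = dunkl θ j (dunkl θ i f) := by
  rcases eq_or_ne i j with rfl | h
  · rfl
  induction f using MvPolynomial.induction_on with
  | C c => simp [dunkl_C]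
  | add p q hp hq => simp only [map_add, hp, hq]
  | mul_X p l hp =>
    rw [mul_comm]
    by_cases hl : l = i
    · exact (dunkl_comm_aux θ h.symm p l hp.symm (by rw [hl]; exact h)).symm
    · exact dunkl_comm_aux θ h p l hp hl

/-- The Polychronakos operator `x i D i`. -/
noncomputable def polyOp (θ : K) (i : Fin N) : Module.End K (MvPolynomial (Fin N) K) :=
  LinearMap.mulLeft K (X i) ∘ₗ dunkl θ i

theorem polyOp_apply (θ : K) (i : Fin N) (f : MvPolynomial (Fin N) K) :
    polyOp θ i f = X i * dunkl θ i f := rfl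

theorem permRep_apply (σ : Equiv.Perm (Fin N)) (f : MvPolynomial (Fin N) K) :
    permRep K N σ f = rename σ f := rfl

theorem permRep_mul_polyOp (θ : K) (σ : Equiv.Perm (Fin N)) (i : Fin N) :
    permRep K N σ * polyOp θ i = polyOp θ (σ i) * permRep K N σ := by
  refine LinearMap.ext fun f => ?_
  simp only [Module.End.mul_apply, permRep_apply, polyOp_apply, map_mul, rename_X, rename_dunkl]

/-- The second-order terms cancel since the Dunkl operators commute; what remains comes from `D i`
passing `x j` and `D j` passing `x i`. -/
theorem polyOp_commutator (θ : K) {i j : Fin N} (h : i ≠ j) :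
    polyOp θ i * polyOp θ j - polyOp θ j * polyOp θ i
      = -(θ • ((polyOp θ i - polyOp θ j) * permRep K N (Equiv.swap i j))) := by
  refine LinearMap.ext fun f => ?_
  simp only [LinearMap.sub_apply, Module.End.mul_apply, polyOp_apply, LinearMap.neg_apply,
    LinearMap.smul_apply, permRep_apply, dunkl_X_mul_of_ne θ h, dunkl_X_mul_of_ne θ h.symm,
    rename_dunkl, dunkl_comm θ j i, Equiv.swap_apply_left, Equiv.swap_comm j i,
    Equiv.swap_apply_right, smul_eq_C_mul]
  ring

theorem heckmanPolychronakos_eq (θ : K) (m : ℕ) :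
    heckmanPolychronakos (N := N) θ m = ∑ i, polyOp θ i ^ m := rfl

end DunklRelations

/-! ### Cherednik operators: relations with adjacent transpositions -/

section Cherednik

variable {K R : Type*} [Field K] [Ring R] [Algebra K R] {n : ℕ}

/-- The Jucys–Murphy element `∑ j < i, (j,i)` in a ring with an action of the symmetric group. -/
noncomputable def jucysMurphy (s : Equiv.Perm (Fin n) →* R) (i : Fin n) : R :=
  ∑ j with j < i, s (Equiv.swap j i)

/-- The Cherednik operator `p i + θ ∑ j < i, (j,i)`. -/
noncomputable def cherednik (θ : K) (p : Fin n → R) (s : Equiv.Perm (Fin n) →* R) (i : Fin n) : R :=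
  p i + θ • jucysMurphy s i

theorem hom_mul_swap (s : Equiv.Perm (Fin n) →* R) (σ : Equiv.Perm (Fin n)) (i j : Fin n) :
    s σ * s (Equiv.swap i j) = s (Equiv.swap (σ i) (σ j)) * s σ := by
  rw [← map_mul, ← map_mul, Equiv.swap_apply_apply, inv_mul_cancel_right]

theorem swap_mul_jucysMurphy_of_ne (s : Equiv.Perm (Fin n) →* R) {i j l : Fin n}
    (hij : j.val = i.val + 1) (hi : l ≠ i) (hj : l ≠ j) :
    s (Equiv.swap i j) * jucysMurphy s l = jucysMurphy s l * s (Equiv.swap i j) := by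
  have hl : Equiv.swap i j l = l := Equiv.swap_apply_of_ne_of_ne hi hj
  simp only [jucysMurphy, Finset.mul_sum, Finset.sum_mul]
  refine Finset.sum_equiv (Equiv.swap i j) (fun m => ?_)
    (fun m _ => by rw [hom_mul_swap, hl])
  have hi' := Fin.val_ne_of_ne hi
  have hj' := Fin.val_ne_of_ne hj
  simp only [Finset.mem_filter, Finset.mem_univ, true_and]
  rcases eq_or_ne m i with rfl | h1
  · rw [Equiv.swap_apply_left]; omega
  · rcases eq_or_ne m j with rfl | h2
    · rw [Equiv.swap_apply_right]; omega
    · rw [Equiv.swap_apply_of_ne_of_ne h1 h2]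

/-- The sum for `j = i + 1` has one more summand, the transposition `(i,j)` itself, whose square is
the `1` on the right. -/
theorem swap_mul_jucysMurphy (s : Equiv.Perm (Fin n) →* R) {i j : Fin n}
    (hij : j.val = i.val + 1) :
    s (Equiv.swap i j) * jucysMurphy s i = jucysMurphy s j * s (Equiv.swap i j) - 1 := by
  have hset : (Finset.univ.filter fun m : Fin n => m < j)
      = insert i (Finset.univ.filter fun m => m < i) := by
    ext m; simp only [Finset.mem_filter, Finset.mem_univ, true_and, Finset.mem_insert]; omega
  have hone : s (Equiv.swap i j) * s (Equiv.swap i j) = 1 := by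
    rw [← map_mul, Equiv.swap_mul_self, map_one]
  simp only [jucysMurphy]
  rw [hset, Finset.sum_insert (by simp), add_mul, hone, add_sub_cancel_left, Finset.mul_sum,
    Finset.sum_mul]
  refine Finset.sum_congr rfl fun m hm => ?_
  have hm' : m < i := by simpa using hm
  rw [hom_mul_swap, Equiv.swap_apply_left, Equiv.swap_apply_of_ne_of_ne]
  · exact Fin.ne_of_val_ne (by omega)
  · exact Fin.ne_of_val_ne (by omega)

variable {θ : K} {p : Fin n → R} {s : Equiv.Perm (Fin n) →* R}
  (hsp : ∀ σ i, s σ * p i = p (σ i) * s σ)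

include hsp

theorem swap_mul_cherednik_of_ne {i j l : Fin n}
    (hij : j.val = i.val + 1) (hi : l ≠ i) (hj : l ≠ j) :
    s (Equiv.swap i j) * cherednik θ p s l = cherednik θ p s l * s (Equiv.swap i j) := by
  rw [cherednik, mul_add, add_mul, hsp, Equiv.swap_apply_of_ne_of_ne hi hj, mul_smul_comm,
    smul_mul_assoc, swap_mul_jucysMurphy_of_ne s hij hi hj]

theorem swap_mul_cherednik {i j : Fin n} (hij : j.val = i.val + 1) :
    s (Equiv.swap i j) * cherednik θ p s i
      = cherednik θ p s j * s (Equiv.swap i j) - algebraMap K R θ := by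
  rw [cherednik, cherednik, mul_add, add_mul, hsp, Equiv.swap_apply_left, mul_smul_comm,
    smul_mul_assoc, swap_mul_jucysMurphy s hij, smul_sub, Algebra.algebraMap_eq_smul_one,
    add_sub_assoc]

theorem swap_mul_cherednik' {i j : Fin n} (hij : j.val = i.val + 1) :
    s (Equiv.swap i j) * cherednik θ p s j
      = cherednik θ p s i * s (Equiv.swap i j) + algebraMap K R θ := by
  have hone : s (Equiv.swap i j) * s (Equiv.swap i j) = 1 := by
    rw [← map_mul, Equiv.swap_mul_self, map_one]
  have h := congrArg (fun x => s (Equiv.swap i j) * x * s (Equiv.swap i j))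
    (swap_mul_cherednik (θ := θ) hsp hij)
  simp only [mul_sub, sub_mul, ← mul_assoc, hone, one_mul] at h
  simp only [mul_assoc, hone, mul_one] at h
  rw [Algebra.commutes, ← mul_assoc, hone, one_mul] at h
  rw [h, sub_add_cancel]

/-- With `ξ` the Cherednik operators, moving the transposition past `ξ i ^ 2` leaves `-θ (ξ i + ξ
j)` and past `ξ j ^ 2` leaves `+θ (ξ i + ξ j)`. Only the cross relations are needed, not that the
`ξ` commute with each other. -/
theorem commute_sum_cherednik_sq_adjacent {i j : Fin n} (hij : j.val = i.val + 1) :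
    Commute (s (Equiv.swap i j)) (∑ l, cherednik θ p s l ^ 2) := by
  have hne : i ≠ j := Fin.ne_of_val_ne (by omega)
  rw [commute_iff_eq, ← sub_eq_zero, Finset.mul_sum, Finset.sum_mul, ← Finset.sum_sub_distrib,
    Fintype.sum_eq_add i j hne]
  · have h1 := swap_mul_cherednik (θ := θ) hsp hij
    have h2 := swap_mul_cherednik' (θ := θ) hsp hij
    have c1 := Algebra.commutes (R := K) (A := R) θ (cherednik θ p s i)
    have c2 := Algebra.commutes (R := K) (A := R) θ (cherednik θ p s j)
    rw [pow_two, pow_two, ← mul_assoc, ← mul_assoc, h1, h2, sub_mul, add_mul, mul_assoc, h1,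
      mul_assoc _ (s _), h2, c1, c2]
    noncomm_ring
  · intro l hl
    rw [sub_eq_zero]
    have h := swap_mul_cherednik_of_ne (θ := θ) hsp hij hl.1 hl.2
    rw [pow_two, ← mul_assoc, h, mul_assoc, h, mul_assoc]

end Cherednik

/-! ### The sum of squares of the Cherednik operators commutes with everything -/

section Central

variable {K R : Type*} [Field K] [Ring R] [Algebra K R] {n : ℕ}
  {θ : K} {p : Fin (n + 1) → R} {s : Equiv.Perm (Fin (n + 1)) →* R}
  (hsp : ∀ σ i, s σ * p i = p (σ i) * s σ)

include hsp

theorem commute_sum_cherednik_sq (σ : Equiv.Perm (Fin (n + 1))) :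
    Commute (s σ) (∑ l, cherednik θ p s l ^ 2) := by
  have hσ : σ ∈ Submonoid.closure
      (Set.range fun i : Fin n => Equiv.swap i.castSucc i.succ) := by
    rw [Equiv.Perm.mclosure_swap_castSucc_succ]; trivial
  induction hσ using Submonoid.closure_induction with
  | mem x hx =>
    obtain ⟨i, rfl⟩ := hx
    exact commute_sum_cherednik_sq_adjacent hsp (by simp)
  | one => rw [map_one]; exact Commute.one_left _
  | mul x y _ _ hx hy => rw [map_mul]; exact hx.mul_left hy

variable (hp : ∀ i j, i ≠ j → p i * p j - p j * p i = -(θ • ((p i - p j) * s (Equiv.swap i j))))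

include hp

/-- The commutator of `p 0` with `p j` is cancelled by its commutator with the summand `θ (0,j)`;
the remaining transpositions `(m,j)` do not move `0`. -/
theorem commute_zero_cherednik (j : Fin (n + 1)) : Commute (p 0) (cherednik θ p s j) := by
  rcases eq_or_ne j 0 with rfl | h
  · simp [cherednik, jucysMurphy]
  · have hset : (Finset.univ.filter fun m : Fin (n + 1) => m < j)
        = insert 0 (Finset.univ.filter fun m => m < j ∧ m ≠ 0) := by
      ext m
      have : (0 : Fin (n + 1)) < j := Fin.pos_iff_ne_zero.mpr h
      by_cases hm : m = 0 <;> simp [hm, this]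
    have hc : Commute (p 0) (∑ m with m < j ∧ m ≠ 0, s (Equiv.swap m j)) := by
      refine Commute.sum_right _ _ _ fun m hm => ?_
      have hm' : m ≠ 0 := by simp at hm; exact hm.2
      rw [commute_iff_eq, hsp, Equiv.swap_apply_of_ne_of_ne hm'.symm h.symm]
    rw [commute_iff_eq, cherednik, jucysMurphy, hset, Finset.sum_insert (by simp), smul_add,
      ← add_assoc, mul_add, add_mul, mul_smul_comm, smul_mul_assoc, hc.eq, add_left_inj, mul_add,
      add_mul, mul_smul_comm, smul_mul_assoc, hsp, Equiv.swap_apply_left, ← sub_eq_zero]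
    have := hp 0 j h.symm
    rw [add_sub_add_comm, this, sub_mul, ← smul_sub, neg_add_cancel]

/-- `p 0` commutes with each Cherednik operator, and every `p k` is a conjugate of `p 0` by a
transposition, which commutes with the sum of squares. -/
theorem commute_polyOp_sum_cherednik_sq (k : Fin (n + 1)) :
    Commute (p k) (∑ l, cherednik θ p s l ^ 2) := by
  have h0 : Commute (p 0) (∑ l, cherednik θ p s l ^ 2) :=
    Commute.sum_right _ _ _ fun l _ => (commute_zero_cherednik hsp hp l).pow_right 2
  have hone : s (Equiv.swap 0 k) * s (Equiv.swap 0 k) = 1 := by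
    rw [← map_mul, Equiv.swap_mul_self, map_one]
  have hk : p k = s (Equiv.swap 0 k) * p 0 * s (Equiv.swap 0 k) := by
    rw [hsp, Equiv.swap_apply_left, mul_assoc, hone, mul_one]
  rw [hk]
  exact ((commute_sum_cherednik_sq hsp _).mul_left h0).mul_left (commute_sum_cherednik_sq hsp _)

end Central

/-! ### Dominance through sums of truncations -/

section Majorization

variable {N : ℕ}

/-- Majorization of tuples, without sorting: the sums agree and all sums of truncations
`(γ i - t)⁺` are dominated. -/
def Majorized (γ μ : Fin N → ℕ) : Prop :=
  ∑ i, γ i = ∑ i, μ i ∧ ∀ t, ∑ i, (γ i - t) ≤ ∑ i, (μ i - t)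

/-- The sum of squares of the entries. -/
def sqSum (γ : Fin N → ℕ) : ℕ := ∑ i, γ i * γ i

theorem Majorized.refl (γ : Fin N → ℕ) : Majorized γ γ := ⟨rfl, fun _ => le_rfl⟩

theorem Majorized.trans {γ μ ν : Fin N → ℕ} (h : Majorized γ μ) (h' : Majorized μ ν) :
    Majorized γ ν := ⟨h.1.trans h'.1, fun t => (h.2 t).trans (h'.2 t)⟩

theorem majorized_comp_perm (γ : Fin N → ℕ) (σ : Equiv.Perm (Fin N)) : Majorized (γ ∘ σ) γ :=
  ⟨Equiv.sum_comp σ γ, fun t => (Equiv.sum_comp σ fun i => γ i - t).le⟩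

theorem majorized_perm_comp (γ : Fin N → ℕ) (σ : Equiv.Perm (Fin N)) : Majorized γ (γ ∘ σ) :=
  ⟨(Equiv.sum_comp σ γ).symm, fun t => (Equiv.sum_comp σ fun i => γ i - t).ge⟩

theorem sqSum_comp_perm (γ : Fin N → ℕ) (σ : Equiv.Perm (Fin N)) : sqSum (γ ∘ σ) = sqSum γ :=
  Equiv.sum_comp σ fun i => γ i * γ i

/-- A layer-cake formula: it writes squares as sums of truncations, which makes `sqSum` monotone
under majorization. -/
theorem two_mul_sum_range_sub (x T : ℕ) (h : x ≤ T) :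
    2 * ∑ t ∈ Finset.range T, (x - t) = x * x + x := by
  induction x generalizing T with
  | zero => simp
  | succ x ih =>
    obtain ⟨T, rfl⟩ : ∃ S, T = S + 1 := ⟨T - 1, by omega⟩
    rw [Finset.sum_range_succ']
    simp only [Nat.add_sub_add_right]
    rw [mul_add, ih T (by omega)]
    simp only [Nat.sub_zero]
    ring

theorem two_mul_sum_sum_range_sub (γ : Fin N → ℕ) (T : ℕ) (h : ∀ i, γ i ≤ T) :
    2 * ∑ t ∈ Finset.range T, ∑ i, (γ i - t) = sqSum γ + ∑ i, γ i := by
  rw [Finset.sum_comm, Finset.mul_sum, sqSum, ← Finset.sum_add_distrib]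
  exact Finset.sum_congr rfl fun i _ => two_mul_sum_range_sub _ _ (h i)

theorem entry_le_sum (γ : Fin N → ℕ) (i : Fin N) : γ i ≤ ∑ i, γ i :=
  Finset.single_le_sum (f := γ) (fun _ _ => Nat.zero_le _) (Finset.mem_univ i)

theorem Majorized.sqSum_le {γ μ : Fin N → ℕ} (h : Majorized γ μ) : sqSum γ ≤ sqSum μ := by
  have h1 := two_mul_sum_sum_range_sub γ (∑ i, γ i) (entry_le_sum γ)
  have h2 := two_mul_sum_sum_range_sub μ (∑ i, γ i) (fun i => h.1 ▸ entry_le_sum μ i)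
  have h3 := Finset.sum_le_sum (s := Finset.range (∑ i, γ i)) fun t _ => h.2 t
  have h4 := h.1
  omega

/-- By the layer-cake formula the two families of truncation sums have equal totals; as one family
is termwise at most the other, they coincide. So `sqSum` detects strict majorization. -/
theorem Majorized.symm_of_sqSum_eq {γ μ : Fin N → ℕ} (h : Majorized γ μ)
    (hq : sqSum γ = sqSum μ) : Majorized μ γ := by
  refine ⟨h.1.symm, fun t => ?_⟩
  have h1 := two_mul_sum_sum_range_sub γ (∑ i, γ i) (entry_le_sum γ)
  have h2 := two_mul_sum_sum_range_sub μ (∑ i, γ i) (fun i => h.1 ▸ entry_le_sum μ i)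
  have h4 := h.1
  by_cases ht : t < ∑ i, γ i
  · have h5 := (Finset.sum_eq_sum_iff_of_le (s := Finset.range (∑ i, γ i))
      fun t _ => h.2 t).mp (by omega) t (Finset.mem_range.mpr ht)
    exact h5.ge
  · have : ∀ i, μ i - t = 0 := fun i => by
      have := entry_le_sum μ i
      omega
    simp [this]

theorem sum_eq_add_add_sum {M : Type*} [AddCommMonoid M] {i j : Fin N} (h : i ≠ j)
    (f : Fin N → M) : ∑ l, f l = f i + f j + ∑ l with l ≠ i ∧ l ≠ j, f l := by
  rw [← Finset.add_sum_erase _ _ (Finset.mem_univ i),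
    ← Finset.add_sum_erase _ _ (by simp [h.symm] : j ∈ Finset.univ.erase i), add_assoc]
  congr 2
  refine Finset.sum_congr ?_ fun _ _ => rfl
  ext l; simp [and_comm]

/-- A transfer between two positions that stays below the larger of the two entries: the only kind
of move that divided differences of monomials create. -/
theorem majorized_of_transfer {γ γ' : Fin N → ℕ} {i j : Fin N} (hij : i ≠ j)
    (hl : ∀ l, l ≠ i → l ≠ j → γ' l = γ l) (hs : γ' i + γ' j = γ i + γ j)
    (hi : γ' i ≤ max (γ i) (γ j)) (hj : γ' j ≤ max (γ i) (γ j)) : Majorized γ' γ := by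
  have hr : ∀ g : ℕ → ℕ, ∑ l with l ≠ i ∧ l ≠ j, g (γ' l) = ∑ l with l ≠ i ∧ l ≠ j, g (γ l) :=
    fun g => Finset.sum_congr rfl fun l hl' => by
      simp only [Finset.mem_filter] at hl'
      rw [hl l hl'.2.1 hl'.2.2]
  refine ⟨?_, fun t => ?_⟩
  · rw [sum_eq_add_add_sum hij, sum_eq_add_add_sum hij γ, hs, hr fun x => x]
  · rw [sum_eq_add_add_sum hij, sum_eq_add_add_sum hij (fun l => γ l - t), hr fun x => x - t]
    omega

theorem sqSum_lt_of_transfer {γ γ' : Fin N → ℕ} {i j : Fin N} (hij : i ≠ j)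
    (hl : ∀ l, l ≠ i → l ≠ j → γ' l = γ l) (hs : γ' i + γ' j = γ i + γ j)
    (hi : γ' i < max (γ i) (γ j)) (hj : γ' j < max (γ i) (γ j)) : sqSum γ' < sqSum γ := by
  have hr : ∑ l with l ≠ i ∧ l ≠ j, γ' l * γ' l = ∑ l with l ≠ i ∧ l ≠ j, γ l * γ l :=
    Finset.sum_congr rfl fun l hl' => by
      simp only [Finset.mem_filter] at hl'
      rw [hl l hl'.2.1 hl'.2.2]
  rw [sqSum, sqSum, sum_eq_add_add_sum hij, sum_eq_add_add_sum hij (fun l => γ l * γ l), hr]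
  have : γ' i * γ' i + γ' j * γ' j < γ i * γ i + γ j * γ j := by
    rcases le_total (γ j) (γ i) with h | h
    · rw [max_eq_left h] at hi hj
      zify at *
      nlinarith [mul_pos (sub_pos.mpr hi) (sub_pos.mpr hj)]
    · rw [max_eq_right h] at hi hj
      zify at *
      nlinarith [mul_pos (sub_pos.mpr hi) (sub_pos.mpr hj)]
  omega

theorem antitone_sortDesc (γ : Fin N → ℕ) : Antitone (sortDesc γ) :=
  fun _ _ h => Tuple.monotone_sort γ (Fin.rev_le_rev.mpr h)

theorem exists_sortDesc_eq_comp (γ : Fin N → ℕ) :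
    ∃ σ : Equiv.Perm (Fin N), sortDesc γ = γ ∘ σ :=
  ⟨Fin.revPerm.trans (Tuple.sort γ), rfl⟩

theorem majorized_sortDesc_iff {γ μ : Fin N → ℕ} : Majorized (sortDesc γ) μ ↔ Majorized γ μ := by
  obtain ⟨σ, hσ⟩ := exists_sortDesc_eq_comp γ
  rw [hσ]
  exact ⟨(majorized_perm_comp γ σ).trans, (majorized_comp_perm γ σ).trans⟩

theorem sqSum_sortDesc (γ : Fin N → ℕ) : sqSum (sortDesc γ) = sqSum γ := by
  obtain ⟨σ, hσ⟩ := exists_sortDesc_eq_comp γ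
  rw [hσ, sqSum_comp_perm]

theorem Majorized.dominanceLE {γ μ : Fin N → ℕ} (hμ : Antitone μ) (h : Majorized γ μ) :
    DominanceLE γ μ := by
  refine ⟨h.1, fun k hk => ?_⟩
  rcases Nat.eq_zero_or_pos k with rfl | hk0
  · simp
  have hkl : k - 1 < N := by omega
  -- At the threshold `t = μ (k - 1)`, truncation loses nothing: the first `k` entries of `μ` are at
  -- least `t` and the others at most `t`.
  set t := μ ⟨k - 1, hkl⟩ with ht
  have h1 : ∑ i with i.val < k, γ i ≤ ∑ i : Fin N with i.val < k, t + ∑ i, (γ i - t) := by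
    calc ∑ i with i.val < k, γ i ≤ ∑ i : Fin N with i.val < k, (t + (γ i - t)) :=
          Finset.sum_le_sum fun i _ => by omega
      _ = ∑ i : Fin N with i.val < k, t + ∑ i with i.val < k, (γ i - t) :=
          Finset.sum_add_distrib
      _ ≤ _ := by gcongr; exact Finset.filter_subset _ _
  have h2 : ∑ i, (μ i - t) = ∑ i with i.val < k, (μ i - t) := by
    symm
    apply Finset.sum_subset (Finset.filter_subset _ _)
    intro i _ hi
    have hi' : k ≤ i.val := by simpa using hi
    have := hμ (show (⟨k - 1, hkl⟩ : Fin N) ≤ i by rw [Fin.le_def]; simp; omega)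
    omega
  have h3 : ∑ i : Fin N with i.val < k, t + ∑ i with i.val < k, (μ i - t)
      = ∑ i with i.val < k, μ i := by
    rw [← Finset.sum_add_distrib]
    refine Finset.sum_congr rfl fun i hi => ?_
    have hi' : i.val < k := by simpa using hi
    have := hμ (show i ≤ (⟨k - 1, hkl⟩ : Fin N) by rw [Fin.le_def]; simp; omega)
    omega
  have h4 := h.2 t
  omega

theorem DominanceLE.majorized {γ μ : Fin N → ℕ} (hγ : Antitone γ) (h : DominanceLE γ μ) :
    Majorized γ μ := by
  refine ⟨h.1, fun t => ?_⟩
  -- Here the cut-off is chosen from the threshold: since `γ` is nonincreasing, its entries above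
  -- `t` are exactly the first `k`.
  set k := (Finset.univ.filter fun i => t < γ i).card with hk
  have hkN : k ≤ N := (Finset.card_le_univ _).trans (by simp)
  have hlt : ∀ i : Fin N, i.val < k ↔ t < γ i := fun i =>
    Tuple.lt_card_gt_iff_apply_gt_of_antitone (j := i) (a := t) hγ
  have h1 : ∑ i, (γ i - t) = ∑ i with i.val < k, (γ i - t) := by
    symm
    apply Finset.sum_subset (Finset.filter_subset _ _)
    intro i _ hi
    have hi' : ¬ i.val < k := by simpa using hi
    rw [hlt] at hi'
    omega
  have h2 : ∑ i : Fin N with i.val < k, t + ∑ i with i.val < k, (γ i - t)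
      = ∑ i with i.val < k, γ i := by
    rw [← Finset.sum_add_distrib]
    refine Finset.sum_congr rfl fun i hi => ?_
    have := (hlt i).mp (by simpa using hi)
    omega
  have h3 : ∑ i with i.val < k, μ i ≤ ∑ i : Fin N with i.val < k, t + ∑ i, (μ i - t) := by
    calc ∑ i with i.val < k, μ i ≤ ∑ i : Fin N with i.val < k, (t + (μ i - t)) :=
          Finset.sum_le_sum fun i _ => by omega
      _ = ∑ i : Fin N with i.val < k, t + ∑ i with i.val < k, (μ i - t) :=
          Finset.sum_add_distrib
      _ ≤ _ := by gcongr; exact Finset.filter_subset _ _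
  have h4 := h.2 k hkN
  omega

theorem dominanceLE_sortDesc_iff {γ μ : Fin N → ℕ} (hμ : Antitone μ) :
    DominanceLE (sortDesc γ) μ ↔ Majorized γ μ := by
  rw [← majorized_sortDesc_iff]
  exact ⟨fun h => h.majorized (antitone_sortDesc γ), fun h => h.dominanceLE hμ⟩

theorem sum_filter_val_lt_succ (μ : Fin N → ℕ) (i : Fin N) :
    ∑ j with j.val < i.val + 1, μ j = μ i + ∑ j with j.val < i.val, μ j := by
  have : (Finset.univ.filter fun j : Fin N => j.val < i.val + 1)
      = insert i (Finset.univ.filter fun j : Fin N => j.val < i.val) := by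
    ext j; simp only [Finset.mem_filter, Finset.mem_univ, true_and, Finset.mem_insert]; omega
  rw [this, Finset.sum_insert (by simp)]

theorem DominanceLE.antisymm {γ μ : Fin N → ℕ} (h : DominanceLE γ μ) (h' : DominanceLE μ γ) :
    γ = μ := by
  funext i
  have h1 := sum_filter_val_lt_succ γ i
  have h2 := sum_filter_val_lt_succ μ i
  have h3 := le_antisymm (h.2 (i + 1) i.2) (h'.2 (i + 1) i.2)
  have h4 := le_antisymm (h.2 i i.2.le) (h'.2 i i.2.le)
  omega

theorem Majorized.sortDesc_eq_iff {γ μ : Fin N → ℕ} (hμ : Antitone μ) (h : Majorized γ μ) :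
    sortDesc γ = μ ↔ sqSum γ = sqSum μ := by
  constructor
  · rintro rfl; exact (sqSum_sortDesc γ).symm
  · intro hq
    have h1 := (majorized_sortDesc_iff (γ := γ)).mpr h
    have h2 := h1.symm_of_sqSum_eq ((sqSum_sortDesc γ).trans hq)
    exact (h1.dominanceLE hμ).antisymm (h2.dominanceLE (antitone_sortDesc γ))

theorem majorized_of_sortDesc_eq {γ μ : Fin N → ℕ} (h : sortDesc γ = μ) : Majorized γ μ :=
  h ▸ majorized_sortDesc_iff.mp (Majorized.refl _)

/-- Exchanging the summations gives a sum of initial partial sums, each monotone for dominance. This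
controls the term of the energy that is linear in `θ`. -/
theorem sum_filter_gt_le_of_dominanceLE {γ μ : Fin N → ℕ} (h : DominanceLE γ μ) :
    ∑ i, ∑ j with i < j, γ i ≤ ∑ i, ∑ j with i < j, μ i := by
  have hs : ∀ ν : Fin N → ℕ, ∑ i, ∑ j with i < j, ν i = ∑ j : Fin N, ∑ i with i.val < j.val, ν i := by
    intro ν
    simp only [Finset.sum_filter]
    rw [Finset.sum_comm]
    rfl
  rw [hs, hs]
  exact Finset.sum_le_sum fun j _ => h.2 j j.2.le

end Majorization

/-! ### Triangularity of the operators with respect to majorization -/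

section Triangular

variable {N : ℕ}

/-- The exponents that are majorized by `μ`. -/
def domExps (μ : Fin N → ℕ) : Set (Fin N →₀ ℕ) := {γ | Majorized γ μ}

/-- The exponents that are majorized by `μ` and are not rearrangements of it. -/
def lowerExps (μ : Fin N → ℕ) : Set (Fin N →₀ ℕ) := {γ | Majorized γ μ ∧ sqSum γ < sqSum μ}

theorem coe_mapDomain_perm (σ : Equiv.Perm (Fin N)) (γ : Fin N →₀ ℕ) :
    ⇑(γ.mapDomain σ) = ⇑γ ∘ σ.symm := by
  funext i
  exact Finsupp.mapDomain_equiv_apply γ i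

theorem majorized_mapDomain (σ : Equiv.Perm (Fin N)) (γ : Fin N →₀ ℕ) :
    Majorized (γ.mapDomain σ) γ := by
  rw [coe_mapDomain_perm]; exact majorized_comp_perm _ _

theorem sqSum_mapDomain (σ : Equiv.Perm (Fin N)) (γ : Fin N →₀ ℕ) :
    sqSum (γ.mapDomain σ) = sqSum γ := by
  rw [coe_mapDomain_perm]; exact sqSum_comp_perm _ _

theorem lowerExps_mapDomain (σ : Equiv.Perm (Fin N)) (γ : Fin N →₀ ℕ) :
    lowerExps (γ.mapDomain σ) = lowerExps γ := by
  have h : Majorized γ (γ.mapDomain σ) := by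
    rw [coe_mapDomain_perm]; exact majorized_perm_comp _ _
  ext δ
  simp only [lowerExps, Set.mem_ofPred_eq, sqSum_mapDomain]
  exact and_congr_left fun _ => ⟨fun h' => h'.trans (majorized_mapDomain σ γ), fun h' => h'.trans h⟩

theorem lowerExps_subset_domExps (μ : Fin N → ℕ) : lowerExps μ ⊆ domExps μ := fun _ h => h.1

theorem lowerExps_mono {γ μ : Fin N → ℕ} (h : Majorized γ μ) : lowerExps γ ⊆ lowerExps μ :=
  fun _ h' => ⟨h'.1.trans h, h'.2.trans_le h.sqSum_le⟩

theorem domExps_mono {γ μ : Fin N → ℕ} (h : Majorized γ μ) : domExps γ ⊆ domExps μ :=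
  fun _ h' => Majorized.trans h' h

theorem domExps_subset_lowerExps {γ μ : Fin N → ℕ} (h : Majorized γ μ) (h' : sqSum γ < sqSum μ) :
    domExps γ ⊆ lowerExps μ :=
  fun _ hδ => ⟨Majorized.trans hδ h, hδ.sqSum_le.trans_lt h'⟩

variable {K : Type*} [Field K]

theorem restrictSupport_le_comap {s : Set (Fin N →₀ ℕ)} {U : Submodule K (MvPolynomial (Fin N) K)}
    {T : Module.End K (MvPolynomial (Fin N) K)} (h : ∀ γ ∈ s, T (monomial γ 1) ∈ U) :
    restrictSupport K s ≤ U.comap T := by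
  rw [restrictSupport_eq_span, Submodule.span_le]
  rintro _ ⟨γ, hγ, rfl⟩
  exact h γ hγ

theorem monomial_one_mem {s : Set (Fin N →₀ ℕ)} {γ : Fin N →₀ ℕ} (h : γ ∈ s) :
    (monomial γ (1 : K)) ∈ restrictSupport K s :=
  (monomial_mem_restrictSupport K).mpr (Or.inl h)

theorem dividedDiff_rename_swap (i j : Fin N) (f : MvPolynomial (Fin N) K) :
    dividedDiff i j (rename (Equiv.swap i j) f) = -dividedDiff i j f := by
  rcases eq_or_ne i j with rfl | h
  · simp [dividedDiff_self]
  · apply eq_dividedDiff h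
    rw [mul_neg, X_sub_X_mul_dividedDiff, rename_rename, ← Equiv.coe_trans, Equiv.swap_swap,
      Equiv.coe_refl, rename_id_apply, neg_sub]

/-- The divided difference of `x_i^p x_j^q` with `p > q` is a geometric sum. After multiplication by
`x_i` its first term is the original monomial and all others are strict transfers between `i` and
`j`. -/
theorem X_mul_dividedDiff_monomial_of_lt {γ : Fin N →₀ ℕ} {i j : Fin N} (h : γ j < γ i) :
    X i * dividedDiff i j (monomial γ (1 : K)) - monomial γ 1 ∈
      restrictSupport K (lowerExps γ) := by
  have hij : i ≠ j := by rintro rfl; exact lt_irrefl _ h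
  let e : ℕ → ℕ → (Fin N →₀ ℕ) := fun x y => (γ.update i x).update j y
  have ei : ∀ x y, e x y i = x := fun x y => by
    simp [e, Finsupp.coe_update, Function.update_of_ne hij]
  have ej : ∀ x y, e x y j = y := fun x y => by simp [e, Finsupp.coe_update]
  have el : ∀ x y l, l ≠ i → l ≠ j → e x y l = γ l := fun x y l h1 h2 => by
    simp [e, Finsupp.coe_update, Function.update_of_ne h1, Function.update_of_ne h2]
  have ext_e : ∀ (δ : Fin N →₀ ℕ) x y, δ i = x → δ j = y → (∀ l, l ≠ i → l ≠ j → δ l = γ l) →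
      δ = e x y := by
    intro δ x y h1 h2 h3
    ext l
    rcases eq_or_ne l i with rfl | hi
    · rw [h1, ei]
    · rcases eq_or_ne l j with rfl | hj
      · rw [h2, ej]
      · rw [h3 l hi hj, el _ _ _ hi hj]
  have hXi : ∀ x y, X i * monomial (e x y) (1 : K) = monomial (e (x + 1) y) 1 := by
    intro x y
    rw [X, monomial_mul, one_mul]
    congr 2
    apply ext_e <;> simp +contextual [ei, ej, el, hij, add_comm]
  have hXj : ∀ x y, X j * monomial (e x y) (1 : K) = monomial (e x (y + 1)) 1 := by
    intro x y
    rw [X, monomial_mul, one_mul]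
    congr 2
    apply ext_e <;> simp +contextual [ei, ej, el, hij.symm, add_comm]
  obtain ⟨n, hn⟩ : ∃ n, γ i = γ j + (n + 1) := ⟨γ i - γ j - 1, by omega⟩
  have hdd : dividedDiff i j (monomial γ (1 : K))
      = ∑ r ∈ Finset.range (n + 1), monomial (e (γ j + n - r) (γ j + r)) 1 := by
    apply eq_dividedDiff hij
    have hsw : rename (Equiv.swap i j) (monomial γ (1 : K))
        = monomial (e (γ j + (n + 1) - (n + 1)) (γ j + (n + 1))) 1 := by
      rw [rename_monomial]
      congr 2
      apply ext_e
      · rw [coe_mapDomain_perm]; simp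
      · rw [coe_mapDomain_perm]; simp [hn]
      · intro l h1 h2
        rw [coe_mapDomain_perm]
        simp [Equiv.swap_apply_of_ne_of_ne h1 h2]
    have h0 : monomial γ (1 : K) = monomial (e (γ j + (n + 1) - 0) (γ j + 0)) 1 := by
      congr 2
      apply ext_e
      · simp [hn]
      · simp
      · intros; rfl
    -- The difference of the monomial and its swap telescopes over the intermediate exponents at `i`
    -- and `j`.
    rw [hsw, h0, ← Finset.sum_range_sub' fun r =>
      monomial (e (γ j + (n + 1) - r) (γ j + r)) (1 : K), Finset.mul_sum]
    refine Finset.sum_congr rfl fun r hr => ?_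
    have hr' : r < n + 1 := Finset.mem_range.mp hr
    rw [sub_mul, hXi, hXj, add_assoc (γ j) r 1]
    congr 4 <;> omega
  have h0 : monomial γ (1 : K) = monomial (e (γ j + n - 0 + 1) (γ j + 0)) 1 := by
    congr 2
    apply ext_e
    · simp [hn, add_assoc]
    · simp
    · intros; rfl
  rw [hdd, Finset.mul_sum]
  simp only [hXi]
  -- The term with index zero is the monomial itself; in each remaining term both exponents at `i`
  -- and `j` are smaller than `γ i`.
  rw [Finset.sum_range_succ', ← h0, add_sub_cancel_right]
  refine Submodule.sum_mem _ fun r hr => monomial_one_mem ?_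
  have hr' : r < n := Finset.mem_range.mp hr
  exact ⟨majorized_of_transfer hij (el _ _) (by rw [ei, ej]; omega) (by rw [ei]; omega)
      (by rw [ej]; omega),
    sqSum_lt_of_transfer hij (el _ _) (by rw [ei, ej]; omega) (by rw [ei]; omega)
      (by rw [ej]; omega)⟩

theorem X_mul_dividedDiff_monomial (γ : Fin N →₀ ℕ) (i j : Fin N) :
    X i * dividedDiff i j (monomial γ (1 : K)) - ((if γ j < γ i then monomial γ 1 else 0)
      - if γ i < γ j then monomial (γ.mapDomain (Equiv.swap i j)) 1 else 0) ∈
      restrictSupport K (lowerExps γ) := by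
  rcases lt_trichotomy (γ j) (γ i) with h | h | h
  · rw [if_pos h, if_neg h.asymm, sub_zero]
    exact X_mul_dividedDiff_monomial_of_lt h
  · have h0 : dividedDiff i j (monomial γ (1 : K)) = 0 := by
      rcases eq_or_ne i j with rfl | hij
      · simp [dividedDiff_self]
      · apply eq_dividedDiff hij
        rw [mul_zero, rename_monomial, eq_comm, sub_eq_zero]
        congr 2
        refine Finsupp.ext fun l => ?_
        rw [coe_mapDomain_perm, Equiv.symm_swap, Function.comp_apply, Equiv.swap_apply_def]
        split_ifs with h1 h2
        · rw [h1, h]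
        · rw [h2, h]
        · rfl
    simp [h0, h]
  · rw [if_neg h.asymm, if_pos h, zero_sub, sub_neg_eq_add]
    have h1 : monomial γ (1 : K)
        = rename (Equiv.swap i j) (monomial (γ.mapDomain (Equiv.swap i j)) 1) := by
      rw [rename_monomial, ← Finsupp.mapDomain_comp, ← Equiv.coe_trans, Equiv.swap_swap,
        Equiv.coe_refl, Finsupp.mapDomain_id]
    have h2 := X_mul_dividedDiff_monomial_of_lt (K := K)
      (γ := γ.mapDomain (Equiv.swap i j)) (i := i) (j := j) (by
        rw [coe_mapDomain_perm]; simpa using h)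
    rw [lowerExps_mapDomain] at h2
    rw [h1, dividedDiff_rename_swap]
    have h3 := Submodule.neg_mem _ h2
    rwa [neg_sub', sub_neg_eq_add, ← mul_neg] at h3

/-- Modulo strictly lower terms, each `j` with a smaller exponent contributes to the diagonal, and
each `j` with a larger exponent contributes a swapped monomial of the same shape. -/
theorem polyOp_monomial (θ : K) (γ : Fin N →₀ ℕ) (i : Fin N) :
    polyOp θ i (monomial γ 1) ≡
      ((γ i : K) + θ * (Finset.univ.filter fun j => γ j < γ i).card) • monomial γ 1
        - θ • ∑ j with γ i < γ j, monomial (γ.mapDomain (Equiv.swap i j)) 1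
      [SMOD restrictSupport K (lowerExps γ)] := by
  rw [SModEq.sub_mem]
  have h1 : polyOp θ i (monomial γ (1 : K)) = (γ i : K) • monomial γ 1
      + θ • ∑ j, X i * dividedDiff i j (monomial γ (1 : K)) := by
    rw [polyOp_apply, dunkl_apply, mul_add, X_mul_pderiv_monomial, mul_smul_comm, Finset.mul_sum,
      Nat.cast_smul_eq_nsmul]
  have h2 := Submodule.smul_mem _ θ (Submodule.sum_mem _ fun j (_ : j ∈ Finset.univ) =>
    X_mul_dividedDiff_monomial (K := K) γ i j)
  convert h2 using 1
  rw [h1, Finset.sum_sub_distrib, Finset.sum_sub_distrib, ← Finset.sum_filter, ← Finset.sum_filter,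
    Finset.sum_const, smul_sub, smul_sub, add_smul, mul_smul, Nat.cast_smul_eq_nsmul K
      (Finset.card _)]
  abel

theorem polyOp_monomial_mem_domExps (θ : K) (γ : Fin N →₀ ℕ) (i : Fin N) :
    polyOp θ i (monomial γ 1) ∈ restrictSupport K (domExps γ) := by
  have h := (SModEq.sub_mem).mp (polyOp_monomial θ γ i)
  rw [← sub_add_cancel (polyOp θ i (monomial γ 1)) (((γ i : K) +
    θ * (Finset.univ.filter fun j => γ j < γ i).card) • monomial γ 1
        - θ • ∑ j with γ i < γ j, monomial (γ.mapDomain (Equiv.swap i j)) 1)]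
  refine add_mem (restrictSupport_mono _ (lowerExps_subset_domExps _) h) (sub_mem ?_ ?_)
  · exact Submodule.smul_mem _ _ (monomial_one_mem (Majorized.refl _))
  · exact Submodule.smul_mem _ _ (Submodule.sum_mem _ fun j _ =>
      monomial_one_mem (majorized_mapDomain _ _))

/-- An operator that preserves the filtration by majorization. -/
def Filtered (T : Module.End K (MvPolynomial (Fin N) K)) : Prop :=
  ∀ γ : Fin N →₀ ℕ, T (monomial γ 1) ∈ restrictSupport K (domExps γ)

theorem Filtered.mem_domExps {T : Module.End K (MvPolynomial (Fin N) K)} (hT : Filtered T)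
    {μ : Fin N → ℕ} {f : MvPolynomial (Fin N) K} (hf : f ∈ restrictSupport K (domExps μ)) :
    T f ∈ restrictSupport K (domExps μ) :=
  restrictSupport_le_comap
    (fun γ (hγ : Majorized γ μ) => restrictSupport_mono _ (domExps_mono hγ) (hT γ)) hf

theorem Filtered.mem_lowerExps {T : Module.End K (MvPolynomial (Fin N) K)} (hT : Filtered T)
    {μ : Fin N → ℕ} {f : MvPolynomial (Fin N) K} (hf : f ∈ restrictSupport K (lowerExps μ)) :
    T f ∈ restrictSupport K (lowerExps μ) :=
  restrictSupport_le_comap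
    (fun γ hγ => restrictSupport_mono _ (domExps_subset_lowerExps hγ.1 hγ.2) (hT γ)) hf

theorem Filtered.smodEq {T : Module.End K (MvPolynomial (Fin N) K)} (hT : Filtered T)
    {μ : Fin N → ℕ} {f g : MvPolynomial (Fin N) K}
    (h : f ≡ g [SMOD restrictSupport K (lowerExps μ)]) :
    T f ≡ T g [SMOD restrictSupport K (lowerExps μ)] := by
  rw [SModEq.sub_mem] at h ⊢
  rw [← map_sub]
  exact hT.mem_lowerExps h

theorem filtered_polyOp (θ : K) (i : Fin N) : Filtered (polyOp θ i) :=
  fun γ => polyOp_monomial_mem_domExps θ γ i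

theorem filtered_permRep (σ : Equiv.Perm (Fin N)) : Filtered (permRep K N σ) := fun γ => by
  rw [permRep_apply, rename_monomial]
  exact monomial_one_mem (majorized_mapDomain σ γ)

theorem Filtered.add {S T : Module.End K (MvPolynomial (Fin N) K)} (hS : Filtered S)
    (hT : Filtered T) : Filtered (S + T) := fun γ => add_mem (hS γ) (hT γ)

theorem Filtered.smul {T : Module.End K (MvPolynomial (Fin N) K)} (c : K) (hT : Filtered T) :
    Filtered (c • T) := fun γ => Submodule.smul_mem _ c (hT γ)

theorem Filtered.sum {ι : Type*} {s : Finset ι} {T : ι → Module.End K (MvPolynomial (Fin N) K)}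
    (hT : ∀ i ∈ s, Filtered (T i)) : Filtered (∑ i ∈ s, T i) := fun γ => by
  rw [LinearMap.sum_apply]
  exact Submodule.sum_mem _ fun i hi => hT i hi γ

theorem Filtered.mul {S T : Module.End K (MvPolynomial (Fin N) K)} (hS : Filtered S)
    (hT : Filtered T) : Filtered (S * T) := fun γ => hS.mem_domExps (hT γ)

theorem Filtered.pow {T : Module.End K (MvPolynomial (Fin N) K)} (hT : Filtered T) (m : ℕ) :
    Filtered (T ^ m) := by
  induction m with
  | zero => exact fun γ => monomial_one_mem (Majorized.refl _)
  | succ m ih => rw [pow_succ]; exact ih.mul hT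

theorem filtered_heckmanPolychronakos (θ : K) (m : ℕ) :
    Filtered (heckmanPolychronakos (N := N) θ m) :=
  Filtered.sum fun i _ => (filtered_polyOp θ i).pow m

end Triangular

/-! ### Ranks of positions -/

section Rank

variable {N : ℕ}

/-- The position of `i` when the indices are ordered by increasing value of `γ`, ties being broken
by the order of the indices. -/
def rank (γ : Fin N → ℕ) (i : Fin N) : ℕ :=
  (Finset.univ.filter fun j => γ j < γ i ∨ (j < i ∧ γ j = γ i)).card

theorem rank_lt_rank {γ : Fin N → ℕ} {i j : Fin N} (h : γ j < γ i ∨ (j < i ∧ γ j = γ i)) :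
    rank γ j < rank γ i := by
  refine Finset.card_lt_card (Finset.ssubset_iff_of_subset ?_ |>.mpr ⟨j, ?_, ?_⟩)
  · intro l hl
    simp only [Finset.mem_filter, Finset.mem_univ, true_and] at hl ⊢
    omega
  · simpa using h
  · simp

theorem rank_injective (γ : Fin N → ℕ) : Function.Injective (rank γ) := by
  intro i j hij
  by_contra hne
  rcases (by omega : (γ j < γ i ∨ (j < i ∧ γ j = γ i)) ∨ (γ i < γ j ∨ (i < j ∧ γ i = γ j)))
    with h | h
  · exact (rank_lt_rank h).ne' hij
  · exact (rank_lt_rank h).ne hij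

theorem rank_lt (γ : Fin N → ℕ) (i : Fin N) : rank γ i < N := by
  have : rank γ i < (Finset.univ : Finset (Fin N)).card :=
    Finset.card_lt_card (Finset.ssubset_iff_of_subset (Finset.filter_subset _ _) |>.mpr
      ⟨i, Finset.mem_univ i, by simp⟩)
  simpa using this

/-- The ranks are a permutation of `0, …, N - 1`. Hence the `θ ^ 2` term of the energy does not
depend on the exponents. -/
theorem sum_comp_rank {M : Type*} [AddCommMonoid M] (γ : Fin N → ℕ) (f : ℕ → M) :
    ∑ i, f (rank γ i) = ∑ k ∈ Finset.range N, f k := by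
  have h : Finset.univ.image (rank γ) = Finset.range N := by
    apply Finset.eq_of_subset_of_card_le
    · intro k hk
      obtain ⟨i, _, rfl⟩ := Finset.mem_image.mp hk
      exact Finset.mem_range.mpr (rank_lt γ i)
    · rw [Finset.card_image_of_injective _ (rank_injective γ)]; simp
  rw [← h, Finset.sum_image fun _ _ _ _ h => rank_injective γ h]

/-- Within a block of equal exponents it does not matter whether pairs are counted forwards or
backwards. For a nonincreasing tuple the rank may therefore be replaced by the number of later
positions. -/
theorem sum_mul_rank {γ : Fin N → ℕ} (hγ : Antitone γ) :
    ∑ i, γ i * rank γ i = ∑ i, ∑ j with i < j, γ i := by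
  have h1 : ∀ i, γ i * rank γ i
      = ∑ j, (if γ j < γ i then γ i else 0) + ∑ j, (if j < i ∧ γ j = γ i then γ i else 0) := by
    intro i
    rw [← Finset.sum_add_distrib, rank, Finset.card_eq_sum_ones, Finset.mul_sum, Finset.sum_filter]
    refine Finset.sum_congr rfl fun j _ => ?_
    split_ifs <;> omega
  simp only [h1, Finset.sum_add_distrib]
  rw [Finset.sum_comm (f := fun i j => if j < i ∧ γ j = γ i then γ i else 0),
    ← Finset.sum_add_distrib]
  refine Finset.sum_congr rfl fun i _ => ?_
  rw [Finset.sum_filter, ← Finset.sum_add_distrib]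
  refine Finset.sum_congr rfl fun j _ => ?_
  rcases le_or_gt j i with h | h
  · have := hγ h
    split_ifs <;> omega
  · have := hγ h.le
    split_ifs <;> omega

end Rank

/-! ### The commuting operator `calogero` and its energies -/

section Calogero

variable {K : Type*} [Field K] {N : ℕ}

/-- The sum of the squares of the Cherednik operators. It commutes with all the operators `x i D i`
and with permutations. -/
noncomputable def calogero (θ : K) : Module.End K (MvPolynomial (Fin N) K) :=
  ∑ l, cherednik θ (polyOp θ) (permRep K N) l ^ 2

theorem commute_polyOp_calogero (θ : K) (k : Fin N) : Commute (polyOp θ k) (calogero θ) := by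
  cases N with
  | zero => exact k.elim0
  | succ n =>
    exact commute_polyOp_sum_cherednik_sq (permRep_mul_polyOp θ)
      (fun i j h => polyOp_commutator θ h) k

theorem commute_permRep_calogero (θ : K) (σ : Equiv.Perm (Fin N)) :
    Commute (permRep K N σ) (calogero θ) := by
  cases N with
  | zero => rw [Subsingleton.elim σ 1, map_one]; exact Commute.one_left _
  | succ n => exact commute_sum_cherednik_sq (permRep_mul_polyOp θ) σ

theorem commute_heckmanPolychronakos_calogero (θ : K) (m : ℕ) :
    Commute (heckmanPolychronakos (N := N) θ m) (calogero θ) :=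
  Commute.sum_left _ _ _ fun i _ => (commute_polyOp_calogero θ i).pow_left m

theorem filtered_cherednik (θ : K) (i : Fin N) :
    Filtered (cherednik θ (polyOp θ) (permRep K N) i) :=
  (filtered_polyOp θ i).add (.smul θ (.sum fun _ _ => filtered_permRep _))

theorem filtered_calogero (θ : K) : Filtered (calogero (N := N) θ) :=
  Filtered.sum fun i _ => (filtered_cherednik θ i).pow 2

/-- For nonincreasing `γ`, every `j` with a larger exponent precedes `i`, so the Jucys–Murphy term
cancels all off-diagonal leading terms. The ties before `i` complete the diagonal coefficient to the
rank. -/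
theorem cherednik_monomial (θ : K) {γ : Fin N →₀ ℕ} (hγ : Antitone γ) (i : Fin N) :
    cherednik θ (polyOp θ) (permRep K N) i (monomial γ 1) ≡
      ((γ i : K) + θ * rank γ i) • monomial γ 1 [SMOD restrictSupport K (lowerExps γ)] := by
  have h1 : jucysMurphy (permRep K N) i (monomial γ (1 : K))
      = ((Finset.univ.filter fun j => j < i ∧ γ j = γ i).card : K) • monomial γ 1
        + ∑ j with γ i < γ j, monomial (γ.mapDomain (Equiv.swap i j)) 1 := by
    rw [jucysMurphy, LinearMap.sum_apply, Nat.cast_smul_eq_nsmul, ← Finset.sum_const,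
      Finset.sum_filter, Finset.sum_filter, Finset.sum_filter, ← Finset.sum_add_distrib]
    refine Finset.sum_congr rfl fun j _ => ?_
    rw [permRep_apply, rename_monomial, Equiv.swap_comm j i]
    by_cases hji : j < i
    · have h := hγ hji.le
      by_cases h' : γ j = γ i
      · have hs : γ.mapDomain (Equiv.swap i j) = γ := by
          refine Finsupp.ext fun l => ?_
          rw [coe_mapDomain_perm, Equiv.symm_swap, Function.comp_apply, Equiv.swap_apply_def]
          split_ifs with h1 h2
          · rw [h1, h']
          · rw [h2, h']
          · rfl
        simp [hji, h', hs]
      · simp [hji, h', lt_of_le_of_ne h (Ne.symm h')]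
    · have h := hγ (not_lt.mp hji)
      simp [hji, h.not_gt]
  have h2 : rank γ i = (Finset.univ.filter fun j => γ j < γ i).card
      + (Finset.univ.filter fun j => j < i ∧ γ j = γ i).card := by
    rw [rank, Finset.filter_or, Finset.card_union_of_disjoint]
    rw [Finset.disjoint_filter]
    intro j _ h h'
    omega
  rw [cherednik, LinearMap.add_apply, LinearMap.smul_apply, h1, h2]
  convert (polyOp_monomial θ γ i).add (SModEq.refl _) using 1
  rw [smul_add, Nat.cast_add]
  module

/-- The eigenvalue of `calogero θ` on the part of shape `μ`, for nonincreasing `μ`. -/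
noncomputable def energy (θ : K) (μ : Fin N → ℕ) : K :=
  ∑ i, ((μ i : K) + θ * rank μ i) ^ 2

theorem energy_eq (θ : K) {μ : Fin N → ℕ} (hμ : Antitone μ) :
    energy θ μ = (sqSum μ : K) + 2 * θ * ((∑ i, ∑ j with i < j, μ i : ℕ) : K)
      + θ ^ 2 * ∑ k ∈ Finset.range N, (k : K) ^ 2 := by
  rw [← sum_mul_rank hμ, ← sum_comp_rank μ (fun k => (k : K) ^ 2), energy, sqSum]
  push_cast
  rw [Finset.mul_sum, Finset.mul_sum, ← Finset.sum_add_distrib, ← Finset.sum_add_distrib]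
  exact Finset.sum_congr rfl fun i _ => by ring

theorem calogero_monomial_of_antitone (θ : K) {γ : Fin N →₀ ℕ} (hγ : Antitone γ) :
    calogero θ (monomial γ 1) ≡ energy θ γ • monomial γ 1
      [SMOD restrictSupport K (lowerExps γ)] := by
  rw [calogero, energy, LinearMap.sum_apply, Finset.sum_smul]
  refine SModEq.sum fun i _ => ?_
  rw [pow_two, Module.End.mul_apply]
  refine ((filtered_cherednik θ i).smodEq (cherednik_monomial θ hγ i)).trans ?_
  rw [map_smul, pow_two, mul_smul]
  exact (cherednik_monomial θ hγ i).smul _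

/-- The nonincreasing case is transported by a permutation, since `calogero` commutes with
permutations. -/
theorem calogero_monomial (θ : K) (γ : Fin N →₀ ℕ) :
    calogero θ (monomial γ 1) ≡ energy θ (sortDesc γ) • monomial γ 1
      [SMOD restrictSupport K (lowerExps γ)] := by
  obtain ⟨σ, hσ⟩ := exists_sortDesc_eq_comp (γ : Fin N → ℕ)
  set δ : Fin N →₀ ℕ := γ.mapDomain σ.symm with hδ
  have hδ' : ⇑δ = sortDesc γ := by rw [hσ, hδ, coe_mapDomain_perm]; rfl
  have hγδ : γ = δ.mapDomain σ := by
    rw [hδ, ← Finsupp.mapDomain_comp, ← Equiv.coe_trans, Equiv.symm_trans_self, Equiv.coe_refl,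
      Finsupp.mapDomain_id]
  have h := calogero_monomial_of_antitone θ (γ := δ) (by rw [hδ']; exact antitone_sortDesc γ)
  have h1 := (filtered_permRep σ).smodEq h
  have hc : ∀ f, permRep K N σ (calogero θ f) = calogero θ (permRep K N σ f) := fun f =>
    LinearMap.congr_fun (commute_permRep_calogero θ σ).eq f
  rw [hc, map_smul, permRep_apply, rename_monomial, ← hγδ, hδ'] at h1
  have hl : lowerExps γ = lowerExps (sortDesc γ) := by
    rw [← hδ', hγδ, lowerExps_mapDomain]
  rwa [hl]

/-- Going down in dominance strictly lowers the sum of squares and does not raise the linear term,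
whose coefficient `2 t` is positive. The `θ ^ 2` terms agree. -/
theorem energy_ne_of_real [Algebra ℂ K] {t : ℝ} (ht : 0 < t) {μ ν : Fin N → ℕ}
    (hμ : Antitone μ) (hν : Antitone ν) (h : DominanceLE μ ν) (hq : sqSum μ < sqSum ν) :
    energy (algebraMap ℂ K t) μ ≠ energy (algebraMap ℂ K t) ν := by
  rw [energy_eq _ hμ, energy_eq _ hν]
  intro he
  have he' := add_right_cancel he
  have hr : algebraMap ℂ K (((sqSum μ : ℝ) + 2 * t * ((∑ i, ∑ j with i < j, μ i : ℕ) : ℝ) : ℝ) : ℂ)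
      = algebraMap ℂ K
        (((sqSum ν : ℝ) + 2 * t * ((∑ i, ∑ j with i < j, ν i : ℕ) : ℝ) : ℝ) : ℂ) := by
    simpa only [Complex.ofReal_add, Complex.ofReal_mul, Complex.ofReal_natCast, map_add, map_mul,
      map_natCast, Complex.ofReal_ofNat, map_ofNat] using he'
  have hr' := Complex.ofReal_injective ((algebraMap ℂ K).injective hr)
  have h1 : (sqSum μ : ℝ) < sqSum ν := by exact_mod_cast hq
  have h2 : ((∑ i, ∑ j with i < j, μ i : ℕ) : ℝ) ≤ ((∑ i, ∑ j with i < j, ν i : ℕ) : ℝ) := by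
    exact_mod_cast sum_filter_gt_le_of_dominanceLE h
  nlinarith [mul_le_mul_of_nonneg_left h2 ht.le]

/-- An equality would be a polynomial relation for `θ` of degree at most one with nonzero constant
term, so the sums of squares alone decide. -/
theorem energy_ne_of_transcendental [Algebra ℂ K] {θ : K} (ht : Transcendental ℂ θ)
    {μ ν : Fin N → ℕ} (hμ : Antitone μ) (hν : Antitone ν) (hq : sqSum μ < sqSum ν) :
    energy θ μ ≠ energy θ ν := by
  rw [energy_eq _ hμ, energy_eq _ hν]
  intro he
  have he' := add_right_cancel he
  apply ht
  set A := ∑ i, ∑ j with i < j, μ i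
  set B := ∑ i, ∑ j with i < j, ν i
  refine ⟨Polynomial.C (((sqSum μ : ℂ) - sqSum ν)) + Polynomial.C (2 * ((A : ℂ) - B))
    * Polynomial.X, ?_, ?_⟩
  · intro h0
    have := congrArg (fun p => Polynomial.coeff p 0) h0
    simp only [Polynomial.coeff_add, Polynomial.coeff_C_zero, Polynomial.mul_coeff_zero,
      Polynomial.coeff_X_zero, mul_zero, add_zero, Polynomial.coeff_zero, sub_eq_zero,
      Nat.cast_inj] at this
    omega
  · simp only [map_add, map_mul, Polynomial.aeval_X, map_sub, map_natCast,
      map_ofNat]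
    linear_combination he'

end Calogero

/-! ### Lifting leading parts to joint eigenfunctions -/

section Eigenfunctions

variable {K : Type*} [Field K] {N : ℕ}

theorem monomialRep_toSubmodule (lam : Fin N → ℕ) :
    (monomialRep (K := K) lam).toSubmodule = restrictSupport K {γ | sortDesc γ = lam} := by
  rw [restrictSupport_eq_span]
  change Submodule.span K _ = _
  congr 1
  ext f
  simp only [Set.mem_ofPred_eq, Set.mem_image, eq_comm]

theorem coeff_eq_zero_of_mem {s : Set (Fin N →₀ ℕ)} {f : MvPolynomial (Fin N) K}
    (h : f ∈ restrictSupport K s) {γ : Fin N →₀ ℕ} (hγ : γ ∉ s) : coeff γ f = 0 := by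
  by_contra h'
  exact hγ (h (mem_support_iff.mpr h'))

theorem mem_restrictSupport_of_coeff {s : Set (Fin N →₀ ℕ)} {f : MvPolynomial (Fin N) K}
    (h : ∀ γ, coeff γ f ≠ 0 → γ ∈ s) : f ∈ restrictSupport K s :=
  fun γ hγ => h γ (mem_support_iff.mp hγ)

theorem coeff_leadingPart (lam : Fin N → ℕ) (F : MvPolynomial (Fin N) K) (γ : Fin N →₀ ℕ) :
    coeff γ (leadingPart lam F) = if sortDesc γ = lam then coeff γ F else 0 := by
  rw [leadingPart, coeff_sum]
  simp only [coeff_monomial]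
  rw [Finset.sum_ite_eq']
  by_cases h : sortDesc γ = lam
  · rw [if_pos h]
    split_ifs with h1
    · rfl
    · by_contra h3
      exact h1 (Finset.mem_filter.mpr ⟨mem_support_iff.mpr (Ne.symm h3), h⟩)
  · rw [if_neg h, ite_eq_right_iff]
    intro h1
    exact absurd (Finset.mem_filter.mp h1).2 h

theorem notMem_lowerExps {lam : Fin N → ℕ} {γ : Fin N →₀ ℕ} (h : sortDesc γ = lam) :
    γ ∉ lowerExps lam := fun h' => by
  have := h'.2
  rw [← h, sqSum_sortDesc] at this
  exact lt_irrefl _ this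

theorem eq_zero_of_mem_lower {lam : Fin N → ℕ} {f : MvPolynomial (Fin N) K}
    (h : f ∈ restrictSupport K (lowerExps lam)) (h' : f ∈ (monomialRep (K := K) lam).toSubmodule) :
    f = 0 := by
  rw [monomialRep_toSubmodule] at h'
  ext γ
  rw [coeff_zero]
  by_cases hγ : sortDesc γ = lam
  · exact coeff_eq_zero_of_mem h (notMem_lowerExps hγ)
  · exact coeff_eq_zero_of_mem h' hγ

theorem leadingPart_eq {lam : Fin N → ℕ} {F v : MvPolynomial (Fin N) K}
    (hv : v ∈ (monomialRep (K := K) lam).toSubmodule)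
    (hF : F ≡ v [SMOD restrictSupport K (lowerExps lam)]) : leadingPart lam F = v := by
  rw [SModEq.sub_mem] at hF
  rw [monomialRep_toSubmodule] at hv
  ext γ
  rw [coeff_leadingPart]
  split_ifs with h
  · have := coeff_eq_zero_of_mem hF (notMem_lowerExps h)
    rwa [coeff_sub, sub_eq_zero] at this
  · exact (coeff_eq_zero_of_mem hv h).symm

/-- A dominated exponent that is not a rearrangement of `lam` has a strictly smaller sum of squares,
so it lies in `lowerExps`. -/
theorem smodEq_leadingPart {lam : Fin N → ℕ} (hlam : Antitone lam) {F : MvPolynomial (Fin N) K}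
    (hF : ∀ γ ∈ F.support, DominanceLE (sortDesc γ) lam) :
    F ≡ leadingPart lam F [SMOD restrictSupport K (lowerExps lam)] := by
  rw [SModEq.sub_mem]
  refine mem_restrictSupport_of_coeff fun γ hγ => ?_
  rw [coeff_sub, coeff_leadingPart] at hγ
  split_ifs at hγ with h
  · simp at hγ
  · rw [sub_zero] at hγ
    have h1 := (dominanceLE_sortDesc_iff hlam).mp (hF γ (mem_support_iff.mpr hγ))
    exact ⟨h1, lt_of_le_of_ne h1.sqSum_le fun h2 => h ((h1.sortDesc_eq_iff hlam).mpr h2)⟩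

/-- At a monomial of `f` with maximal `sqSum`, the other monomials contribute nothing to the
coefficient in `calogero θ f`. So the energy of this monomial would have to be `e`. -/
theorem eq_zero_of_calogero_eq {θ e : K} {lam : Fin N → ℕ}
    (he : ∀ γ ∈ lowerExps lam, energy θ (sortDesc γ) ≠ e) {f : MvPolynomial (Fin N) K}
    (hf : f ∈ restrictSupport K (lowerExps lam)) (hZ : calogero θ f = e • f) : f = 0 := by
  by_contra h0
  obtain ⟨γ, hγ, hmax⟩ := Finset.exists_max_image f.support (fun γ => sqSum γ)
    (support_nonempty.mpr h0)
  have hterm : ∀ δ ∈ f.support, coeff γ (calogero θ (monomial δ (coeff δ f)))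
      = if δ = γ then energy θ (sortDesc γ) * coeff γ f else 0 := by
    intro δ hδ
    have h1 : monomial δ (coeff δ f) = coeff δ f • monomial δ (1 : K) := by
      rw [smul_monomial, smul_eq_mul, mul_one]
    have h2 := SModEq.sub_mem.mp (calogero_monomial θ δ)
    have h3 := coeff_eq_zero_of_mem h2 (γ := γ) fun h => (hmax δ hδ).not_gt h.2
    rw [coeff_sub, sub_eq_zero, coeff_smul, coeff_monomial] at h3
    rw [h1, map_smul, coeff_smul, h3]
    split_ifs with h
    · subst h; simp [mul_comm]
    · simp
  have h1 : coeff γ (calogero θ f) = energy θ (sortDesc γ) * coeff γ f := by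
    conv_lhs => rw [f.as_sum, map_sum, coeff_sum]
    rw [Finset.sum_congr rfl hterm, Finset.sum_ite_eq' , if_pos hγ]
  rw [hZ, coeff_smul, smul_eq_mul] at h1
  exact he γ (hf hγ) (mul_right_cancel₀ (mem_support_iff.mp hγ) h1).symm

theorem finite_lowerExps (lam : Fin N → ℕ) : (lowerExps lam).Finite := by
  refine (Set.finite_Iic (Finsupp.equivFunOnFinite.symm fun _ : Fin N => ∑ i, lam i)).subset ?_
  intro γ hγ i
  have := entry_le_sum γ i
  rw [hγ.1.1] at this
  simpa using this

/-- On the finite-dimensional space of lower polynomials `calogero θ - e` is injective by the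
preceding uniqueness, hence surjective. -/
theorem exists_calogero_sub_eq {θ e : K} {lam : Fin N → ℕ}
    (he : ∀ γ ∈ lowerExps lam, energy θ (sortDesc γ) ≠ e) {g : MvPolynomial (Fin N) K}
    (hg : g ∈ restrictSupport K (lowerExps lam)) :
    ∃ f ∈ restrictSupport K (lowerExps lam), calogero θ f - e • f = g := by
  have hfin : Finite (lowerExps lam) := finite_lowerExps lam
  have hmod : Module.Finite K (restrictSupport K (lowerExps lam)) :=
    Module.Finite.of_basis (basisRestrictSupport K (lowerExps lam))
  let T : Module.End K (restrictSupport K (lowerExps lam)) :=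
    (calogero θ - e • 1).restrict fun f hf =>
      sub_mem ((filtered_calogero θ).mem_lowerExps hf) (Submodule.smul_mem _ _ hf)
  have hT : ∀ x, (T x : MvPolynomial (Fin N) K) = calogero θ x - e • (x : MvPolynomial (Fin N) K) :=
    fun _ => rfl
  have hinj : Function.Injective T := by
    rw [injective_iff_map_eq_zero]
    intro x hx
    have hx' := congrArg Subtype.val hx
    rw [hT, ZeroMemClass.coe_zero, sub_eq_zero] at hx'
    exact Subtype.ext (eq_zero_of_calogero_eq he x.2 hx')
  obtain ⟨x, hx⟩ := LinearMap.injective_iff_surjective.mp hinj ⟨g, hg⟩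
  exact ⟨x, x.2, by rw [← hT, hx]⟩

theorem calogero_smodEq (θ : K) {lam : Fin N → ℕ} {v : MvPolynomial (Fin N) K}
    (hv : v ∈ (monomialRep (K := K) lam).toSubmodule) :
    calogero θ v ≡ energy θ lam • v [SMOD restrictSupport K (lowerExps lam)] := by
  rw [monomialRep_toSubmodule] at hv
  have h : restrictSupport K {γ : Fin N →₀ ℕ | sortDesc γ = lam}
      ≤ (restrictSupport K (lowerExps lam)).comap
        (calogero θ - energy θ lam • (1 : Module.End K (MvPolynomial (Fin N) K))) := by
    refine restrictSupport_le_comap fun γ hγ => ?_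
    have h1 := SModEq.sub_mem.mp (calogero_monomial θ γ)
    have hγ' : sortDesc γ = lam := hγ
    rw [hγ'] at h1
    exact restrictSupport_mono _ (lowerExps_mono (majorized_of_sortDesc_eq hγ)) h1
  exact SModEq.sub_mem.mpr (h hv)

/-- A lower correction turns `v` into an eigenvector `F` of `calogero`. Then `P m F - c m F` is
lower and, by commutation, belongs to the same eigenvalue, so it vanishes. -/
theorem exists_eigenfunction {θ : K} {lam : Fin N → ℕ}
    (he : ∀ γ ∈ lowerExps lam, energy θ (sortDesc γ) ≠ energy θ lam)
    {v : MvPolynomial (Fin N) K} (hv : v ∈ (monomialRep (K := K) lam).toSubmodule) {c : ℕ → K}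
    (hc : ∀ m, heckmanPolychronakos θ m v ≡ c m • v [SMOD restrictSupport K (lowerExps lam)]) :
    ∃ F, F ≡ v [SMOD restrictSupport K (lowerExps lam)] ∧
      ∀ m, heckmanPolychronakos θ m F = c m • F := by
  obtain ⟨w, hw, hwv⟩ := exists_calogero_sub_eq he
    (Submodule.neg_mem _ (SModEq.sub_mem.mp (calogero_smodEq θ hv)))
  have hF : v + w ≡ v [SMOD restrictSupport K (lowerExps lam)] := by
    rw [SModEq.sub_mem, add_sub_cancel_left]; exact hw
  refine ⟨v + w, hF, fun m => ?_⟩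
  have hZ : calogero θ (v + w) = energy θ lam • (v + w) := by
    rw [map_add, smul_add, ← sub_eq_zero]
    rw [eq_neg_iff_add_eq_zero] at hwv
    rw [← hwv]; abel
  rw [← sub_eq_zero]
  refine eq_zero_of_calogero_eq he (SModEq.sub_mem.mp ?_) ?_
  · exact (((filtered_heckmanPolychronakos θ m).smodEq hF).trans (hc m)).trans (hF.symm.smul _)
  · have hcomm : calogero θ (heckmanPolychronakos θ m (v + w))
        = heckmanPolychronakos θ m (calogero θ (v + w)) :=
      LinearMap.congr_fun (commute_heckmanPolychronakos_calogero θ m).symm.eq _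
    rw [map_sub, map_smul, hcomm, hZ, map_smul, smul_sub, smul_comm (c m)]

theorem exists_isJointEigenfunction {θ : K} {lam : Fin N → ℕ} (hlam : Antitone lam)
    (he : ∀ γ ∈ lowerExps lam, energy θ (sortDesc γ) ≠ energy θ lam) {τ : YoungDiagram}
    {v : MvPolynomial (Fin N) K} (hv : v ∈ (monomialRep (K := K) lam).toSubmodule)
    (hτ : v ∈ (isotypic (K := K) lam τ).toSubmodule) (h0 : v ≠ 0) {c : ℕ → K}
    (hc : ∀ m, heckmanPolychronakos θ m v ≡ c m • v [SMOD restrictSupport K (lowerExps lam)]) :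
    ∃ F, IsJointEigenfunction θ lam τ F ∧ leadingPart lam F = v := by
  obtain ⟨F, hF, hm⟩ := exists_eigenfunction he hv hc
  have hl := leadingPart_eq hv hF
  have hdom : F ∈ restrictSupport K (domExps lam) := by
    rw [← sub_add_cancel F v]
    refine add_mem (restrictSupport_mono _ (lowerExps_subset_domExps _) (SModEq.sub_mem.mp hF)) ?_
    rw [monomialRep_toSubmodule] at hv
    exact restrictSupport_mono _ (fun γ hγ => majorized_of_sortDesc_eq hγ) hv
  refine ⟨F, ⟨fun m _ => ⟨c m, hm m⟩, ?_, ?_, ?_, ?_⟩, hl⟩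
  · intro γ hγ
    have h : Majorized γ lam := hdom (mem_support_iff.mpr hγ)
    rw [← h.1, Finsupp.weight_apply, Finsupp.sum_fintype _ _ (by simp)]
    simp
  · exact fun γ hγ => (dominanceLE_sortDesc_iff hlam).mpr (hdom hγ)
  · rwa [hl]
  · rwa [hl]

/-- Comparing nonzero leading parts identifies the unknown eigenvalue with `c`. -/
theorem IsJointEigenfunction.eigenvalue {θ : K} {lam : Fin N → ℕ} (hlam : Antitone lam)
    {τ : YoungDiagram} {F : MvPolynomial (Fin N) K} (hF : IsJointEigenfunction θ lam τ F)
    (hv : leadingPart lam F ∈ (monomialRep (K := K) lam).toSubmodule) {m : ℕ} (hm : 1 ≤ m) {c : K}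
    (hc : heckmanPolychronakos θ m (leadingPart lam F) ≡ c • leadingPart lam F
      [SMOD restrictSupport K (lowerExps lam)]) :
    heckmanPolychronakos θ m F = c • F := by
  obtain ⟨d, hd⟩ := hF.eigen m hm
  have hlead := smodEq_leadingPart hlam hF.dominated
  have h1 : d • leadingPart lam F ≡ c • leadingPart lam F
      [SMOD restrictSupport K (lowerExps lam)] := by
    refine ((hlead.smul d).symm.trans ?_).trans hc
    rw [← hd]
    exact (filtered_heckmanPolychronakos θ m).smodEq hlead
  rw [SModEq.sub_mem, ← sub_smul] at h1
  have h2 := eq_zero_of_mem_lower h1 (Submodule.smul_mem _ _ hv)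
  rcases smul_eq_zero.mp h2 with h3 | h3
  · rw [hd, sub_eq_zero.mp h3]
  · exact absurd h3 hF.leading_ne_zero

end Eigenfunctions

/-! ### Leading action on two-valued exponents -/

section TwoValued

variable {N : ℕ}

theorem exists_perm_comp_eq {α : Type*} [DecidableEq α] {f g : Fin N → α}
    (h : ∀ c, (Finset.univ.filter fun i => f i = c).card
      = (Finset.univ.filter fun i => g i = c).card) :
    ∃ σ : Equiv.Perm (Fin N), g ∘ σ = f := by
  have e : ∀ c, Nonempty ({i // f i = c} ≃ {i // g i = c}) := fun c =>
    Fintype.card_eq.mp (by rw [Fintype.card_subtype, Fintype.card_subtype, h])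
  exact ⟨Equiv.ofFiberEquiv fun c => (e c).some, funext fun i => Equiv.ofFiberEquiv_map _ i⟩

theorem sortDesc_of_antitone {μ : Fin N → ℕ} (h : Antitone μ) : sortDesc μ = μ :=
  ((Majorized.refl μ).sortDesc_eq_iff h).mpr rfl

theorem sortDesc_eq_iff_exists_perm {γ μ : Fin N → ℕ} (h : Antitone μ) :
    sortDesc γ = μ ↔ ∃ σ : Equiv.Perm (Fin N), γ = μ ∘ σ := by
  constructor
  · intro h'
    obtain ⟨σ, hσ⟩ := exists_sortDesc_eq_comp γ
    refine ⟨σ.symm, ?_⟩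
    rw [← h', hσ]
    funext i; simp
  · rintro ⟨σ, rfl⟩
    rw [sortDesc_comp_perm, sortDesc_of_antitone h]

/-- The exponent vector with value `a` on `A` and `b` elsewhere. -/
noncomputable def twoExp (a b : ℕ) (A : Finset (Fin N)) : Fin N →₀ ℕ :=
  Finsupp.equivFunOnFinite.symm fun i => if i ∈ A then a else b

theorem twoExp_apply (a b : ℕ) (A : Finset (Fin N)) (i : Fin N) :
    twoExp a b A i = if i ∈ A then a else b := rfl

theorem twoExp_injective {a b : ℕ} (hab : b < a) :
    Function.Injective (twoExp (N := N) a b) := by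
  intro A B h
  ext i
  have := DFunLike.congr_fun h i
  rw [twoExp_apply, twoExp_apply] at this
  by_cases hA : i ∈ A <;> by_cases hB : i ∈ B <;> simp [hA, hB] at this ⊢ <;> omega

theorem mem_map_perm {σ : Equiv.Perm (Fin N)} {A : Finset (Fin N)} {i : Fin N} :
    i ∈ A.map σ.toEmbedding ↔ σ.symm i ∈ A := by
  rw [Finset.mem_map_equiv]

theorem mapDomain_twoExp (a b : ℕ) (σ : Equiv.Perm (Fin N)) (A : Finset (Fin N)) :
    (twoExp a b A).mapDomain σ = twoExp a b (A.map σ.toEmbedding) := by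
  refine Finsupp.ext fun i => ?_
  rw [coe_mapDomain_perm, Function.comp_apply, twoExp_apply, twoExp_apply]
  simp only [mem_map_perm]

theorem antitone_twoValued {η a b : ℕ} (hab : b < a) : Antitone (twoValued N η a b) := by
  intro i j h
  have h' : i.val ≤ j.val := h
  simp only [twoValued]
  split_ifs <;> omega

theorem card_filter_val_lt {k : ℕ} (h : k ≤ N) :
    (Finset.univ.filter fun i : Fin N => i.val < k).card = k := by
  rw [Fin.card_filter_val_lt, min_eq_right h]

theorem sortDesc_twoExp {η a b : ℕ} (hab : b < a) {A : Finset (Fin N)} (hA : A.card = N - η) :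
    sortDesc (twoExp a b A) = twoValued N η a b := by
  rw [sortDesc_eq_iff_exists_perm (antitone_twoValued hab)]
  obtain ⟨σ, hσ⟩ := exists_perm_comp_eq (f := fun i => decide (i ∈ A))
    (g := fun i : Fin N => decide (i.val < N - η)) (by
      have h1 : (Finset.univ.filter fun i => i ∈ A).card
          = (Finset.univ.filter fun i : Fin N => i.val < N - η).card := by
        rw [card_filter_val_lt (Nat.sub_le _ _), ← hA]; congr 1; ext; simp
      have h2 := Finset.card_filter_add_card_filter_not (s := Finset.univ) (fun i => i ∈ A)
      have h3 := Finset.card_filter_add_card_filter_not (s := Finset.univ)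
        (fun i : Fin N => i.val < N - η)
      rintro (_ | _)
      · simp only [decide_eq_false_iff_not]; omega
      · simpa only [decide_eq_true_eq] using h1)
  refine ⟨σ, funext fun i => ?_⟩
  have := congrFun hσ i
  simp only [Function.comp_apply, decide_eq_decide] at this
  simp only [twoExp_apply, Function.comp_apply, twoValued, this]

theorem exists_eq_twoExp {η a b : ℕ} (hab : b < a) {γ : Fin N →₀ ℕ}
    (h : sortDesc γ = twoValued N η a b) : ∃ A : Finset (Fin N), A.card = N - η ∧
      γ = twoExp a b A := by
  obtain ⟨σ, hσ⟩ := (sortDesc_eq_iff_exists_perm (antitone_twoValued hab)).mp h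
  refine ⟨(Finset.univ.filter fun i : Fin N => i.val < N - η).map σ.symm.toEmbedding, ?_, ?_⟩
  · rw [Finset.card_map, card_filter_val_lt (Nat.sub_le _ _)]
  · refine Finsupp.ext fun i => ?_
    rw [hσ, twoExp_apply]
    simp only [mem_map_perm, Function.comp_apply, twoValued, Finset.mem_filter, Finset.mem_univ,
      true_and, Equiv.symm_symm]

variable {K : Type*} [Field K]

theorem monomialRep_twoValued {η a b : ℕ} (hab : b < a) :
    (monomialRep (K := K) (twoValued N η a b)).toSubmodule
      = Submodule.span K ((fun A => monomial (twoExp a b A) (1 : K)) ''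
        {A : Finset (Fin N) | A.card = N - η}) := by
  change Submodule.span K _ = _
  congr 1
  ext f
  constructor
  · rintro ⟨γ, hγ, rfl⟩
    obtain ⟨A, hA, rfl⟩ := exists_eq_twoExp hab hγ
    exact ⟨A, hA, rfl⟩
  · rintro ⟨A, hA, rfl⟩
    exact ⟨_, sortDesc_twoExp hab hA, rfl⟩

/-- The sum of all `(i,j)`, over all pairs of indices. -/
noncomputable def swapSum (K : Type*) [Field K] (N : ℕ) :
    Module.End K (MvPolynomial (Fin N) K) :=
  ∑ i, ∑ j, permRep K N (Equiv.swap i j)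

/-- The sum of the monomials obtained from that of `A` by exchanging an element of `A` with `i`. -/
noncomputable def exchangeSum (K : Type*) [Field K] {N : ℕ} (a b : ℕ) (A : Finset (Fin N))
    (i : Fin N) : MvPolynomial (Fin N) K :=
  ∑ j ∈ A, monomial (twoExp a b (A.map (Equiv.swap i j).toEmbedding)) 1

theorem map_swap_eq_self {A : Finset (Fin N)} {i j : Fin N} (h : i ∈ A ↔ j ∈ A) :
    A.map (Equiv.swap i j).toEmbedding = A := by
  ext l
  rw [mem_map_perm, Equiv.symm_swap, Equiv.swap_apply_def]
  split_ifs with h1 h2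
  · rw [h1, h]
  · rw [h2, h]
  · rfl

/-- Pairs on the same side of `A` fix the monomial; each pair across is counted in both orders,
whence the factor `2`. -/
theorem swapSum_twoExp (a b : ℕ) (A : Finset (Fin N)) :
    swapSum K N (monomial (twoExp a b A) 1)
      = ((A.card : K) ^ 2 + (Aᶜ.card : K) ^ 2) • monomial (twoExp a b A) 1
        + (2 : K) • ∑ i ∈ Aᶜ, exchangeSum K a b A i := by
  have h1 : ∀ i j, permRep K N (Equiv.swap i j) (monomial (twoExp a b A) (1 : K))
      = monomial (twoExp a b (A.map (Equiv.swap i j).toEmbedding)) 1 := fun i j => by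
    rw [permRep_apply, rename_monomial, mapDomain_twoExp]
  have h2 : ∑ i ∈ A, ∑ j ∈ A, monomial (twoExp a b (A.map (Equiv.swap i j).toEmbedding)) (1 : K)
      = ((A.card : K) ^ 2) • monomial (twoExp a b A) 1 := by
    rw [Finset.sum_congr rfl fun i hi => Finset.sum_congr rfl fun j hj => by
      rw [map_swap_eq_self (iff_of_true hi hj)]]
    simp only [Finset.sum_const, smul_smul, ← Nat.cast_smul_eq_nsmul K, pow_two]
  have h3 : ∑ i ∈ Aᶜ, ∑ j ∈ Aᶜ,
        monomial (twoExp a b (A.map (Equiv.swap i j).toEmbedding)) (1 : K)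
      = ((Aᶜ.card : K) ^ 2) • monomial (twoExp a b A) 1 := by
    rw [Finset.sum_congr rfl fun i hi => Finset.sum_congr rfl fun j hj => by
      rw [map_swap_eq_self (iff_of_false (Finset.mem_compl.mp hi) (Finset.mem_compl.mp hj))]]
    simp only [Finset.sum_const, smul_smul, ← Nat.cast_smul_eq_nsmul K, pow_two]
  have h4 : ∑ i ∈ A, ∑ j ∈ Aᶜ,
        monomial (twoExp a b (A.map (Equiv.swap i j).toEmbedding)) (1 : K)
      = ∑ i ∈ Aᶜ, exchangeSum K a b A i := by
    rw [Finset.sum_comm]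
    simp only [exchangeSum, Equiv.swap_comm]
  simp only [swapSum, LinearMap.sum_apply, h1]
  have h5 : ∀ i, ∑ j, monomial (twoExp a b (A.map (Equiv.swap i j).toEmbedding)) (1 : K)
      = exchangeSum K a b A i
        + ∑ j ∈ Aᶜ, monomial (twoExp a b (A.map (Equiv.swap i j).toEmbedding)) (1 : K) :=
    fun i => (Finset.sum_add_sum_compl A _).symm
  have h6 : ∑ i ∈ A, exchangeSum K a b A i = ((A.card : K) ^ 2) • monomial (twoExp a b A) 1 := h2
  rw [← Finset.sum_add_sum_compl A]
  simp only [h5, Finset.sum_add_distrib]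
  rw [h6, h3, h4]
  module

theorem polyOp_twoExp_of_mem (θ : K) {η a b : ℕ} (hη : η ≤ N) (hab : b < a) {A : Finset (Fin N)}
    (hA : A.card = N - η) {i : Fin N} (hi : i ∈ A) :
    polyOp θ i (monomial (twoExp a b A) 1) ≡ ((a : K) + θ * η) • monomial (twoExp a b A) 1
      [SMOD restrictSupport K (lowerExps (twoValued N η a b))] := by
  have h := (polyOp_monomial θ (twoExp a b A) i).mono
    (restrictSupport_mono K (lowerExps_mono (majorized_of_sortDesc_eq (sortDesc_twoExp hab hA))))
  have h1 : (Finset.univ.filter fun j => twoExp a b A j < twoExp a b A i) = Aᶜ := by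
    ext j
    by_cases hj : j ∈ A <;> simp [twoExp_apply, hi, hj, hab]
  have h2 : (Finset.univ.filter fun j => twoExp a b A i < twoExp a b A j) = ∅ := by
    ext j
    by_cases hj : j ∈ A <;> simp [twoExp_apply, hi, hj, hab.le]
  have h3 : Aᶜ.card = η := by rw [Finset.card_compl, Fintype.card_fin, hA]; omega
  rwa [h1, h2, Finset.sum_empty, smul_zero, sub_zero, h3, twoExp_apply, if_pos hi] at h

theorem polyOp_twoExp_of_notMem (θ : K) {η a b : ℕ} (hab : b < a) {A : Finset (Fin N)}
    (hA : A.card = N - η) {i : Fin N} (hi : i ∉ A) :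
    polyOp θ i (monomial (twoExp a b A) 1) ≡
      (b : K) • monomial (twoExp a b A) 1 - θ • exchangeSum K a b A i
      [SMOD restrictSupport K (lowerExps (twoValued N η a b))] := by
  have h := (polyOp_monomial θ (twoExp a b A) i).mono
    (restrictSupport_mono K (lowerExps_mono (majorized_of_sortDesc_eq (sortDesc_twoExp hab hA))))
  have h1 : (Finset.univ.filter fun j => twoExp a b A j < twoExp a b A i) = ∅ := by
    ext j
    by_cases hj : j ∈ A <;> simp [twoExp_apply, hi, hj, hab.le]
  have h2 : (Finset.univ.filter fun j => twoExp a b A i < twoExp a b A j) = A := by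
    ext j
    by_cases hj : j ∈ A <;> simp [twoExp_apply, hi, hj, hab]
  rw [h1, h2, Finset.card_empty, Nat.cast_zero, mul_zero, add_zero, twoExp_apply, if_neg hi] at h
  simp only [mapDomain_twoExp] at h
  exact h

/-- After the exchange `i` belongs to the set in every summand, so the scalar case applies. -/
theorem polyOp_exchangeSum (θ : K) {η a b : ℕ} (hη : η ≤ N) (hab : b < a) {A : Finset (Fin N)}
    (hA : A.card = N - η) {i : Fin N} :
    polyOp θ i (exchangeSum K a b A i) ≡ ((a : K) + θ * η) • exchangeSum K a b A i
      [SMOD restrictSupport K (lowerExps (twoValued N η a b))] := by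
  rw [exchangeSum, map_sum, Finset.smul_sum]
  refine SModEq.sum fun j hj => polyOp_twoExp_of_mem θ hη hab (by rw [Finset.card_map, hA]) ?_
  rw [mem_map_perm, Equiv.symm_swap, Equiv.swap_apply_left]
  exact hj

theorem polyOp_pow_twoExp_of_mem (θ : K) {η a b : ℕ} (hη : η ≤ N) (hab : b < a)
    {A : Finset (Fin N)} (hA : A.card = N - η) {i : Fin N} (hi : i ∈ A) (m : ℕ) :
    (polyOp θ i ^ m) (monomial (twoExp a b A) 1) ≡
      ((a : K) + θ * η) ^ m • monomial (twoExp a b A) 1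
      [SMOD restrictSupport K (lowerExps (twoValued N η a b))] := by
  induction m with
  | zero => rw [pow_zero, pow_zero, one_smul, Module.End.one_apply]; exact SModEq.refl _
  | succ m ih =>
    rw [pow_succ', Module.End.mul_apply]
    refine ((filtered_polyOp θ i).smodEq ih).trans ?_
    rw [map_smul, pow_succ, mul_smul]
    exact (polyOp_twoExp_of_mem θ hη hab hA hi).smul _

/-- On `x^A` and its exchange sum, `x i D i` is triangular with diagonal entries `b` and `a + θη`.
The off-diagonal entry of its `m`-th power is `-θ` times the divided difference. -/
theorem polyOp_pow_twoExp_of_notMem (θ : K) {η a b : ℕ} (hη : η ≤ N) (hab : b < a)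
    (hne : (a : K) + θ * η - b ≠ 0) {A : Finset (Fin N)} (hA : A.card = N - η) {i : Fin N}
    (hi : i ∉ A) (m : ℕ) :
    (polyOp θ i ^ m) (monomial (twoExp a b A) 1) ≡ (b : K) ^ m • monomial (twoExp a b A) 1
        - (θ * ((((a : K) + θ * η) ^ m - (b : K) ^ m) / ((a : K) + θ * η - b)))
          • exchangeSum K a b A i
      [SMOD restrictSupport K (lowerExps (twoValued N η a b))] := by
  induction m with
  | zero => simp
  | succ m ih =>
    rw [pow_succ', Module.End.mul_apply]
    refine ((filtered_polyOp θ i).smodEq ih).trans ?_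
    rw [map_sub, map_smul, map_smul]
    refine (((polyOp_twoExp_of_notMem θ hab hA hi).smul _).sub
      ((polyOp_exchangeSum θ hη hab hA).smul _)).trans ?_
    have hs : θ * ((((a : K) + θ * η) ^ (m + 1) - (b : K) ^ (m + 1)) / ((a : K) + θ * η - b))
        = (b : K) ^ m * θ + θ * ((((a : K) + θ * η) ^ m - (b : K) ^ m) / ((a : K) + θ * η - b))
          * ((a : K) + θ * η) := by
      field_simp
      ring
    rw [hs, pow_succ, smul_sub, smul_smul, smul_smul, smul_smul, add_smul, sub_sub]
    exact SModEq.refl _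

theorem heckmanPolychronakos_twoExp (θ : K) {η a b : ℕ} (hη : η ≤ N) (hab : b < a)
    (hne : (a : K) + θ * η - b ≠ 0) {A : Finset (Fin N)} (hA : A.card = N - η) (m : ℕ) :
    heckmanPolychronakos θ m (monomial (twoExp a b A) 1) ≡
      (((a : K) + θ * η) ^ m * ((N : K) - η) + (b : K) ^ m * η) • monomial (twoExp a b A) 1
        - (θ * ((((a : K) + θ * η) ^ m - (b : K) ^ m) / ((a : K) + θ * η - b)))
          • ∑ i ∈ Aᶜ, exchangeSum K a b A i
      [SMOD restrictSupport K (lowerExps (twoValued N η a b))] := by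
  rw [heckmanPolychronakos_eq, LinearMap.sum_apply, ← Finset.sum_add_sum_compl A]
  refine ((SModEq.sum fun i hi => polyOp_pow_twoExp_of_mem θ hη hab hA hi m).add
    (SModEq.sum fun i hi => polyOp_pow_twoExp_of_notMem θ hη hab hne hA
      (Finset.mem_compl.mp hi) m)).trans ?_
  have h3 : Aᶜ.card = η := by rw [Finset.card_compl, Fintype.card_fin, hA]; omega
  rw [Finset.sum_const, Finset.sum_sub_distrib, Finset.sum_const, hA, h3, ← Finset.smul_sum,
    ← Nat.cast_smul_eq_nsmul K, ← Nat.cast_smul_eq_nsmul K, Nat.cast_sub hη, smul_smul, smul_smul,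
    add_smul, mul_comm ((N : K) - η), mul_comm (η : K) ((b : K) ^ m), ← add_sub_assoc]
  exact SModEq.refl _

theorem heckmanPolychronakos_smodEq [CharZero K] (θ : K) {η a b : ℕ} (hη : η ≤ N) (hab : b < a)
    (hne : (a : K) + θ * η - b ≠ 0) (m : ℕ) {k : K} {v : MvPolynomial (Fin N) K}
    (hv : v ∈ (monomialRep (K := K) (twoValued N η a b)).toSubmodule)
    (hk : swapSum K N v = ((N : K) ^ 2 - 2 * (k * ((N : K) - k + 1))) • v) :
    heckmanPolychronakos θ m v ≡
      (((a : K) + θ * η) ^ m * ((N : K) - η) + (b : K) ^ m * η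
            - θ * ((((a : K) + θ * η) ^ m - (b : K) ^ m) / ((a : K) + θ * η - b))
              * ((η : K) * ((N : K) - η) - k * ((N : K) - k + 1))) • v
      [SMOD restrictSupport K (lowerExps (twoValued N η a b))] := by
  set h := (((a : K) + θ * η) ^ m - (b : K) ^ m) / ((a : K) + θ * η - b)
  set c := ((a : K) + θ * η) ^ m * ((N : K) - η) + (b : K) ^ m * η
  -- `T` is the leading part of `P m`: twice the sum of all exchanges is `swapSum` minus the scalar
  -- `(N - η)² + η²`. The final constant arises from `N² - (N - η)² - η² = 2η(N - η)`.
  let T : Module.End K (MvPolynomial (Fin N) K) := c • 1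
    - (θ * h / 2) • (swapSum K N - (((N : K) - η) ^ 2 + (η : K) ^ 2) • 1)
  have hT : (monomialRep (K := K) (twoValued N η a b)).toSubmodule ≤
      (restrictSupport K (lowerExps (twoValued N η a b))).comap
        (heckmanPolychronakos θ m - T) := by
    rw [monomialRep_twoValued hab, Submodule.span_le]
    rintro _ ⟨A, hA, rfl⟩
    have hA' : A.card = N - η := hA
    have h3 : Aᶜ.card = η := by rw [Finset.card_compl, Fintype.card_fin, hA']; omega
    have h1 := SModEq.sub_mem.mp (heckmanPolychronakos_twoExp θ hη hab hne hA' m)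
    change heckmanPolychronakos θ m (monomial (twoExp a b A) 1) - T (monomial (twoExp a b A) 1) ∈
      restrictSupport K (lowerExps (twoValued N η a b))
    convert h1 using 2
    have h2 := swapSum_twoExp (K := K) a b A
    rw [hA', h3, Nat.cast_sub hη] at h2
    simp only [T, LinearMap.sub_apply, LinearMap.smul_apply, Module.End.one_apply]
    rw [h2, add_sub_cancel_left, smul_smul, div_mul_cancel₀ _ two_ne_zero]
  have hv' : heckmanPolychronakos θ m v - T v ∈
      restrictSupport K (lowerExps (twoValued N η a b)) := hT hv
  refine (SModEq.sub_mem.mpr hv').trans ?_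
  convert SModEq.refl _ using 1
  simp only [T, LinearMap.sub_apply, LinearMap.smul_apply, Module.End.one_apply]
  rw [hk, ← sub_smul, smul_smul, ← sub_smul]
  congr 1
  field_simp
  ring

end TwoValued

/-! ### Diagrams with at most two rows -/

section YoungDiagrams

theorem mem_twoRow {p q i j : ℕ} :
    (i, j) ∈ twoRow p q ↔ (i = 0 ∧ j < p) ∨ (i = 1 ∧ j < min p q) := by
  rw [twoRow, YoungDiagram.mem_ofRowLens]
  rcases i with _ | _ | i
  · simp
  · simp
  · simp

theorem cells_twoRow {p q : ℕ} (h : q ≤ p) :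
    (twoRow p q).cells = (Finset.range p).map ⟨fun j => (0, j), fun _ _ h => (Prod.mk.inj h).2⟩
      ∪ (Finset.range q).map ⟨fun j => (1, j), fun _ _ h => (Prod.mk.inj h).2⟩ := by
  ext ⟨i, j⟩
  rw [YoungDiagram.mem_cells, mem_twoRow, min_eq_right h]
  simp only [Finset.mem_union, Finset.mem_map, Finset.mem_range, DFunLike.coe, Prod.mk.injEq]
  constructor
  · rintro (⟨rfl, h⟩ | ⟨rfl, h⟩)
    · exact Or.inl ⟨j, h, rfl, rfl⟩
    · exact Or.inr ⟨j, h, rfl, rfl⟩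
  · rintro (⟨j, h, rfl, rfl⟩ | ⟨j, h, rfl, rfl⟩)
    · exact Or.inl ⟨rfl, h⟩
    · exact Or.inr ⟨rfl, h⟩

theorem card_twoRow {p q : ℕ} (h : q ≤ p) : (twoRow p q).card = p + q := by
  rw [YoungDiagram.card, cells_twoRow h, Finset.card_union_of_disjoint]
  · simp
  · rw [Finset.disjoint_left]
    intro x hx hx'
    obtain ⟨j, _, rfl⟩ := Finset.mem_map.mp hx
    obtain ⟨j', _, h⟩ := Finset.mem_map.mp hx'
    exact absurd (congrArg Prod.fst h) one_ne_zero

/-- A diagram with at most two rows is a `twoRow`. -/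
theorem eq_twoRow_of_notMem {N : ℕ} {τ : YoungDiagram} (hτ : τ.card = N) (h : (2, 0) ∉ τ) :
    ∃ k, 2 * k ≤ N ∧ τ = twoRow (N - k) k := by
  have hle : τ.rowLen 1 ≤ τ.rowLen 0 := τ.rowLen_anti 0 1 (by omega)
  have heq : τ = twoRow (τ.rowLen 0) (τ.rowLen 1) := by
    ext ⟨i, j⟩
    rw [YoungDiagram.mem_cells, YoungDiagram.mem_cells, mem_twoRow, min_eq_right hle]
    rcases i with _ | _ | i
    · simp [YoungDiagram.mem_iff_lt_rowLen]
    · simp [YoungDiagram.mem_iff_lt_rowLen]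
    · have : (i + 1 + 1, j) ∉ τ := fun h' => h (τ.up_left_mem (by omega) (Nat.zero_le j) h')
      simp [this]
  have hc := card_twoRow hle
  rw [← heq, hτ] at hc
  refine ⟨τ.rowLen 1, by omega, ?_⟩
  rwa [show N - τ.rowLen 1 = τ.rowLen 0 by omega]

end YoungDiagrams

/-! ### Specht polynomials -/

section SpechtPolynomials

variable {K : Type*} [Field K] {N : ℕ}

/-- The pairs of cells of `τ` lying in the same column, the first one above the second one. -/
def columnPairs (τ : YoungDiagram) : Finset ({c // c ∈ τ.cells} × {c // c ∈ τ.cells}) :=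
  Finset.univ.filter fun pq => pq.1.1.2 = pq.2.1.2 ∧ pq.1.1.1 < pq.2.1.1

theorem spechtPoly_eq_prod (τ : YoungDiagram) (t : {c // c ∈ τ.cells} ≃ Fin N) :
    spechtPoly (K := K) τ t = ∏ pq ∈ columnPairs τ, (X (t pq.1) - X (t pq.2)) := by
  rw [spechtPoly, columnPairs, Finset.prod_filter, ← Finset.univ_product_univ,
    Finset.prod_product]
  exact Finset.prod_congr rfl fun p _ => Finset.prod_filter _ _

/-- The cells are adjacent in their column, so the transposition reverses only the factor of this
pair and permutes the other factors without changing their orientation. -/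
theorem rename_swap_spechtPoly (τ : YoungDiagram) (t : {c // c ∈ τ.cells} ≃ Fin N)
    {p q : {c // c ∈ τ.cells}} (hc : p.1.2 = q.1.2) (hr : q.1.1 = p.1.1 + 1) :
    rename (Equiv.swap (t p) (t q)) (spechtPoly (K := K) τ t) = -spechtPoly τ t := by
  have hpq : (p, q) ∈ columnPairs τ := by
    simp only [columnPairs, Finset.mem_filter, Finset.mem_univ, true_and]
    exact ⟨hc, by omega⟩
  have hne : p ≠ q := by rintro rfl; omega
  have hsw : ∀ c, Equiv.swap (t p) (t q) (t c) = t (Equiv.swap p q c) :=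
    fun c => t.injective.swap_apply p q c
  have hext : ∀ c d : {c // c ∈ τ.cells}, c = d ↔ c.1.2 = d.1.2 ∧ c.1.1 = d.1.1 := fun c d =>
    ⟨fun h => h ▸ ⟨rfl, rfl⟩, fun h => Subtype.ext (Prod.ext h.2 h.1)⟩
  have hcol : ∀ c, (Equiv.swap p q c).1.2 = c.1.2 := fun c => by
    rw [Equiv.swap_apply_def]
    split_ifs with h h
    · rw [h, hc]
    · rw [h, hc]
    · rfl
  have hrow : ∀ c, (Equiv.swap p q c).1.1 = if c.1.2 = p.1.2 ∧ c.1.1 = p.1.1 then p.1.1 + 1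
      else if c.1.2 = p.1.2 ∧ c.1.1 = p.1.1 + 1 then p.1.1 else c.1.1 := fun c => by
    have h1 := hext c p
    have h2 := hext c q
    rw [Equiv.swap_apply_def]
    by_cases h3 : c = p
    · rw [if_pos h3, if_pos (h1.mp h3), hr]
    · rw [if_neg h3, if_neg fun h => h3 (h1.mpr h)]
      by_cases h4 : c = q
      · rw [if_pos h4, if_pos (by rw [h4, hc, hr]; exact ⟨rfl, rfl⟩)]
      · rw [if_neg h4, if_neg fun h => h4 (h2.mpr (by rwa [← hc, hr]))]
  rw [spechtPoly_eq_prod, map_prod, ← Finset.mul_prod_erase _ _ hpq,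
    ← Finset.mul_prod_erase _ _ hpq, ← neg_mul]
  congr 1
  · simp
  · refine Finset.prod_nbij' (fun x => (Equiv.swap p q x.1, Equiv.swap p q x.2))
      (fun x => (Equiv.swap p q x.1, Equiv.swap p q x.2)) ?_ ?_ ?_ ?_ ?_
    rotate_left 2
    · simp
    · simp
    · intro x _; simp [hsw]
    all_goals
      rintro ⟨x, y⟩ hxy
      simp only [columnPairs, Finset.mem_erase, Finset.mem_filter, Finset.mem_univ, true_and,
        ne_eq, Prod.mk.injEq, hext, hcol, hrow] at hxy ⊢
      split_ifs <;> omega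

theorem exists_filling {τ : YoungDiagram} (hτ : τ.card = N) :
    Nonempty ({c // c ∈ τ.cells} ≃ Fin N) :=
  ⟨Fintype.equivFinOfCardEq (by rw [Fintype.card_coe]; exact hτ)⟩

/-- For two rows the Specht polynomial is a product of differences of distinct variables. -/
theorem exists_spechtPoly_twoRow_eq {p q : ℕ} (h : q ≤ p)
    (t : {c // c ∈ (twoRow p q).cells} ≃ Fin N) :
    ∃ P Q : Fin q → Fin N, Function.Injective P ∧ Function.Injective Q ∧ (∀ i j, P i ≠ Q j) ∧
      spechtPoly (K := K) (twoRow p q) t = ∏ j, (X (P j) - X (Q j)) := by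
  have h0 : ∀ j : Fin q, (0, j.val) ∈ (twoRow p q).cells := fun j => by
    rw [YoungDiagram.mem_cells, mem_twoRow]; exact Or.inl ⟨rfl, by omega⟩
  have h1 : ∀ j : Fin q, (1, j.val) ∈ (twoRow p q).cells := fun j => by
    rw [YoungDiagram.mem_cells, mem_twoRow]; exact Or.inr ⟨rfl, by omega⟩
  refine ⟨fun j => t ⟨_, h0 j⟩, fun j => t ⟨_, h1 j⟩, ?_, ?_, ?_, ?_⟩
  · intro i j hij
    simpa [Fin.ext_iff] using hij
  · intro i j hij
    simpa [Fin.ext_iff] using hij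
  · intro i j hij
    simp at hij
  · rw [spechtPoly_eq_prod]
    symm
    refine Finset.prod_bij (fun j _ => (⟨_, h0 j⟩, ⟨_, h1 j⟩)) ?_ ?_ ?_ ?_
    · intro j _
      simp [columnPairs]
    · intro i _ j _ hij
      simpa [Fin.ext_iff] using hij
    · rintro ⟨⟨⟨i, j⟩, hx⟩, ⟨⟨i', j'⟩, hy⟩⟩ hxy
      simp only [columnPairs, Finset.mem_filter, Finset.mem_univ, true_and] at hxy
      obtain ⟨rfl, hlt⟩ := hxy
      have hx' := hx
      have hy' := hy
      rw [YoungDiagram.mem_cells, mem_twoRow] at hx' hy'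
      have hi : i = 0 := by omega
      have hi' : i' = 1 := by omega
      subst hi; subst hi'
      exact ⟨⟨j, by omega⟩, Finset.mem_univ _, rfl⟩
    · intro j _; rfl

end SpechtPolynomials

/-! ### Harmonic multilinear polynomials and the eigenvalue of `swapSum` -/

section Multilinear

variable {K : Type*} [Field K] {N : ℕ}

/-- A Taylor expansion of the transposition. It turns the action of `swapSum` on multilinear
polynomials into a second-order differential operator. -/
theorem sub_rename_swap_monomial {γ : Fin N →₀ ℕ} (hγ : ∀ l, γ l ≤ 1) {i j : Fin N} (hij : i ≠ j) :
    (monomial γ (1 : K)) - rename (Equiv.swap i j) (monomial γ 1)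
      = (X i - X j) * (pderiv i (monomial γ 1) - pderiv j (monomial γ 1))
        + (X i - X j) ^ 2 * pderiv i (pderiv j (monomial γ 1)) := by
  -- `r` is the factor free of `x i` and `x j`; four cases for the two exponents remain.
  set r : MvPolynomial (Fin N) K := monomial ((γ.update i 0).update j 0) 1 with hr
  have hγr : monomial γ (1 : K) = X i ^ γ i * X j ^ γ j * r := by
    rw [hr, X_pow_eq_monomial, X_pow_eq_monomial, monomial_mul, monomial_mul, one_mul, one_mul]
    congr 2
    refine Finsupp.ext fun l => ?_
    rcases eq_or_ne l i with rfl | hi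
    · simp [Finsupp.coe_update, hij]
    · rcases eq_or_ne l j with rfl | hj
      · simp [Finsupp.coe_update, hij.symm]
      · simp [Finsupp.coe_update, Function.update_of_ne hi, Function.update_of_ne hj, hi.symm,
          hj.symm]
  have hri : pderiv i r = 0 := by
    rw [hr, pderiv_monomial]
    simp [Finsupp.coe_update, Function.update_of_ne hij]
  have hrj : pderiv j r = 0 := by
    rw [hr, pderiv_monomial]
    simp [Finsupp.coe_update]
  have hsr : rename (Equiv.swap i j) r = r := by
    rw [hr, rename_monomial]
    congr 2
    refine Finsupp.ext fun l => ?_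
    rw [coe_mapDomain_perm, Equiv.symm_swap, Function.comp_apply]
    rcases eq_or_ne l i with rfl | hi
    · simp [Finsupp.coe_update, Function.update_of_ne hij]
    · rcases eq_or_ne l j with rfl | hj
      · simp [Finsupp.coe_update, Function.update_of_ne hij]
      · rw [Equiv.swap_apply_of_ne_of_ne hi hj]
  rw [hγr]
  have h1 := hγ i
  have h2 := hγ j
  interval_cases γ i <;> interval_cases γ j <;>
    simp [hri, hrj, hsr, Derivation.leibniz, pderiv_X_of_ne hij, pderiv_X_of_ne hij.symm] <;> ring

theorem sub_rename_swap {f : MvPolynomial (Fin N) K} (hf : f ∈ restrictDegree (Fin N) K 1)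
    (i j : Fin N) :
    f - rename (Equiv.swap i j) f
      = (X i - X j) * (pderiv i f - pderiv j f) + (X i - X j) ^ 2 * pderiv i (pderiv j f) := by
  rcases eq_or_ne i j with rfl | hij
  · simp
  rw [mem_restrictDegree] at hf
  rw [f.as_sum]
  simp only [map_sum, ← Finset.sum_sub_distrib, Finset.mul_sum, ← Finset.sum_add_distrib]
  refine Finset.sum_congr rfl fun γ hγ => ?_
  have h : monomial γ (coeff γ f) = coeff γ f • monomial γ (1 : K) := by
    rw [smul_monomial, smul_eq_mul, mul_one]
  rw [h]
  simp only [map_smul, Derivation.map_smul, ← smul_sub, mul_smul_comm, ← smul_add]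
  rw [sub_rename_swap_monomial (hf γ hγ) hij]

theorem pderiv_comm (i j : Fin N) (f : MvPolynomial (Fin N) K) :
    pderiv i (pderiv j f) = pderiv j (pderiv i f) := by
  have hX : ∀ i j l : Fin N, pderiv i (pderiv j (X l : MvPolynomial (Fin N) K)) = 0 := by
    intro i j l
    rw [pderiv_X, Pi.single_apply]
    split_ifs <;> simp
  induction f using MvPolynomial.induction_on with
  | C c => simp
  | add p q hp hq => simp only [map_add, hp, hq]
  | mul_X p l hp =>
    simp only [Derivation.leibniz, map_add, smul_eq_mul, hX, hp]
    ring

/-- The translation-invariant multilinear polynomials that are homogeneous of degree `k`. -/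
def IsHarmonic (k : ℕ) (f : MvPolynomial (Fin N) K) : Prop :=
  f ∈ restrictDegree (Fin N) K 1 ∧ f.IsHomogeneous k ∧ ∑ i, pderiv i f = 0

theorem IsHarmonic.add {k : ℕ} {f g : MvPolynomial (Fin N) K} (hf : IsHarmonic k f)
    (hg : IsHarmonic k g) : IsHarmonic k (f + g) :=
  ⟨add_mem hf.1 hg.1, hf.2.1.add hg.2.1, by
    simp only [map_add, Finset.sum_add_distrib, hf.2.2, hg.2.2, add_zero]⟩

theorem IsHarmonic.smul {k : ℕ} {f : MvPolynomial (Fin N) K} (c : K) (hf : IsHarmonic k f) :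
    IsHarmonic k (c • f) :=
  ⟨Submodule.smul_mem _ _ hf.1, by
      rw [← mem_homogeneousSubmodule] at *
      exact Submodule.smul_mem _ _ ((mem_homogeneousSubmodule k f).mpr hf.2.1), by
    simp only [Derivation.map_smul, ← Finset.smul_sum, hf.2.2, smul_zero]⟩

theorem IsHarmonic.zero (k : ℕ) : IsHarmonic k (0 : MvPolynomial (Fin N) K) :=
  ⟨zero_mem _, isHomogeneous_zero _ _ _, by simp⟩

/-- Summing the expansion over all pairs, translation invariance kills every term with a free sum of
derivatives, and Euler's identity evaluates the others: `2Nk` from first order and `-2k(k - 1)` from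
second order. -/
theorem IsHarmonic.swapSum_eq {k : ℕ} {f : MvPolynomial (Fin N) K} (hf : IsHarmonic k f) :
    swapSum K N f = ((N : K) ^ 2 - 2 * ((k : K) * ((N : K) - k + 1))) • f := by
  obtain ⟨h1, h2, h3⟩ := hf
  have hE : ∑ i, X i * pderiv i f = (k : MvPolynomial (Fin N) K) * f := by
    rw [h2.sum_X_mul_pderiv, nsmul_eq_mul]
  have hD : ∀ i, ∑ j, pderiv i (pderiv j f) = 0 := fun i => by
    rw [← map_sum, h3, map_zero]
  have hcomm : ∀ i j, pderiv i (pderiv j f) = pderiv j (pderiv i f) := fun i j =>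
    pderiv_comm i j f
  have hEE : ∀ i, ∑ j, X j * pderiv i (pderiv j f)
      = (k : MvPolynomial (Fin N) K) * pderiv i f - pderiv i f := by
    intro i
    have h := congrArg (pderiv i) hE
    simp only [map_sum, Derivation.leibniz, smul_eq_mul, Finset.sum_add_distrib,
      Derivation.map_natCast, mul_zero, add_zero, pderiv_X, Pi.single_apply] at h
    simp only [mul_ite, mul_one, mul_zero, Finset.sum_ite_eq', Finset.mem_univ,
      if_true] at h
    rw [← h]; ring
  have hterm : ∀ i j, rename (Equiv.swap i j) f = f - (X i * pderiv i f + X j * pderiv j f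
      - X i * pderiv j f - X j * pderiv i f + X i ^ 2 * pderiv i (pderiv j f)
      + X j ^ 2 * pderiv j (pderiv i f) - 2 * (X i * (X j * pderiv i (pderiv j f)))) := by
    intro i j
    have := sub_rename_swap h1 i j
    rw [hcomm j i]
    linear_combination -this
  have e1 : ∑ i : Fin N, ∑ j : Fin N, X i * pderiv i f
      = (N : MvPolynomial (Fin N) K) * (k * f) := by
    rw [Finset.sum_comm]; simp only [hE, Finset.sum_const, Finset.card_univ, Fintype.card_fin,
      nsmul_eq_mul]
  have e2 : ∑ i : Fin N, ∑ j : Fin N, X j * pderiv j f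
      = (N : MvPolynomial (Fin N) K) * (k * f) := by
    simp only [hE, Finset.sum_const, Finset.card_univ, Fintype.card_fin, nsmul_eq_mul]
  have e3 : ∑ i : Fin N, ∑ j : Fin N, (X i : MvPolynomial (Fin N) K) * pderiv j f = 0 := by
    simp only [← Finset.mul_sum, h3, mul_zero, Finset.sum_const_zero]
  have e4 : ∑ i : Fin N, ∑ j : Fin N, (X j : MvPolynomial (Fin N) K) * pderiv i f = 0 := by
    rw [Finset.sum_comm]; exact e3
  have e5 : ∑ i : Fin N, ∑ j : Fin N,
      (X i : MvPolynomial (Fin N) K) ^ 2 * pderiv i (pderiv j f) = 0 := by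
    simp only [← Finset.mul_sum, hD, mul_zero, Finset.sum_const_zero]
  have e6 : ∑ i : Fin N, ∑ j : Fin N,
      (X j : MvPolynomial (Fin N) K) ^ 2 * pderiv j (pderiv i f) = 0 := by
    rw [Finset.sum_comm]; exact e5
  have e7 : ∑ i : Fin N, ∑ j : Fin N,
      (2 : MvPolynomial (Fin N) K) * (X i * (X j * pderiv i (pderiv j f)))
      = 2 * (k * (k * f) - k * f) := by
    simp only [← Finset.mul_sum, hEE, mul_sub, Finset.sum_sub_distrib,
      mul_left_comm _ (k : MvPolynomial (Fin N) K), hE]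
  simp only [swapSum, LinearMap.sum_apply, permRep_apply, hterm, Finset.sum_sub_distrib,
    Finset.sum_add_distrib, e1, e2, e3, e4, e5, e6, e7]
  simp only [Finset.sum_const, Finset.card_univ, Fintype.card_fin, nsmul_eq_mul]
  rw [smul_eq_C_mul]
  simp only [map_sub, map_mul, map_pow, map_natCast, map_add, map_one, map_ofNat]
  ring

/-- The variables are distinct, so no exponent exceeds one; each factor is linear and is annihilated
by the derivation `∑ ∂_i`. -/
theorem isHarmonic_prod {k : ℕ} {P Q : Fin k → Fin N} (hP : Function.Injective P)
    (hQ : Function.Injective Q) (hPQ : ∀ i j, P i ≠ Q j) :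
    IsHarmonic k (∏ j, (X (P j) - X (Q j)) : MvPolynomial (Fin N) K) := by
  refine ⟨?_, ?_, ?_⟩
  · rw [mem_restrictDegree]
    intro γ hγ i
    refine (degreeOf_le_iff.mp le_rfl γ hγ).trans ((degreeOf_prod_le i _ _).trans ?_)
    have h1 : ∀ j, degreeOf i (X (P j) - X (Q j) : MvPolynomial (Fin N) K)
        ≤ if P j = i ∨ Q j = i then 1 else 0 := by
      intro j
      refine (degreeOf_sub_le i _ _).trans ?_
      rw [degreeOf_X, degreeOf_X]
      split_ifs <;> simp_all
    refine (Finset.sum_le_sum fun j _ => h1 j).trans ?_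
    rw [← Finset.card_filter]
    refine Finset.card_le_one.mpr fun x hx y hy => ?_
    simp only [Finset.mem_filter, Finset.mem_univ, true_and] at hx hy
    rcases hx with hx | hx <;> rcases hy with hy | hy
    · exact hP (hx.trans hy.symm)
    · exact absurd (hx.trans hy.symm) (hPQ _ _)
    · exact absurd (hy.trans hx.symm) (hPQ _ _)
    · exact hQ (hx.trans hy.symm)
  · have := IsHomogeneous.prod (R := K) Finset.univ
      (fun j => (X (P j) - X (Q j) : MvPolynomial (Fin N) K)) (fun _ => 1)
      fun j _ => (isHomogeneous_X K _).sub (isHomogeneous_X K _)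
    simpa using this
  · have h : ∀ s : Finset (Fin k), ∑ i, pderiv i
        (∏ j ∈ s, (X (P j) - X (Q j)) : MvPolynomial (Fin N) K) = 0 := by
      intro s
      induction s using Finset.induction_on with
      | empty => simp
      | insert j s hj ih =>
        simp only [Finset.prod_insert hj, Derivation.leibniz, Finset.sum_add_distrib, smul_eq_mul,
          ← Finset.mul_sum, ih, mul_zero, zero_add, map_sub, Finset.sum_sub_distrib, pderiv_X]
        simp [Pi.single_apply]
    exact h Finset.univ

theorem isHarmonic_of_mem_specht {p q : ℕ} (h : q ≤ p) {f : MvPolynomial (Fin N) K}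
    (hf : f ∈ (specht (K := K) (N := N) (twoRow p q)).toSubmodule) : IsHarmonic q f := by
  induction hf using Submodule.span_induction with
  | mem x hx =>
    obtain ⟨t, rfl⟩ := hx
    obtain ⟨P, Q, hP, hQ, hPQ, heq⟩ := exists_spechtPoly_twoRow_eq (K := K) h t
    rw [heq]
    exact isHarmonic_prod hP hQ hPQ
  | zero => exact IsHarmonic.zero q
  | add x y _ _ hx hy => exact hx.add hy
  | smul c x _ hx => exact hx.smul c

end Multilinear

/-! ### Evaluation at indicator vectors -/

section Slice

variable {K : Type*} [Field K] {N : ℕ}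

/-- The indicator function of `A`, as a point of `K ^ N`. -/
def indicator (K : Type*) [Field K] (A : Finset (Fin N)) (i : Fin N) : K := if i ∈ A then 1 else 0

/-- The equivariant map sending a polynomial `f` to the sum of the monomials of the sets `A` of
size `d`, with the values of `f` at the indicator functions of `A` as coefficients. -/
noncomputable def slice (a b d : ℕ) : Module.End K (MvPolynomial (Fin N) K) :=
  ∑ A ∈ Finset.powersetCard d Finset.univ,
    (aeval (indicator K A)).toLinearMap.smulRight (monomial (twoExp a b A) 1)

theorem slice_apply (a b d : ℕ) (f : MvPolynomial (Fin N) K) :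
    slice a b d f = ∑ A ∈ Finset.powersetCard d Finset.univ,
      aeval (indicator K A) f • monomial (twoExp a b A) (1 : K) := by
  simp [slice, LinearMap.sum_apply]

theorem coeff_slice {a b d : ℕ} (hab : b < a) {A : Finset (Fin N)} (hA : A.card = d)
    (f : MvPolynomial (Fin N) K) : coeff (twoExp a b A) (slice a b d f)
      = aeval (indicator K A) f := by
  rw [slice_apply, coeff_sum]
  simp only [coeff_smul, coeff_monomial, (twoExp_injective hab).eq_iff, smul_eq_mul, mul_ite,
    mul_one, mul_zero, Finset.sum_ite_eq']
  rw [if_pos (Finset.mem_powersetCard.mpr ⟨Finset.subset_univ _, hA⟩)]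

theorem monomial_twoExp_mem {η a b : ℕ} (hab : b < a) {A : Finset (Fin N)} (hA : A.card = N - η) :
    monomial (twoExp a b A) (1 : K) ∈ (monomialRep (K := K) (twoValued N η a b)).toSubmodule := by
  rw [monomialRep_twoValued hab]
  exact Submodule.subset_span ⟨A, hA, rfl⟩

theorem slice_mem {η a b : ℕ} (hab : b < a) (f : MvPolynomial (Fin N) K) :
    slice a b (N - η) f ∈ (monomialRep (K := K) (twoValued N η a b)).toSubmodule := by
  rw [slice_apply]
  exact Submodule.sum_mem _ fun A hA => Submodule.smul_mem _ _
    (monomial_twoExp_mem hab (Finset.mem_powersetCard.mp hA).2)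

theorem rename_slice (a b d : ℕ) (σ : Equiv.Perm (Fin N)) (f : MvPolynomial (Fin N) K) :
    rename σ (slice a b d f) = slice a b d (rename σ f) := by
  rw [slice_apply, slice_apply, map_sum]
  refine Finset.sum_equiv (Equiv.finsetCongr σ) (fun A => ?_) (fun A _ => ?_)
  · simp [Finset.mem_powersetCard]
  · rw [map_smul, rename_monomial, mapDomain_twoExp, Equiv.finsetCongr_apply, aeval_rename]
    congr 3
    funext i
    simp [indicator]

theorem slice_swapSum (a b d : ℕ) (f : MvPolynomial (Fin N) K) :
    slice a b d (swapSum K N f) = swapSum K N (slice a b d f) := by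
  simp only [swapSum, LinearMap.sum_apply, map_sum, permRep_apply, rename_slice]

/-- For sets of equal size `k`, the monomial of `A` at the indicator of `B` is `1` if `A = B` and
`0` otherwise. This realizes the Specht module inside a two-valued module, so that one argument
treats both. -/
theorem slice_eq_self {k : ℕ} (hk : k ≤ N) {f : MvPolynomial (Fin N) K}
    (hf : f ∈ (monomialRep (K := K) (twoValued N (N - k) 1 0)).toSubmodule) :
    slice 1 0 k f = f := by
  rw [monomialRep_twoValued one_pos] at hf
  induction hf using Submodule.span_induction with
  | zero => simp
  | add x y _ _ hx hy => rw [map_add, hx, hy]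
  | smul c x _ hx => rw [map_smul, hx]
  | mem x hx =>
    obtain ⟨A, hA, rfl⟩ := hx
    have hA' : A.card = k := by rw [hA]; omega
    have hev : ∀ B : Finset (Fin N), B.card = k →
        aeval (indicator K B) (monomial (twoExp 1 0 A) (1 : K)) = if B = A then 1 else 0 := by
      intro B hB
      rw [aeval_monomial, map_one, one_mul, Finsupp.prod_fintype _ _ (by simp)]
      simp only [twoExp_apply]
      split_ifs with h
      · subst h
        exact Finset.prod_eq_one fun i _ => by by_cases hi : i ∈ B <;> simp [indicator, hi]
      · obtain ⟨i, hi, hi'⟩ : ∃ i ∈ A, i ∉ B := by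
          by_contra hc
          push Not at hc
          exact h (Finset.eq_of_subset_of_card_le hc (by rw [hA', hB])).symm
        exact Finset.prod_eq_zero (Finset.mem_univ i) (by simp [indicator, hi, hi'])
    change slice 1 0 k (monomial (twoExp 1 0 A) 1) = monomial (twoExp 1 0 A) 1
    rw [slice_apply, Finset.sum_congr rfl fun B hB => by
      rw [hev B (Finset.mem_powersetCard.mp hB).2]]
    simp only [ite_smul, one_smul, zero_smul, Finset.sum_ite_eq']
    rw [if_pos (Finset.mem_powersetCard.mpr ⟨Finset.subset_univ _, hA'⟩)]

theorem IsHarmonic.mem_monomialRep {k : ℕ} (hk : k ≤ N) {f : MvPolynomial (Fin N) K}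
    (hf : IsHarmonic k f) :
    f ∈ (monomialRep (K := K) (twoValued N (N - k) 1 0)).toSubmodule := by
  rw [monomialRep_toSubmodule]
  refine mem_restrictSupport_of_coeff fun γ hγ => ?_
  have h1 := (mem_restrictDegree _ _ _).mp hf.1 γ (mem_support_iff.mpr hγ)
  have h2 := hf.2.1 hγ
  have hγA : γ = twoExp 1 0 (Finset.univ.filter fun i => γ i = 1) := by
    refine Finsupp.ext fun i => ?_
    rw [twoExp_apply]
    have := h1 i
    by_cases h : γ i = 1 <;> simp [h]; omega
  rw [hγA]
  refine sortDesc_twoExp one_pos ?_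
  rw [Finsupp.weight_apply, Finsupp.sum_fintype _ _ (by simp)] at h2
  rw [Finset.card_filter]
  rw [show N - (N - k) = k by omega, ← h2]
  refine Finset.sum_congr rfl fun i _ => ?_
  have := h1 i
  simp only [Pi.one_apply, smul_eq_mul, mul_one]
  split_ifs <;> omega

theorem exists_slice_ne_zero {η a b k : ℕ} (hab : b < a)
    (hk : k ≤ min η (N - η)) :
    ∃ f ∈ (specht (K := K) (N := N) (twoRow (N - k) k)).toSubmodule, slice a b (N - η) f ≠ 0 := by
  have hk' : k ≤ N - k := by omega
  obtain ⟨t⟩ := exists_filling (N := N) (τ := twoRow (N - k) k)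
    (by rw [card_twoRow hk']; omega)
  refine ⟨_, Submodule.subset_span ⟨t, rfl⟩, ?_⟩
  obtain ⟨P, Q, hP, hQ, hPQ, heq⟩ := exists_spechtPoly_twoRow_eq (K := K) hk' t
  have hsub : Finset.univ.image P ⊆ (Finset.univ.image Q)ᶜ := by
    intro x hx
    obtain ⟨i, _, rfl⟩ := Finset.mem_image.mp hx
    simp only [Finset.mem_compl, Finset.mem_image, Finset.mem_univ, true_and, not_exists]
    exact fun j h => hPQ i j h.symm
  -- A set containing every `P j` and no `Q j` makes each factor equal to `1`. It exists since `k ≤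
  -- N - η` and `k ≤ η`.
  obtain ⟨A, hPA, hAQ, hA⟩ := Finset.exists_subsuperset_card_eq hsub (n := N - η)
    (by rw [Finset.card_image_of_injective _ hP, Finset.card_univ, Fintype.card_fin]; omega)
    (by rw [Finset.card_compl, Finset.card_image_of_injective _ hQ, Finset.card_univ,
      Fintype.card_fin, Fintype.card_fin]; omega)
  intro h0
  have h1 := coeff_slice (K := K) hab hA (spechtPoly (twoRow (N - k) k) t)
  rw [h0, coeff_zero, heq, map_prod] at h1
  refine one_ne_zero (α := K) (h1.trans (Finset.prod_eq_one fun j _ => ?_)).symm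
  have hPj : P j ∈ A := hPA (Finset.mem_image_of_mem _ (Finset.mem_univ j))
  have hQj : Q j ∉ A := fun h =>
    Finset.mem_compl.mp (hAQ h) (Finset.mem_image_of_mem _ (Finset.mem_univ j))
  simp [indicator, hPj, hQj]

end Slice

/-! ### Vectors fixed by the stabilizer of a subset -/

section Invariants

variable {K : Type*} [Field K] {N : ℕ}

/-- The polynomials fixed by all permutations that preserve `A₀`. -/
def stabInvariants (K : Type*) [Field K] (A₀ : Finset (Fin N)) :
    Submodule K (MvPolynomial (Fin N) K) where
  carrier := {f | ∀ σ : Equiv.Perm (Fin N), A₀.map σ.toEmbedding = A₀ → rename σ f = f}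
  add_mem' hf hg σ hσ := by rw [map_add, hf σ hσ, hg σ hσ]
  zero_mem' σ _ := map_zero _
  smul_mem' c f hf σ hσ := by rw [map_smul, hf σ hσ]

theorem coeff_rename_perm (σ : Equiv.Perm (Fin N)) (f : MvPolynomial (Fin N) K) (a b : ℕ)
    (A : Finset (Fin N)) :
    coeff (twoExp a b (A.map σ.toEmbedding)) (rename σ f) = coeff (twoExp a b A) f := by
  rw [← mapDomain_twoExp, coeff_rename_mapDomain _ σ.injective]

theorem map_mul_perm (σ ρ : Equiv.Perm (Fin N)) (A : Finset (Fin N)) :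
    A.map (σ * ρ).toEmbedding = (A.map ρ.toEmbedding).map σ.toEmbedding := by
  rw [Finset.map_map]; rfl

/-- The two conditions fix the sizes of all four cells of the Venn diagram with `A₀`, so the cells
can be matched by a permutation. -/
theorem exists_map_perm_eq {A B A₀ : Finset (Fin N)} (h : A.card = B.card)
    (h' : (A \ A₀).card = (B \ A₀).card) : ∃ σ : Equiv.Perm (Fin N),
      A₀.map σ.toEmbedding = A₀ ∧ A.map σ.toEmbedding = B := by
  obtain ⟨σ, hσ⟩ := exists_perm_comp_eq (f := fun i => (decide (i ∈ A₀), decide (i ∈ A)))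
    (g := fun i => (decide (i ∈ A₀), decide (i ∈ B))) (by
      have key : ∀ C : Finset (Fin N),
          (Finset.univ.filter fun i => (decide (i ∈ A₀), decide (i ∈ C)) = (true, true)) = C ∩ A₀ ∧
          (Finset.univ.filter fun i => (decide (i ∈ A₀), decide (i ∈ C)) = (true, false)) = A₀ \ C ∧
          (Finset.univ.filter fun i => (decide (i ∈ A₀), decide (i ∈ C)) = (false, true)) = C \ A₀ ∧
          (Finset.univ.filter fun i => (decide (i ∈ A₀), decide (i ∈ C)) = (false, false))
            = (A₀ ∪ C)ᶜ := by
        intro C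
        refine ⟨?_, ?_, ?_, ?_⟩ <;> ext i <;> simp [and_comm]
      have h1 : ∀ C : Finset (Fin N), (C \ A₀).card + (C ∩ A₀).card = C.card :=
        fun C => Finset.card_sdiff_add_card_inter C A₀
      have h2 : ∀ C : Finset (Fin N), (A₀ \ C).card + (C ∩ A₀).card = A₀.card :=
        fun C => by rw [Finset.inter_comm]; exact Finset.card_sdiff_add_card_inter A₀ C
      have h3 : ∀ C : Finset (Fin N), (A₀ ∪ C).card = A₀.card + (C \ A₀).card :=
        fun C => by
          rw [← Finset.union_sdiff_self_eq_union, Finset.card_union_of_disjoint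
            Finset.disjoint_sdiff]
      have a1 := h1 A
      have a2 := h1 B
      have b1 := h2 A
      have b2 := h2 B
      rintro ⟨_ | _, _ | _⟩
      · rw [(key A).2.2.2, (key B).2.2.2, Finset.card_compl, Finset.card_compl, h3, h3, h']
      · rw [(key A).2.2.1, (key B).2.2.1, h']
      · rw [(key A).2.1, (key B).2.1]; omega
      · rw [(key A).1, (key B).1]; omega)
  have hmem : ∀ i, (σ i ∈ A₀ ↔ i ∈ A₀) ∧ (σ i ∈ B ↔ i ∈ A) := fun i => by
    have := congrFun hσ i
    simpa only [Function.comp_apply, Prod.mk.injEq, decide_eq_decide] using this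
  refine ⟨σ, ?_, ?_⟩
  · ext i
    rw [mem_map_perm, ← (hmem (σ.symm i)).1, Equiv.apply_symm_apply]
  · ext i
    rw [mem_map_perm, ← (hmem (σ.symm i)).2, Equiv.apply_symm_apply]

theorem eq_zero_of_coeff_twoExp {η a b : ℕ} (hab : b < a) {f : MvPolynomial (Fin N) K}
    (hf : f ∈ (monomialRep (K := K) (twoValued N η a b)).toSubmodule)
    (h : ∀ A : Finset (Fin N), A.card = N - η → coeff (twoExp a b A) f = 0) : f = 0 := by
  rw [monomialRep_toSubmodule] at hf
  ext γ
  rw [coeff_zero]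
  by_contra h'
  obtain ⟨A, hA, rfl⟩ := exists_eq_twoExp hab (hf (mem_support_iff.mpr h'))
  exact h' (h A hA)

/-- After moving a nonzero coefficient to `A₀`, averaging over the stabilizer multiplies it by the
order of that group, which is nonzero in characteristic zero. -/
theorem exists_mem_stabInvariants [CharZero K] {η a b : ℕ} (hab : b < a)
    {A₀ : Finset (Fin N)} (hA₀ : A₀.card = N - η) {W : Subrepresentation (permRep K N)}
    (hW : W.toSubmodule ≤ (monomialRep (K := K) (twoValued N η a b)).toSubmodule)
    (h0 : W.toSubmodule ≠ ⊥) : ∃ u ∈ W.toSubmodule, u ∈ stabInvariants K A₀ ∧ u ≠ 0 := by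
  obtain ⟨f, hf, hf0⟩ := Submodule.exists_mem_ne_zero_of_ne_bot h0
  obtain ⟨A, hA, hfA⟩ : ∃ A : Finset (Fin N), A.card = N - η ∧ coeff (twoExp a b A) f ≠ 0 := by
    by_contra hc
    push Not at hc
    exact hf0 (eq_zero_of_coeff_twoExp hab (hW hf) hc)
  obtain ⟨ρ, -, hρ⟩ := exists_map_perm_eq (A := A) (B := A₀) (A₀ := ∅) (by rw [hA, hA₀])
    (by rw [Finset.sdiff_empty, Finset.sdiff_empty, hA, hA₀])
  set g := rename ρ f with hg
  have hgW : g ∈ W.toSubmodule := W.apply_mem_toSubmodule ρ hf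
  have hg0 : coeff (twoExp a b A₀) g ≠ 0 := by rwa [← hρ, hg, coeff_rename_perm]
  set S := Finset.univ.filter fun σ : Equiv.Perm (Fin N) => A₀.map σ.toEmbedding = A₀ with hS
  have hS1 : S.card ≠ 0 := Finset.card_ne_zero.mpr 
    ⟨1, Finset.mem_filter.mpr ⟨Finset.mem_univ _, Finset.map_refl⟩⟩
  refine ⟨∑ σ ∈ S, rename σ g, Submodule.sum_mem _ fun σ _ => W.apply_mem_toSubmodule σ hgW, ?_, ?_⟩
  · intro τ hτ
    rw [map_sum]
    refine Finset.sum_equiv (Equiv.mulLeft τ) (fun σ => ?_) (fun σ _ => ?_)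
    · simp only [hS, Finset.mem_filter, Finset.mem_univ, true_and, Equiv.coe_mulLeft, map_mul_perm]
      nth_rw 4 [← hτ]
      exact (Finset.map_injective _).eq_iff.symm
    · rw [rename_rename]; rfl
  · intro hz
    have h1 := congrArg (coeff (twoExp a b A₀)) hz
    rw [coeff_sum, coeff_zero, Finset.sum_congr rfl fun σ hσ => by
      rw [show coeff (twoExp a b A₀) (rename σ g) = coeff (twoExp a b A₀) g by
        have hσ' := (Finset.mem_filter.mp hσ).2
        conv_lhs => rw [← hσ']
        exact coeff_rename_perm σ g a b A₀], Finset.sum_const, nsmul_eq_mul] at h1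
    exact (mul_ne_zero (Nat.cast_ne_zero.mpr hS1) hg0) h1

/-- An invariant vector is determined by its coefficients on one representative of each orbit of
subsets, and the orbits are indexed by `|A \ A₀|`. -/
theorem card_le_of_linearIndependent {η a b : ℕ} (hη : η ≤ N) (hab : b < a)
    {A₀ : Finset (Fin N)} (hA₀ : A₀.card = N - η) {ι : Type*} [Fintype ι]
    {v : ι → MvPolynomial (Fin N) K} (hv : LinearIndependent K v)
    (hV : ∀ i, v i ∈ (monomialRep (K := K) (twoValued N η a b)).toSubmodule)
    (hI : ∀ i, v i ∈ stabInvariants K A₀) : Fintype.card ι ≤ min η (N - η) + 1 := by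
  classical
  -- One representative for each size of `A \ A₀`. The default `∅` is harmless, since only
  -- injectivity of the coefficient map `R` is used.
  let B : Fin (min η (N - η) + 1) → Finset (Fin N) := fun j =>
    if h : ∃ A : Finset (Fin N), A.card = N - η ∧ (A \ A₀).card = j.val then h.choose else ∅
  let R : MvPolynomial (Fin N) K →ₗ[K] (Fin (min η (N - η) + 1) → K) :=
    LinearMap.pi fun j => lcoeff K (twoExp a b (B j))
  have hR : ∀ f, f ∈ (monomialRep (K := K) (twoValued N η a b)).toSubmodule ⊓ stabInvariants K A₀ →
      R f = 0 → f = 0 := by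
    intro f hf hRf
    refine eq_zero_of_coeff_twoExp hab hf.1 fun A hA => ?_
    have hle : (A \ A₀).card < min η (N - η) + 1 := by
      have h1 : (A \ A₀).card ≤ A.card := Finset.card_le_card Finset.sdiff_subset
      have h2 : (A \ A₀).card ≤ A₀ᶜ.card := Finset.card_le_card fun i hi => by
        rw [Finset.mem_compl]; exact (Finset.mem_sdiff.mp hi).2
      rw [Finset.card_compl, Fintype.card_fin] at h2
      omega
    have hex : ∃ A' : Finset (Fin N), A'.card = N - η ∧
        (A' \ A₀).card = (⟨_, hle⟩ : Fin (min η (N - η) + 1)).val := ⟨A, hA, rfl⟩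
    have hB : B ⟨_, hle⟩ = hex.choose := dif_pos hex
    obtain ⟨hc1, hc2⟩ := hex.choose_spec
    obtain ⟨σ, hσ, hσA⟩ := exists_map_perm_eq (A := A) (B := hex.choose) (A₀ := A₀)
      (by rw [hA, hc1]) hc2.symm
    have h3 : coeff (twoExp a b (B ⟨_, hle⟩)) f = 0 := congrFun hRf ⟨_, hle⟩
    rw [hB, ← hσA, ← hf.2 σ hσ, coeff_rename_perm] at h3
    exact h3
  have hli : LinearIndependent K (R ∘ v) := by
    refine hv.map ?_
    rw [Submodule.disjoint_def]
    intro x hx hx'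
    refine hR x ?_ hx'
    refine (Submodule.span_le.mpr ?_) hx
    rintro _ ⟨i, rfl⟩
    exact ⟨hV i, hI i⟩
  have := hli.fintype_card_le_finrank
  rwa [Module.finrank_fin_fun] at this

end Invariants

/-! ### Decomposition of `V_λ` and irreducibility -/

section Decomposition

variable {K : Type*} [Field K] {N : ℕ}

/-- By Maschke the sum has an invariant complement. If the complement met `V_λ`, it would supply one
more independent invariant vector than the dimension allows. -/
theorem iSup_eq_monomialRep [CharZero K] {η a b : ℕ} (hη : η ≤ N) (hab : b < a)
    (W : Fin (min η (N - η) + 1) → Subrepresentation (permRep K N))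
    (hW : ∀ j, (W j).toSubmodule ≤ (monomialRep (K := K) (twoValued N η a b)).toSubmodule)
    (h0 : ∀ j, (W j).toSubmodule ≠ ⊥) (hind : iSupIndep fun j => (W j).toSubmodule) :
    ⨆ j, (W j).toSubmodule = (monomialRep (K := K) (twoValued N η a b)).toSubmodule := by
  obtain ⟨A₀, -, hA₀⟩ := Finset.exists_subset_card_eq
    (s := (Finset.univ : Finset (Fin N))) (n := N - η) (by simp)
  let T : Subrepresentation (permRep K N) :=
    { toSubmodule := ⨆ j, (W j).toSubmodule
      apply_mem_toSubmodule := fun σ f hf => by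
        have h : ⨆ j, (W j).toSubmodule ≤
            (⨆ j, (W j).toSubmodule).comap (permRep K N σ) :=
          iSup_le fun j x hx => Submodule.mem_iSup_of_mem j ((W j).apply_mem_toSubmodule σ hx)
        exact h hf }
  have hTV : T.toSubmodule ≤ (monomialRep (K := K) (twoValued N η a b)).toSubmodule :=
    iSup_le hW
  refine le_antisymm hTV ?_
  have : NeZero (Nat.card (Equiv.Perm (Fin N)) : K) := ⟨Nat.cast_ne_zero.mpr Nat.card_pos.ne'⟩
  have : ComplementedLattice (Subrepresentation (permRep K N)) :=
    (inferInstance : Representation.IsSemisimpleRepresentation (permRep K N))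
  obtain ⟨Q, hQ⟩ := exists_isCompl T
  have hdisj : T.toSubmodule ⊓ Q.toSubmodule = ⊥ := by
    have := hQ.inf_eq_bot
    exact congrArg Subrepresentation.toSubmodule this
  have hcod : T.toSubmodule ⊔ Q.toSubmodule = ⊤ := by
    have := hQ.sup_eq_top
    exact congrArg Subrepresentation.toSubmodule this
  by_cases hU : (Q ⊓ monomialRep (twoValued N η a b)).toSubmodule = ⊥
  · intro x hx
    obtain ⟨y, hy, z, hz, rfl⟩ := Submodule.mem_sup.mp (hcod ▸ Submodule.mem_top (x := x))
    have hz' : z ∈ (Q ⊓ monomialRep (twoValued N η a b)).toSubmodule :=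
      ⟨hz, by have := sub_mem hx (hTV hy); rwa [add_sub_cancel_left] at this⟩
    rw [hU, Submodule.mem_bot] at hz'
    rw [hz', add_zero]
    exact hy
  · exfalso
    obtain ⟨u, hu, huI, hu0⟩ := exists_mem_stabInvariants hab hA₀
      (W := Q ⊓ monomialRep (twoValued N η a b)) (fun x hx => hx.2) hU
    choose v hv hvI hv0 using fun j => exists_mem_stabInvariants hab hA₀ (hW j) (h0 j)
    have hli : LinearIndependent K v := hind.linearIndependent _ hv hv0
    have hnot : u ∉ Submodule.span K (Set.range v) := by
      intro h
      have h1 : u ∈ T.toSubmodule := by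
        refine (Submodule.span_le.mpr ?_) h
        rintro _ ⟨j, rfl⟩
        exact Submodule.mem_iSup_of_mem j (hv j)
      have h2 : u ∈ T.toSubmodule ⊓ Q.toSubmodule := ⟨h1, hu.1⟩
      rw [hdisj, Submodule.mem_bot] at h2
      exact hu0 h2
    have hcard := card_le_of_linearIndependent hη hab hA₀ (hli.option hnot)
      (fun o => by cases o with
        | none => exact hu.2
        | some j => exact hW j (hv j))
      (fun o => by cases o with
        | none => exact huI
        | some j => exact hvI j)
    simp at hcard

/-- The eigenvalue of `swapSum` on the irreducible representation labelled by `(N - k, k)`. -/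
def swapEigenvalue (K : Type*) [Field K] (N k : ℕ) : K :=
  (N : K) ^ 2 - 2 * ((k : K) * ((N : K) - k + 1))

/-- The difference of two eigenvalues is a nonzero multiple of `(k - l)(N + 1 - k - l)`, and the
second factor is nonzero when `2k, 2l ≤ N`. -/
theorem swapEigenvalue_inj [CharZero K] {k l : ℕ} (hk : 2 * k ≤ N) (hl : 2 * l ≤ N)
    (h : swapEigenvalue K N k = swapEigenvalue K N l) : k = l := by
  have h1 : ((k : K) - l) * ((N : K) + 1 - k - l) = 0 := by
    have h2 : (2 : K) * (((k : K) - l) * ((N : K) + 1 - k - l)) = 0 := by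
      unfold swapEigenvalue at h
      linear_combination -h
    simpa using h2
  rcases mul_eq_zero.mp h1 with h2 | h2
  · exact_mod_cast sub_eq_zero.mp h2
  · exfalso
    have h3 : ((N + 1 : ℕ) : K) = ((k + l : ℕ) : K) := by
      push_cast
      linear_combination h2
    have := Nat.cast_injective h3
    omega

theorem swapSum_of_mem_specht {k : ℕ} (hk : 2 * k ≤ N) {f : MvPolynomial (Fin N) K}
    (hf : f ∈ (specht (K := K) (N := N) (twoRow (N - k) k)).toSubmodule) :
    swapSum K N f = swapEigenvalue K N k • f :=
  (isHarmonic_of_mem_specht (by omega) hf).swapSum_eq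

/-- The copy of the irreducible representation labelled by `(N - k, k)` in the representation
spanned by the monomials with `N - η` exponents `a` and `η` exponents `b`. -/
noncomputable def component (K : Type*) [Field K] (N η a b k : ℕ) :
    Subrepresentation (permRep K N) where
  toSubmodule := (specht (K := K) (N := N) (twoRow (N - k) k)).toSubmodule.map (slice a b (N - η))
  apply_mem_toSubmodule σ f hf := by
    obtain ⟨g, hg, rfl⟩ := hf
    exact ⟨_, (specht (twoRow (N - k) k)).apply_mem_toSubmodule σ hg, (rename_slice _ _ _ σ g).symm⟩

variable {η a b : ℕ}

theorem component_le (hab : b < a) (k : ℕ) : (component K N η a b k).toSubmodule ≤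
    (monomialRep (K := K) (twoValued N η a b)).toSubmodule := by
  rintro _ ⟨g, _, rfl⟩
  exact slice_mem hab g

theorem component_ne_bot (hab : b < a) {k : ℕ} (hk : k ≤ min η (N - η)) :
    (component K N η a b k).toSubmodule ≠ ⊥ := by
  obtain ⟨f, hf, hf0⟩ := exists_slice_ne_zero (K := K) hab hk
  intro h
  have : slice a b (N - η) f ∈ (component K N η a b k).toSubmodule := ⟨f, hf, rfl⟩
  rw [h, Submodule.mem_bot] at this
  exact hf0 this

theorem component_le_eigenspace {k : ℕ} (hk : 2 * k ≤ N) :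
    (component K N η a b k).toSubmodule
      ≤ (swapSum K N).eigenspace (swapEigenvalue K N k) := by
  rintro _ ⟨g, hg, rfl⟩
  rw [Module.End.mem_eigenspace_iff, ← slice_swapSum, swapSum_of_mem_specht hk hg, map_smul]

theorem specht_eq_component {k : ℕ} (hk : 2 * k ≤ N) :
    (specht (K := K) (N := N) (twoRow (N - k) k)).toSubmodule
      = (component K N (N - k) 1 0 k).toSubmodule := by
  have h : ∀ f ∈ (specht (K := K) (N := N) (twoRow (N - k) k)).toSubmodule,
      slice 1 0 (N - (N - k)) f = f := fun f hf => by
    rw [show N - (N - k) = k by omega]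
    exact slice_eq_self (by omega)
      ((isHarmonic_of_mem_specht (by omega) hf).mem_monomialRep (by omega))
  ext f
  exact ⟨fun hf => ⟨f, hf, h f hf⟩, by rintro ⟨g, hg, rfl⟩; rwa [h g hg]⟩

variable [CharZero K]

theorem iSupIndep_component : iSupIndep fun k : Fin (min η (N - η) + 1) =>
    (component K N η a b k).toSubmodule := by
  have hinj : Function.Injective fun k : Fin (min η (N - η) + 1) =>
      swapEigenvalue K N (k : ℕ) := fun k l h =>
    Fin.ext (swapEigenvalue_inj (by omega) (by omega) h)
  exact ((Module.End.eigenspaces_iSupIndep (swapSum K N)).comp hinj).mono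
    fun k => component_le_eigenspace (by omega)

theorem iSup_component (hη : η ≤ N) (hab : b < a) :
    ⨆ k : Fin (min η (N - η) + 1), (component K N η a b k).toSubmodule
      = (monomialRep (K := K) (twoValued N η a b)).toSubmodule :=
  iSup_eq_monomialRep hη hab (fun k => component K N η a b k) (fun _ => component_le hab _)
    (fun k => component_ne_bot hab (by omega)) iSupIndep_component

/-- Replacing one component by a nonzero subrepresentation leaves an independent family of the
extremal length, which must again fill `V_λ`. So nothing was lost. -/
theorem component_eq_of_le (hη : η ≤ N) (hab : b < a) {k : ℕ} (hk : k ≤ min η (N - η))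
    {U : Subrepresentation (permRep K N)}
    (hU : U.toSubmodule ≤ (component K N η a b k).toSubmodule) (h0 : U.toSubmodule ≠ ⊥) :
    U.toSubmodule = (component K N η a b k).toSubmodule := by
  let k' : Fin (min η (N - η) + 1) := ⟨k, by omega⟩
  let W : Fin (min η (N - η) + 1) → Subrepresentation (permRep K N) :=
    fun j => if j = k' then U else component K N η a b j
  have hWle : ∀ j, (W j).toSubmodule ≤ (component K N η a b j).toSubmodule := by
    intro j
    by_cases hj : j = k'
    · subst hj; simpa only [W, if_true] using hU
    · simp only [W, if_neg hj]; exact le_rfl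
  have htop := iSup_eq_monomialRep hη hab W (fun j => (hWle j).trans (component_le hab _))
    (fun j => by
      by_cases hj : j = k'
      · simpa only [W, if_pos hj] using h0
      · simp only [W, if_neg hj]; exact component_ne_bot hab (by omega))
    (iSupIndep_component.mono hWle)
  refine le_antisymm hU fun x hx => ?_
  have hx1 : x ∈ U.toSubmodule ⊔ ⨆ (j) (_ : j ≠ k'), (component K N η a b j).toSubmodule := by
    have hx2 : x ∈ ⨆ j, (W j).toSubmodule := htop ▸ component_le hab _ hx
    refine (iSup_le fun j => ?_ : ⨆ j, (W j).toSubmodule ≤ _) hx2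
    by_cases hj : j = k'
    · simp only [W, if_pos hj]; exact le_sup_left
    · exact (hWle j).trans (le_sup_of_le_right (le_iSup₂_of_le j hj le_rfl))
  obtain ⟨u, hu, y, hy, rfl⟩ := Submodule.mem_sup.mp hx1
  have hy' : y ∈ (component K N η a b k).toSubmodule := by
    have := sub_mem hx (hU hu)
    rwa [add_sub_cancel_left] at this
  have := Submodule.disjoint_def.mp (iSupIndep_component (K := K) (N := N) (η := η) (a := a)
    (b := b) k') y hy' hy
  rwa [this, add_zero]

/-- The part of `f` in the other components would lie in this eigenspace and in the sum of the
others, hence is zero. -/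
theorem mem_component_of_swapSum (hη : η ≤ N) (hab : b < a) {k : ℕ} (hk : k ≤ min η (N - η))
    {f : MvPolynomial (Fin N) K} (hf : f ∈ (monomialRep (K := K) (twoValued N η a b)).toSubmodule)
    (h : swapSum K N f = swapEigenvalue K N k • f) :
    f ∈ (component K N η a b k).toSubmodule := by
  let k' : Fin (min η (N - η) + 1) := ⟨k, by omega⟩
  rw [← iSup_component hη hab] at hf
  have hf' : f ∈ (component K N η a b k).toSubmodule ⊔
      ⨆ (j) (_ : j ≠ k'), (component K N η a b j).toSubmodule := by
    refine (iSup_le fun j => ?_ :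
      ⨆ j : Fin (min η (N - η) + 1), (component K N η a b j).toSubmodule ≤ _) hf
    by_cases hj : j = k'
    · subst hj; exact le_sup_left
    · exact le_sup_of_le_right (le_iSup₂_of_le j hj le_rfl)
  obtain ⟨u, hu, y, hy, rfl⟩ := Submodule.mem_sup.mp hf'
  have hu' := component_le_eigenspace (K := K) (N := N) (k := k) (by omega) hu
  have hy' : y ∈ (swapSum K N).eigenspace (swapEigenvalue K N k) := by
    have := sub_mem (Module.End.mem_eigenspace_iff.mpr h) hu'
    rwa [add_sub_cancel_left] at this
  have hy2 : y ∈ ⨆ (μ) (_ : μ ≠ swapEigenvalue K N k), (swapSum K N).eigenspace μ := by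
    refine (iSup₂_le fun j hj => ?_ :
      ⨆ (j) (_ : j ≠ k'), (component K N η a b j).toSubmodule ≤ _) hy
    refine (component_le_eigenspace (by omega)).trans (le_iSup₂_of_le _ ?_ le_rfl)
    exact fun he => hj (Fin.ext (swapEigenvalue_inj (by omega) (by omega) he))
  have := Submodule.disjoint_def.mp
    (Module.End.eigenspaces_iSupIndep (swapSum K N) (swapEigenvalue K N k)) y hy' hy2
  rw [this, add_zero]
  exact hu

theorem eq_zero_of_swapSum (hη : η ≤ N) (hab : b < a) {k : ℕ} (hk : min η (N - η) < k)
    (hk' : 2 * k ≤ N) {f : MvPolynomial (Fin N) K}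
    (hf : f ∈ (monomialRep (K := K) (twoValued N η a b)).toSubmodule)
    (h : swapSum K N f = swapEigenvalue K N k • f) : f = 0 := by
  rw [← iSup_component hη hab] at hf
  have hf2 : f ∈ ⨆ (μ) (_ : μ ≠ swapEigenvalue K N k), (swapSum K N).eigenspace μ := by
    refine (iSup_le fun j => ?_ :
      ⨆ j : Fin (min η (N - η) + 1), (component K N η a b j).toSubmodule ≤ _) hf
    refine (component_le_eigenspace (by omega)).trans (le_iSup₂_of_le _ ?_ le_rfl)
    intro he
    have := swapEigenvalue_inj (by omega) hk' he
    omega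
  exact Submodule.disjoint_def.mp
    (Module.End.eigenspaces_iSupIndep (swapSum K N) (swapEigenvalue K N k)) f
    (Module.End.mem_eigenspace_iff.mpr h) hf2

theorem specht_eq_of_le {k : ℕ} (hk : 2 * k ≤ N) {U : Subrepresentation (permRep K N)}
    (hU : U.toSubmodule ≤ (specht (K := K) (N := N) (twoRow (N - k) k)).toSubmodule)
    (h0 : U.toSubmodule ≠ ⊥) :
    U.toSubmodule = (specht (K := K) (N := N) (twoRow (N - k) k)).toSubmodule := by
  rw [specht_eq_component hk] at hU ⊢
  exact component_eq_of_le (by omega) one_pos (by omega) hU h0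

/-- The kernel of `slice` in the Specht module is a subrepresentation. It is not everything, so by
irreducibility it is zero. -/
theorem slice_injOn_specht (hab : b < a) {k : ℕ} (hk : k ≤ min η (N - η))
    {f : MvPolynomial (Fin N) K}
    (hf : f ∈ (specht (K := K) (N := N) (twoRow (N - k) k)).toSubmodule)
    (h0 : slice a b (N - η) f = 0) : f = 0 := by
  let U : Subrepresentation (permRep K N) :=
    { toSubmodule := (specht (K := K) (N := N) (twoRow (N - k) k)).toSubmodule ⊓
        LinearMap.ker (slice a b (N - η))
      apply_mem_toSubmodule := fun σ g hg =>
        ⟨(specht (twoRow (N - k) k)).apply_mem_toSubmodule σ hg.1, by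
          have : slice a b (N - η) g = 0 := hg.2
          change slice a b (N - η) (rename σ g) = 0
          rw [← rename_slice, this, map_zero]⟩ }
  by_contra hne
  have hU0 : U.toSubmodule ≠ ⊥ := fun h => by
    have : f ∈ U.toSubmodule := ⟨hf, h0⟩
    rw [h, Submodule.mem_bot] at this
    exact hne this
  have hU := specht_eq_of_le (K := K) (N := N) (k := k) (by omega) (U := U) (fun _ h => h.1) hU0
  obtain ⟨g, hg, hg0⟩ := exists_slice_ne_zero (K := K) hab hk
  rw [← hU] at hg
  exact hg0 hg.2

end Decomposition

/-! ### Isotypic components -/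

section Isotypic

variable {K : Type*} [Field K] {N : ℕ}

theorem coe_equiv_symm_apply {U S : Subrepresentation (permRep K N)}
    (e : U.toRepresentation.Equiv S.toRepresentation) (σ : Equiv.Perm (Fin N))
    (s : S.toSubmodule) :
    (e.symm (S.toRepresentation σ s) : MvPolynomial (Fin N) K) = rename σ (e.symm s).1 :=
  congrArg Subtype.val (e.symm.toIntertwiningMap.isIntertwining _ _ σ s)

theorem swapSum_equiv_symm {U S : Subrepresentation (permRep K N)}
    (e : U.toRepresentation.Equiv S.toRepresentation) {s : S.toSubmodule} {c : K}
    (h : swapSum K N s.1 = c • s.1) :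
    swapSum K N (e.symm s).1 = c • (e.symm s).1 := by
  have h1 : ∑ i, ∑ j, S.toRepresentation (Equiv.swap i j) s = c • s := by
    refine Subtype.ext ?_
    rw [Submodule.coe_smul, ← h]
    simp only [swapSum, LinearMap.sum_apply, Submodule.coe_sum]
    rfl
  have h2 := congrArg (fun x => (e.symm x : MvPolynomial (Fin N) K)) h1
  simp only [map_sum, Submodule.coe_sum, coe_equiv_symm_apply, map_smul, Submodule.coe_smul] at h2
  rw [← h2]
  simp only [swapSum, LinearMap.sum_apply, permRep_apply]

theorem swapSum_of_equiv_specht {U : Subrepresentation (permRep K N)} {k : ℕ} (hk : 2 * k ≤ N)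
    (e : U.toRepresentation.Equiv (specht (K := K) (N := N) (twoRow (N - k) k)).toRepresentation)
    {u : MvPolynomial (Fin N) K} (hu : u ∈ U.toSubmodule) :
    swapSum K N u = swapEigenvalue K N k • u := by
  have := swapSum_equiv_symm e (swapSum_of_mem_specht hk (e ⟨u, hu⟩).2)
  have h2 : e.symm (e ⟨u, hu⟩) = ⟨u, hu⟩ := e.toLinearEquiv.symm_apply_apply _
  rwa [h2] at this

variable {η a b : ℕ}

theorem nonempty_component_equiv [CharZero K] (hab : b < a) {k : ℕ}
    (hk : k ≤ min η (N - η)) :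
    Nonempty ((component K N η a b k).toRepresentation.Equiv
      (specht (K := K) (N := N) (twoRow (N - k) k)).toRepresentation) := by
  let S := (specht (K := K) (N := N) (twoRow (N - k) k)).toSubmodule
  let φ : S →ₗ[K] (component K N η a b k).toSubmodule :=
    (slice a b (N - η)).restrict fun f hf => ⟨f, hf, rfl⟩
  have hφ : Function.Bijective φ := by
    constructor
    · rw [injective_iff_map_eq_zero]
      intro f hf
      exact Subtype.ext (slice_injOn_specht hab hk f.2 (congrArg Subtype.val hf))
    · rintro ⟨_, f, hf, rfl⟩
      exact ⟨⟨f, hf⟩, rfl⟩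
  refine ⟨(Representation.Equiv.mk (LinearEquiv.ofBijective φ hφ) fun σ => ?_).symm⟩
  refine LinearMap.ext fun f => Subtype.ext ?_
  exact (rename_slice _ _ _ σ f.1).symm

/-- Every copy of the Specht module inherits its `swapSum` eigenvalue, and in `V_λ` that eigenvalue
singles out the component. This is multiplicity one. -/
theorem isotypic_twoRow [CharZero K] (hη : η ≤ N) (hab : b < a) {k : ℕ}
    (hk : k ≤ min η (N - η)) :
    isotypic (K := K) (twoValued N η a b) (twoRow (N - k) k) = component K N η a b k := by
  refine Subrepresentation.toSubmodule_injective (le_antisymm (iSup_le ?_) ?_)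
  · rintro ⟨U, hU, ⟨e⟩⟩ u hu
    exact mem_component_of_swapSum hη hab hk (hU hu) (swapSum_of_equiv_specht (by omega) e hu)
  · exact le_iSup (fun U : {U : Subrepresentation (permRep K N) //
      U ≤ monomialRep (twoValued N η a b) ∧ Nonempty (U.toRepresentation.Equiv
        (specht (K := K) (N := N) (twoRow (N - k) k)).toRepresentation)} => U.1.toSubmodule)
      ⟨component K N η a b k, component_le hab k, nonempty_component_equiv hab hk⟩

theorem isIrreducible_component [CharZero K] (hη : η ≤ N) (hab : b < a) {k : ℕ}
    (hk : k ≤ min η (N - η)) : (component K N η a b k).toRepresentation.IsIrreducible := by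
  have hbot := component_ne_bot (K := K) (N := N) hab hk
  refine { exists_pair_ne := ⟨⊥, ⊤, fun h => ?_⟩, eq_bot_or_eq_top := fun W => ?_ }
  · have h' : (⊥ : Submodule K (component K N η a b k).toSubmodule) = ⊤ :=
      congrArg Subrepresentation.toSubmodule h
    refine hbot (eq_bot_iff.mpr fun x hx => ?_)
    have : (⟨x, hx⟩ : (component K N η a b k).toSubmodule) ∈
      (⊥ : Submodule K (component K N η a b k).toSubmodule) := h' ▸ Submodule.mem_top
    exact congrArg Subtype.val ((Submodule.mem_bot K).mp this)
  · let U : Subrepresentation (permRep K N) :=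
      { toSubmodule := W.toSubmodule.map (component K N η a b k).toSubmodule.subtype
        apply_mem_toSubmodule := by
          rintro σ _ ⟨w, hw, rfl⟩
          exact ⟨_, W.apply_mem_toSubmodule σ hw, rfl⟩ }
    by_cases h0 : U.toSubmodule = ⊥
    · left
      refine Subrepresentation.toSubmodule_injective (eq_bot_iff.mpr fun w hw => ?_)
      have : w.1 ∈ U.toSubmodule := ⟨w, hw, rfl⟩
      rw [h0, Submodule.mem_bot] at this
      exact (Submodule.mem_bot K).mpr (Subtype.ext this)
    · right
      have hU := component_eq_of_le hη hab hk (U := U) (Submodule.map_subtype_le _ _) h0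
      refine Subrepresentation.toSubmodule_injective (eq_top_iff.mpr fun w _ => ?_)
      have hw : w.1 ∈ U.toSubmodule := by
        rw [hU]
        exact w.2
      obtain ⟨w', hw', h⟩ := hw
      rwa [← Subtype.ext h]

theorem coeff_twoExp_eq_zero [CharZero K] {i j : Fin N} {f : MvPolynomial (Fin N) K}
    (h : rename (Equiv.swap i j) f = -f) {A : Finset (Fin N)} (hA : i ∈ A ↔ j ∈ A) :
    coeff (twoExp a b A) f = 0 := by
  have := coeff_rename_perm (Equiv.swap i j) f a b A
  rw [map_swap_eq_self hA, h, coeff_neg] at this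
  exact self_eq_neg.mp this.symm

/-- A polynomial in two exponents cannot be antisymmetric in three variables. -/
theorem eq_zero_of_rename_swap [CharZero K] (hab : b < a) {i j l : Fin N} (hil : i ≠ l)
    (hjl : j ≠ l) {f : MvPolynomial (Fin N) K}
    (hf : f ∈ (monomialRep (K := K) (twoValued N η a b)).toSubmodule)
    (h₁ : rename (Equiv.swap i j) f = -f) (h₂ : rename (Equiv.swap j l) f = -f) : f = 0 := by
  refine eq_zero_of_coeff_twoExp hab hf fun A _ => ?_
  by_cases hij : i ∈ A ↔ j ∈ A
  · exact coeff_twoExp_eq_zero h₁ hij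
  by_cases hjl' : j ∈ A ↔ l ∈ A
  · exact coeff_twoExp_eq_zero h₂ hjl'
  -- Now `i` and `l` lie on the same side of `A` and `j` on the other. The transposition of `i` and
  -- `j` moves this to a set having `j` and `l` on the same side.
  have h := coeff_rename_perm (Equiv.swap i j) f a b A
  rw [h₁, coeff_neg, coeff_twoExp_eq_zero h₂, neg_zero] at h
  · exact h.symm
  · rw [mem_map_perm, mem_map_perm, Equiv.symm_swap, Equiv.swap_apply_right,
      Equiv.swap_apply_of_ne_of_ne hil.symm hjl.symm]
    tauto

/-- A Specht polynomial is antisymmetric in the first three entries of its first column, so its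
image in `V_λ` vanishes; these polynomials span. -/
theorem eq_bot_of_equiv_specht [CharZero K] (hab : b < a) {τ : YoungDiagram} (hτ : (2, 0) ∈ τ)
    {U : Subrepresentation (permRep K N)} (hU : U ≤ monomialRep (twoValued N η a b))
    (e : U.toRepresentation.Equiv (specht (K := K) (N := N) τ).toRepresentation) :
    U.toSubmodule = ⊥ := by
  let p : Fin 3 → {c // c ∈ τ.cells} := fun i =>
    ⟨(i, 0), τ.up_left_mem (by omega) le_rfl hτ⟩
  have hp : Function.Injective p := fun i j h => Fin.ext (by simpa [p] using h)
  have hspan : (specht (K := K) (N := N) τ).toSubmodule ≤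
      (LinearMap.ker e.symm.toLinearEquiv.toLinearMap).map
        (specht (K := K) (N := N) τ).toSubmodule.subtype := by
    refine Submodule.span_le.mpr ?_
    rintro _ ⟨t, rfl⟩
    have hmem : spechtPoly τ t ∈ (specht (K := K) (N := N) τ).toSubmodule :=
      Submodule.subset_span ⟨t, rfl⟩
    refine ⟨⟨spechtPoly τ t, hmem⟩, ?_, rfl⟩
    have hswap : ∀ i j : Fin 3, (j : ℕ) = i + 1 →
        rename (Equiv.swap (t (p i)) (t (p j))) (e.symm ⟨spechtPoly τ t, hmem⟩).1
          = -(e.symm ⟨spechtPoly τ t, hmem⟩).1 := fun i j hij => by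
      rw [← coe_equiv_symm_apply, ← Submodule.coe_neg, ← map_neg]
      congr 2
      exact Subtype.ext (rename_swap_spechtPoly τ t (p := p i) (q := p j) rfl hij)
    exact Subtype.ext (eq_zero_of_rename_swap hab
      (fun h => absurd (hp (t.injective h)) (by decide))
      (fun h => absurd (hp (t.injective h)) (by decide))
      (hU (e.symm ⟨spechtPoly τ t, hmem⟩).2) (hswap 0 1 rfl) (hswap 1 2 rfl))
  refine eq_bot_iff.mpr fun u hu => ?_
  obtain ⟨s, hs, hse⟩ := hspan (e ⟨u, hu⟩).2
  have h1 : e.symm (e ⟨u, hu⟩) = ⟨u, hu⟩ := e.toLinearEquiv.symm_apply_apply _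
  rw [← Subtype.ext hse] at h1
  exact congrArg Subtype.val (h1.symm.trans hs)

theorem isotypic_eq_bot [CharZero K] (hη : η ≤ N) (hab : b < a) {τ : YoungDiagram}
    (hτ : τ.card = N) (h : ∀ k : ℕ, k ≤ min η (N - η) → τ ≠ twoRow (N - k) k) :
    isotypic (K := K) (twoValued N η a b) τ = ⊥ := by
  refine Subrepresentation.toSubmodule_injective (eq_bot_iff.mpr (iSup_le ?_))
  rintro ⟨U, hU, ⟨e⟩⟩
  by_cases h2 : (2, 0) ∈ τ
  · exact (eq_bot_of_equiv_specht hab h2 hU e).le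
  · obtain ⟨k, hk, rfl⟩ := eq_twoRow_of_notMem hτ h2
    intro u hu
    exact (Submodule.mem_bot K).mpr (eq_zero_of_swapSum hη hab
      (not_le.mp fun hle => h k hle rfl) hk (hU hu) (swapSum_of_equiv_specht hk e hu))

end Isotypic

/-! ### Non-degeneracy for the admissible parameters -/

section Parameter

variable {K : Type*} [Field K] [Algebra ℂ K] {θ : K} {N : ℕ}

theorem add_mul_sub_ne_zero [CharZero K]
    (hθ : (∃ t : ℝ, 0 < t ∧ θ = algebraMap ℂ K (t : ℂ)) ∨ Transcendental ℂ θ)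
    {η a b : ℕ} (hab : b < a) : (a : K) + θ * η - b ≠ 0 := by
  rcases hθ with ⟨t, ht, rfl⟩ | ht
  · have h : (a : K) + algebraMap ℂ K t * η - b
        = algebraMap ℂ K (((a : ℝ) + t * η - b : ℝ) : ℂ) := by
      push_cast
      simp
    rw [h, Ne, map_eq_zero, Complex.ofReal_eq_zero]
    have h1 : (b : ℝ) < a := by exact_mod_cast hab
    have h2 : 0 ≤ t * η := by positivity
    linarith
  · intro h
    rcases Nat.eq_zero_or_pos η with rfl | hη
    · have : (a : K) = b := by linear_combination h - θ * Nat.cast_zero (R := K)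
      exact hab.ne' (Nat.cast_injective this)
    · refine ht ⟨Polynomial.C (η : ℂ) * Polynomial.X + Polynomial.C ((a : ℂ) - b), ?_, ?_⟩
      · intro h0
        have := congrArg (fun q => Polynomial.coeff q 1) h0
        simp [hη.ne'] at this
      · simp
        linear_combination h

theorem energy_sortDesc_ne
    (hθ : (∃ t : ℝ, 0 < t ∧ θ = algebraMap ℂ K (t : ℂ)) ∨ Transcendental ℂ θ)
    {μ : Fin N → ℕ} (hμ : Antitone μ) {γ : Fin N →₀ ℕ} (hγ : γ ∈ lowerExps μ) :
    energy θ (sortDesc γ) ≠ energy θ μ := by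
  have hq : sqSum (sortDesc γ) < sqSum μ := by
    rw [sqSum_sortDesc]
    exact hγ.2
  rcases hθ with ⟨t, ht, rfl⟩ | ht
  · exact energy_ne_of_real ht (antitone_sortDesc _) hμ
      ((dominanceLE_sortDesc_iff hμ).mpr hγ.1) hq
  · exact energy_ne_of_transcendental ht (antitone_sortDesc _) hμ hq

end Parameter

end HP

/-! ### The theorem -/

theorem corollary5p7 {K : Type*} [Field K] [Algebra ℂ K] (θ : K)
    (hθ : (∃ t : ℝ, 0 < t ∧ θ = algebraMap ℂ K (t : ℂ)) ∨ Transcendental ℂ θ)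
    (N η a b : ℕ) (hN : 1 ≤ N) (hη : η ≤ N) (hab : b < a) :
    -- each `τ = (N - k, k)` with `k ≤ min η (N - η)` occurs in `V_λ`, exactly once
    (∀ k : ℕ, k ≤ min η (N - η) →
      (isotypic (K := K) (twoValued N η a b) (twoRow (N - k) k)).toRepresentation.IsIrreducible ∧
      Nonempty ((isotypic (K := K) (twoValued N η a b)
          (twoRow (N - k) k)).toRepresentation.Equiv
        (specht (K := K) (N := N) (twoRow (N - k) k)).toRepresentation)) ∧
    -- no other `τ` occurs
    (∀ τ : YoungDiagram, τ.card = N →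
      (∀ k : ℕ, k ≤ min η (N - η) → τ ≠ twoRow (N - k) k) →
      isotypic (K := K) (twoValued N η a b) τ = ⊥) ∧
    -- `V_λ` is the direct sum of these components
    (iSupIndep (fun k : Fin (min η (N - η) + 1) =>
        (isotypic (K := K) (twoValued N η a b) (twoRow (N - k) k)).toSubmodule) ∧
      ⨆ k : Fin (min η (N - η) + 1),
        (isotypic (K := K) (twoValued N η a b) (twoRow (N - k) k)).toSubmodule =
      (monomialRep (K := K) (twoValued N η a b)).toSubmodule) ∧
    -- the eigenfunctions exist: every nonzero vector of the component is a leading part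
    (∀ k : ℕ, k ≤ min η (N - η) →
      ∀ v ∈ (isotypic (K := K) (twoValued N η a b) (twoRow (N - k) k)).toSubmodule, v ≠ 0 →
        ∃ F : MvPolynomial (Fin N) K,
          IsJointEigenfunction θ (twoValued N η a b) (twoRow (N - k) k) F ∧
          leadingPart (twoValued N η a b) F = v) ∧
    -- the eigenvalue of each of them
    (∀ k : ℕ, k ≤ min η (N - η) → ∀ F : MvPolynomial (Fin N) K,
      IsJointEigenfunction θ (twoValued N η a b) (twoRow (N - k) k) F →
      ∀ m : ℕ, 1 ≤ m →
        heckmanPolychronakos θ m F =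
          (((a : K) + θ * η) ^ m * ((N : K) - η) + (b : K) ^ m * η
            - θ * ((((a : K) + θ * η) ^ m - (b : K) ^ m) / ((a : K) + θ * η - b))
              * ((η : K) * ((N : K) - η) - (k : K) * ((N : K) - k + 1))) • F) := by
  have : CharZero K := charZero_of_injective_algebraMap (algebraMap ℂ K).injective
  have hlam : Antitone (twoValued N η a b) := antitone_twoValued hab
  have hiso : ∀ k, k ≤ min η (N - η) →
      isotypic (K := K) (twoValued N η a b) (twoRow (N - k) k) = component K N η a b k :=
    fun k hk => isotypic_twoRow hη hab hk
  have hiso' : (fun k : Fin (min η (N - η) + 1) =>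
      (isotypic (K := K) (twoValued N η a b) (twoRow (N - k) k)).toSubmodule)
      = fun k : Fin (min η (N - η) + 1) => (component K N η a b k).toSubmodule :=
    funext fun k => congrArg Subrepresentation.toSubmodule (hiso k (by omega))
  -- On the `k`-th component the leading part of every `P m` is a scalar; both the existence and the
  -- eigenvalue statement rest on this.
  have heig : ∀ k, k ≤ min η (N - η) →
      ∀ v ∈ (component K N η a b k).toSubmodule, ∀ m, _ := fun k hk v hv m =>
    heckmanPolychronakos_smodEq θ hη hab (add_mul_sub_ne_zero hθ hab) m (component_le hab k hv)
      (Module.End.mem_eigenspace_iff.mp (component_le_eigenspace (by omega) hv))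
  refine ⟨fun k hk => ?_, fun τ => isotypic_eq_bot hη hab, ⟨?_, ?_⟩, fun k hk v hv h0 => ?_,
    fun k hk F hF m hm => ?_⟩
  · rw [hiso k hk]
    exact ⟨isIrreducible_component hη hab hk, nonempty_component_equiv hab hk⟩
  · rw [hiso']
    exact iSupIndep_component
  · rw [hiso']
    exact iSup_component hη hab
  · have hv' := hv
    rw [hiso k hk] at hv'
    exact exists_isJointEigenfunction hlam (fun γ hγ => energy_sortDesc_ne hθ hlam hγ)
      (component_le hab k hv') hv h0 (heig k hk v hv')
  · have hv := hF.leading_mem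
    rw [hiso k hk] at hv
    exact hF.eigenvalue hlam (component_le hab k hv) hm (heig k hk _ hv m)
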